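/- For a real number $\kappa\le 0$ let $\rho_\kappa=|\kappa|^{-1/2}$ (with $\rho_0=\infty$), let $\mathbb U_\kappa=\{z\in\mathbb C:|z|<\rho_\kappa\}$, and for a sequence $\boldsymbol x=(x_0,x_1,\dots)$ of numbers put $$f_\kappa(\boldsymbol x,z)=\sum_{n=0}^\infty a_{n,\kappa}\,x_n z^n,\qquad a_{n,\kappa}=\prod_{j=1}^n\Big[\frac{1-(j-1)\kappa}{j}\Big]^{1/2}.$$ For real $r$ with $|r|<\rho_\kappa$ let $\Phi_\kappa^r(z)=\dfrac{z-r}{1+\kappa r z}$, a conformal bijection of $\mathbb U_\kappa$ onto itself. Theorem. Let $\boldsymbol X=(X_0,X_1,\dots)$ be i.i.d. real-valued random variables with mean $0$ and variance $1$, let $\boldsymbol Z=(Z_0,Z_1,\dots)$ be i.i.d. real standard normal random variables, and let $\kappa\le 0$. Almost surely, each of the series $f_\kappa(\boldsymbol X,\cdot)$ and $f_\kappa(\boldsymbol Z,\cdot)$ converges on $\mathbb U_\kappa$ and has only finitely many zeros in every compact subset of $\mathbb U_\kappa$. Moreover, for every continuous function $\varphi:\mathbb C\to\mathbb C$ whose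 support is a compact subset of $\mathbb U_\kappa$ and every sequence of real numbers $r_m$ with $|r_m|<\rho_\kappa$ and $|r_m|\to\rho_\kappa$, the random variables $$\sum_{\xi\in\mathbb U_\kappa:\ f_\kappa(\boldsymbol X,\xi)=0}\varphi\big(\Phi_\kappa^{r_m}(\xi)\big)$$ converge in distribution, as $m\to\infty$, to $$\sum_{\xi\in\mathbb U_\kappa:\ f_\kappa(\boldsymbol Z,\xi)=0}\varphi(\xi),$$ where zeros are counted with multiplicity in both sums. -/

import Mathlib

open MeasureTheory ProbabilityTheory Filter Topology
open scoped ENNReal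

namespace RandomAnalytic

/-- The radius `ρ_κ = |κ|^{-1/2}` (it equals `∞` for `κ = 0`). -/
noncomputable def rho (κ : ℝ) : ℝ≥0∞ := (ENNReal.ofReal |κ|) ^ (-(1 / 2) : ℝ)

/-- The open disk `𝕌(0, ρ_κ)` (the whole plane for `κ = 0`). -/
def disk (κ : ℝ) : Set ℂ := {z | ‖z‖ₑ < rho κ}

/-- The coefficient `a_{n,κ} = ∏_{j=1}^n [(1 - (j - 1) κ) / j]^{1/2}`. -/
noncomputable def coeff (κ : ℝ) (n : ℕ) : ℝ :=
  ∏ j ∈ Finset.Icc 1 n, Real.sqrt ((1 - ((j : ℝ) - 1) * κ) / (j : ℝ))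

/-- The power series `f_κ(x, z) = ∑_{n ≥ 0} a_{n,κ} x_n z^n`. -/
noncomputable def series (κ : ℝ) (x : ℕ → ℂ) (z : ℂ) : ℂ :=
  ∑' n : ℕ, (coeff κ n : ℂ) * x n * z ^ n

/-- The series `f_κ(x, ·)` converges (absolutely) at every point of the disk `𝕌(0, ρ_κ)`. -/
def ConvergesOnDisk (κ : ℝ) (x : ℕ → ℂ) : Prop :=
  ∀ z ∈ disk κ, Summable fun n : ℕ => (coeff κ n : ℂ) * x n * z ^ n

/-- The zeros of `f_κ(x, ·)` in the disk `𝕌(0, ρ_κ)`. -/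
def zeroSet (κ : ℝ) (x : ℕ → ℂ) : Set ℂ := {ξ | ξ ∈ disk κ ∧ series κ x ξ = 0}

/-- Only finitely many zeros of `f_κ(x, ·)` lie in each compact subset of the disk. -/
def LocallyFiniteZeros (κ : ℝ) (x : ℕ → ℂ) : Prop :=
  ∀ K : Set ℂ, IsCompact K → K ⊆ disk κ → (zeroSet κ x ∩ K).Finite

/-- The Möbius transformation `Φ_κ^u(z) = (z - u) / (1 + κ ū z)`. -/
noncomputable def mobius (κ : ℝ) (u z : ℂ) : ℂ :=
  (z - u) / (1 + (κ : ℂ) * (starRingEnd ℂ) u * z)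

/-- The linear statistic `∑_{ξ : f_κ(x, ξ) = 0} ψ(ξ)`, the sum being over the zeros in the disk
`𝕌(0, ρ_κ)`, each counted with its multiplicity. -/
noncomputable def zeroSum (κ : ℝ) (x : ℕ → ℂ) (ψ : ℂ → ℂ) : ℂ :=
  ∑ᶠ ξ ∈ zeroSet κ x, (analyticOrderNatAt (series κ x) ξ : ℂ) * ψ ξ

end RandomAnalytic

/-! Put k(z) = ∑ a_n² z^n (`kern`), which is exp z for κ = 0 and (1 + κz)^{1/κ} for κ < 0. For
standardized uncorrelated real coefficients, E f(z) f(w) = k(zw). This kernel is quasi-invariant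
under real Möbius maps (`kern_mobius`): there is a zero-free analytic factor N_r (`normalizer`) for
which N_r(w) f(Φ^{-r}(w)) (`shifted`) again has covariance k(zw). Its zeros, with multiplicity, are
the images under Φ^r of the zeros of f, so the statistic in the theorem is a plain zero statistic of
the shifted function.

The Taylor coefficients of the shifted function at 0 are real linear combinations ∑_n c_{m,k,n} X_n.
Comparing coefficients of z^k w^l in the invariance identity gives exact orthogonality for every m:
∑_n c_{m,k,n} c_{m,l,n} is a_k² if k = l and 0 otherwise (`hasSum_taylorCoeff_shiftedTerm_mul`).
Moreover sup_n |c_{m,k,n}| → 0: by Cauchy's formula a_n² x^n is at most the mean of |k| over the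
circle |z| = x, and |k(x e^{iθ})| / k(x) → 0 off θ = 0 as x → ρ_κ², so no single term carries a
fixed share of k(x) (`exists_forall_term_le`). A Lindeberg central limit theorem
(`tendsto_integral_exp`) then shows that finitely many coefficients converge jointly to a_k Z_k, the
coefficients of f(Z, ·).

To pass to zeros, the Taylor coefficients, scaled by R^k, are viewed as a random element of ℓ¹. The
bound E|V_k| ≤ a_k, with ∑ a_k R^k < ∞, makes the tails small uniformly in m, so convergence in
distribution holds in ℓ¹ (`tendstoInDistribution_series`). By Hurwitz's theorem (`tendsto_zeroStat`)
the zero statistic is continuous on ℓ¹ off the origin, the Gaussian limit is almost surely nonzero,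
and the mapping theorem finishes the proof. -/

namespace RandomAnalytic

/-! ### Factoring out zeros and the argument principle -/

open Metric Set

/-- The quotient is taken by honest division off ξ and only its value at ξ comes from the local
factorization. Hence the identity holds for every z, even outside `U`, which later allows rewriting
`f` as a function. -/
lemma exists_eq_pow_mul {f : ℂ → ℂ} {U : Set ℂ} (hf : AnalyticOnNhd ℂ f U) {ξ : ℂ} (hξU : ξ ∈ U)
    (hξ : analyticOrderAt f ξ ≠ ⊤) :
    ∃ h : ℂ → ℂ, AnalyticOnNhd ℂ h U ∧ h ξ ≠ 0 ∧
      ∀ z, f z = (z - ξ) ^ analyticOrderNatAt f ξ * h z := by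
  obtain ⟨g, hg, hg0, hfg⟩ := (hf ξ hξU).analyticOrderAt_ne_top.1 hξ
  set n := analyticOrderNatAt f ξ
  have key : (fun z => if z = ξ then g ξ else f z / (z - ξ) ^ n) =ᶠ[𝓝 ξ] g := by
    filter_upwards [hfg] with z hz
    split_ifs with h
    · rw [h]
    · rw [hz, smul_eq_mul, mul_div_cancel_left₀ _ (pow_ne_zero _ (sub_ne_zero.2 h))]
  refine ⟨fun z => if z = ξ then g ξ else f z / (z - ξ) ^ n, fun z hz => ?_, by simpa using hg0,
    fun z => ?_⟩
  · by_cases h : z = ξ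
    · subst h
      exact hg.congr key.symm
    · have : AnalyticAt ℂ (fun z => f z / (z - ξ) ^ n) z :=
        (hf z hz).div (by fun_prop) (pow_ne_zero _ (sub_ne_zero.2 h))
      refine this.congr ?_
      filter_upwards [isOpen_ne.mem_nhds h] with y hy
      rw [if_neg hy]
  · by_cases h : z = ξ
    · subst h
      simpa using hfg.self_of_nhds
    · simp only [h, if_false]
      field_simp [pow_ne_zero _ (sub_ne_zero.2 h)]

/-- Zeros are removed one at a time. The product over the zeros already removed does not vanish at
the next one, so the order there is unchanged (`hord`). -/
lemma exists_eq_prod_mul {f : ℂ → ℂ} {U : Set ℂ} (hf : AnalyticOnNhd ℂ f U) (T : Finset ℂ)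
    (hTU : ∀ ξ ∈ T, ξ ∈ U) (hT : ∀ ξ ∈ T, analyticOrderAt f ξ ≠ ⊤) :
    ∃ h : ℂ → ℂ, AnalyticOnNhd ℂ h U ∧ (∀ ξ ∈ T, h ξ ≠ 0) ∧
      ∀ z, f z = (∏ ξ ∈ T, (z - ξ) ^ analyticOrderNatAt f ξ) * h z := by
  classical
  induction T using Finset.induction_on with
  | empty => exact ⟨f, hf, by simp, by simp⟩
  | insert ξ T hξT ih =>
    obtain ⟨h, hh, hne, hfac⟩ := ih (fun η hη => hTU η (Finset.mem_insert_of_mem hη))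
      (fun η hη => hT η (Finset.mem_insert_of_mem hη))
    have hξU := hTU ξ (Finset.mem_insert_self _ _)
    have hord : analyticOrderAt f ξ = analyticOrderAt h ξ := by
      have h1 : AnalyticAt ℂ (fun z => ∏ η ∈ T, (z - η) ^ analyticOrderNatAt f η) ξ := by
        fun_prop
      have h2 : f = (fun z => ∏ η ∈ T, (z - η) ^ analyticOrderNatAt f η) * h :=
        funext fun z => hfac z
      have h3 : analyticOrderAt (fun z => ∏ η ∈ T, (z - η) ^ analyticOrderNatAt f η) ξ = 0 := by
        rw [h1.analyticOrderAt_eq_zero, Finset.prod_ne_zero_iff]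
        intro η hη
        refine pow_ne_zero _ (sub_ne_zero.2 ?_)
        rintro rfl
        exact hξT hη
      conv_lhs => rw [h2]
      rw [analyticOrderAt_mul h1 (hh ξ hξU), h3, zero_add]
    have hord' : analyticOrderNatAt f ξ = analyticOrderNatAt h ξ := by
      simp only [analyticOrderNatAt, hord]
    obtain ⟨h', hh', hne', hfac'⟩ := exists_eq_pow_mul hh hξU
      (hord ▸ hT ξ (Finset.mem_insert_self _ _))
    refine ⟨h', hh', ?_, fun z => ?_⟩
    · intro η hη
      rcases Finset.mem_insert.1 hη with rfl | hη
      · exact hne'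
      · intro h0
        exact hne η hη (by rw [hfac' η, h0, mul_zero])
    · rw [hfac z, hfac' z, Finset.prod_insert hξT, hord']
      ring

lemma finite_zeros_inter {f : ℂ → ℂ} {U K : Set ℂ} (hf : AnalyticOnNhd ℂ f U)
    (hU : IsPreconnected U) (hne : ∃ z ∈ U, f z ≠ 0) (hK : IsCompact K) (hKU : K ⊆ U) :
    ({z | f z = 0} ∩ K).Finite := by
  by_contra hinf
  obtain ⟨z, hzK, hz⟩ := Set.Infinite.exists_accPt_of_subset_isCompact hinf hK inter_subset_right
  obtain ⟨w, hw, hw0⟩ := hne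
  refine hw0 (hf.eqOn_zero_of_preconnected_of_frequently_eq_zero hU (hKU hzK) ?_ hw)
  rw [accPt_iff_frequently_nhdsNE] at hz
  exact hz.mono fun y hy => hy.1

lemma analyticOrderAt_ne_top_of_ne_zero {f : ℂ → ℂ} {U : Set ℂ} (hf : AnalyticOnNhd ℂ f U)
    (hU : IsPreconnected U) (hne : ∃ z ∈ U, f z ≠ 0) {ξ : ℂ} (hξ : ξ ∈ U) :
    analyticOrderAt f ξ ≠ ⊤ := by
  intro h
  obtain ⟨w, hw, hw0⟩ := hne
  exact hw0 (hf.eqOn_zero_of_preconnected_of_eventuallyEq_zero hU hξ (analyticOrderAt_eq_top.1 h) hw)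

/-- The argument principle on a disk, for functions without zeros on its boundary. -/
lemma circleIntegral_deriv_div {f : ℂ → ℂ} {c : ℂ} {r : ℝ} (hr : 0 < r)
    (hf : AnalyticOnNhd ℂ f (closedBall c r)) (hs : ∀ z ∈ sphere c r, f z ≠ 0) :
    ∮ z in C(c, r), deriv f z / f z =
      2 * Real.pi * Complex.I * ∑ᶠ ξ ∈ ball c r, (analyticOrderNatAt f ξ : ℂ) := by
  have hconn : IsPreconnected (closedBall c r) := (convex_closedBall c r).isPreconnected
  obtain ⟨w, hw⟩ : (sphere c r).Nonempty := NormedSpace.sphere_nonempty.mpr hr.le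
  have hne : ∃ z ∈ closedBall c r, f z ≠ 0 := ⟨w, sphere_subset_closedBall hw, hs w hw⟩
  have hfin : ({z | f z = 0} ∩ closedBall c r).Finite :=
    finite_zeros_inter hf hconn hne (isCompact_closedBall c r) subset_rfl
  set T := hfin.toFinset
  have hmT : ∀ z, z ∈ T ↔ f z = 0 ∧ z ∈ closedBall c r := fun z => by simp [T]
  have hTb : ∀ z ∈ T, z ∈ ball c r := by
    intro z hz
    rw [hmT] at hz
    rcases lt_or_eq_of_le (mem_closedBall.1 hz.2) with h | h
    · exact h
    · exact absurd hz.1 (hs z h)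
  obtain ⟨h, hh, hhne, hfac⟩ := exists_eq_prod_mul hf T (fun ξ hξ => ((hmT ξ).1 hξ).2)
    (fun ξ hξ => analyticOrderAt_ne_top_of_ne_zero hf hconn hne ((hmT ξ).1 hξ).2)
  have hh0 : ∀ z ∈ closedBall c r, h z ≠ 0 := by
    intro z hz hz0
    by_cases hzT : z ∈ T
    · exact hhne z hzT hz0
    · exact hzT ((hmT z).2 ⟨by rw [hfac z, hz0, mul_zero], hz⟩)
  have hsum : ∑ᶠ ξ ∈ ball c r, (analyticOrderNatAt f ξ : ℂ) =
      ∑ ξ ∈ T, (analyticOrderNatAt f ξ : ℂ) := by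
    refine finsum_mem_eq_sum_of_inter_support_eq _ ?_
    ext z
    simp only [mem_inter_iff, Function.mem_support, Finset.mem_coe, Nat.cast_ne_zero]
    constructor
    · rintro ⟨h1, h2⟩
      exact ⟨(hmT z).2 ⟨apply_eq_zero_of_analyticOrderNatAt_ne_zero h2, ball_subset_closedBall h1⟩,
        h2⟩
    · rintro ⟨h1, h2⟩
      exact ⟨hTb z h1, h2⟩
  -- The logarithmic derivative turns the factorization into simple poles plus `h' / h`. The latter
  -- is analytic on the closed disk and integrates to zero; each pole contributes 2πi times its
  -- order.
  have hlog : EqOn (fun z => deriv f z / f z)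
      (fun z => (∑ ξ ∈ T, (analyticOrderNatAt f ξ : ℂ) * (z - ξ)⁻¹) + deriv h z / h z)
      (sphere c r) := by
    intro z hz
    have hz' := sphere_subset_closedBall hz
    have hzT : ∀ ξ ∈ T, z - ξ ≠ 0 := by
      intro ξ hξ h0
      rw [sub_eq_zero] at h0
      exact hs z hz (h0 ▸ ((hmT ξ).1 hξ).1)
    have hfe : f = fun z => (∏ ξ ∈ T, (z - ξ) ^ analyticOrderNatAt f ξ) * h z := funext hfac
    change logDeriv f z = _ + logDeriv h z
    conv_lhs => rw [hfe]
    rw [logDeriv_mul (f := fun z => ∏ ξ ∈ T, (z - ξ) ^ analyticOrderNatAt f ξ) z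
      (Finset.prod_ne_zero_iff.2 fun ξ hξ => pow_ne_zero _ (hzT ξ hξ)) (hh0 z hz')
      (by fun_prop) (hh z hz').differentiableAt]
    congr 1
    rw [logDeriv_prod (f := fun ξ z => (z - ξ) ^ analyticOrderNatAt f ξ)
      (fun ξ hξ => pow_ne_zero _ (hzT ξ hξ)) (fun ξ _ => by fun_prop)]
    refine Finset.sum_congr rfl fun ξ _ => ?_
    rw [logDeriv_fun_pow (by fun_prop), logDeriv_apply]
    simp
  have hi1 : ∀ ξ ∈ T, CircleIntegrable (fun z => (analyticOrderNatAt f ξ : ℂ) * (z - ξ)⁻¹) c r := by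
    intro ξ hξ
    refine ContinuousOn.circleIntegrable hr.le ?_
    refine continuousOn_const.mul (ContinuousOn.inv₀ (by fun_prop) ?_)
    intro z hz h0
    rw [sub_eq_zero] at h0
    exact hs z hz (h0 ▸ ((hmT ξ).1 hξ).1)
  have han : AnalyticOnNhd ℂ (fun z => deriv h z / h z) (closedBall c r) :=
    hh.deriv.div hh hh0
  have hi2 : CircleIntegrable (fun z => deriv h z / h z) c r :=
    (han.continuousOn.mono sphere_subset_closedBall).circleIntegrable hr.le
  have hi3 : ∮ z in C(c, r), deriv h z / h z = 0 :=
    Complex.circleIntegral_eq_zero_of_differentiable_on_off_countable hr.le countable_empty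
      han.continuousOn
      (fun z hz => (han z (ball_subset_closedBall hz.1)).differentiableAt)
  rw [circleIntegral.integral_congr hr.le hlog, circleIntegral.integral_add _ hi2, hi3, add_zero,
    circleIntegral.integral_fun_sum hi1, hsum, Finset.mul_sum]
  · refine Finset.sum_congr rfl fun ξ hξ => ?_
    rw [circleIntegral.integral_const_mul, circleIntegral.integral_sub_inv_of_mem_ball (hTb ξ hξ)]
    ring
  · exact CircleIntegrable.fun_sum T hi1

end RandomAnalytic

/-! ### Hurwitz's theorem for linear statistics of zeros -/

namespace RandomAnalytic

open Metric Set

variable {ι : Type*} {l : Filter ι} {F : ι → ℂ → ℂ} {f : ℂ → ℂ} {U : Set ℂ}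

lemma eventually_ne_zero_on_compact (hlim : TendstoLocallyUniformlyOn F f l U) (hU : IsOpen U)
    (hf : ContinuousOn f U) {K : Set ℂ} (hK : IsCompact K) (hKU : K ⊆ U)
    (h0 : ∀ z ∈ K, f z ≠ 0) : ∀ᶠ i in l, ∀ z ∈ K, F i z ≠ 0 := by
  rcases K.eq_empty_or_nonempty with rfl | hKne
  · simp
  obtain ⟨w, hw, hmin⟩ := hK.exists_isMinOn hKne (hf.mono hKU).norm
  have hu := (tendstoLocallyUniformlyOn_iff_forall_isCompact hU).1 hlim K hKU hK
  rw [Metric.tendstoUniformlyOn_iff] at hu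
  filter_upwards [hu ‖f w‖ (norm_pos_iff.2 (h0 w hw))] with i hi z hz hz0
  have h1 := hi z hz
  rw [hz0, dist_zero_right] at h1
  exact absurd (hmin hz) (not_le.2 h1)

/-- By the argument principle the count is a circle integral of the logarithmic derivative. Locally
uniform convergence passes to derivatives, and to the quotients because the limit has no zero on the
circle. -/
lemma tendsto_zero_count [l.IsCountablyGenerated] (hU : IsOpen U)
    (hF : ∀ᶠ i in l, AnalyticOnNhd ℂ (F i) U) (hf : AnalyticOnNhd ℂ f U)
    (hlim : TendstoLocallyUniformlyOn F f l U) {c : ℂ} {r : ℝ} (hr : 0 < r)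
    (hcr : closedBall c r ⊆ U) (hs : ∀ z ∈ sphere c r, f z ≠ 0) :
    Tendsto (fun i => ∑ᶠ ξ ∈ ball c r, (analyticOrderNatAt (F i) ξ : ℂ)) l
      (𝓝 (∑ᶠ ξ ∈ ball c r, (analyticOrderNatAt f ξ : ℂ))) := by
  have hsU : sphere c r ⊆ U := sphere_subset_closedBall.trans hcr
  have hne := eventually_ne_zero_on_compact hlim hU hf.continuousOn (isCompact_sphere c r) hsU hs
  have hder := (hlim.deriv (hF.mono fun i hi => hi.differentiableOn) hU).mono hsU
  have hdiv : TendstoUniformlyOn (fun i z => deriv (F i) z / F i z) (fun z => deriv f z / f z) l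
      (sphere c r) := by
    have := TendstoLocallyUniformlyOn.div₀ hder (hlim.mono hsU)
      (hf.deriv.continuousOn.mono hsU) (hf.continuousOn.mono hsU) hs
    exact (tendstoLocallyUniformlyOn_iff_tendstoUniformlyOn_of_compact
      (isCompact_sphere c r)).1 this
  have hint := hdiv.tendsto_circleIntegral_of_continuousOn hr.le (by
    filter_upwards [hF, hne] with i hi hi0
    exact (hi.deriv.continuousOn.mono hsU).div (hi.continuousOn.mono hsU) hi0)
  rw [circleIntegral_deriv_div hr (hf.mono hcr) hs] at hint
  have hpi : (2 * Real.pi * Complex.I : ℂ) ≠ 0 := Complex.two_pi_I_ne_zero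
  have h2 := hint.const_mul (2 * Real.pi * Complex.I : ℂ)⁻¹
  rw [inv_mul_cancel_left₀ hpi] at h2
  refine h2.congr' ?_
  filter_upwards [hF, hne] with i hi hi0
  rw [circleIntegral_deriv_div hr (hi.mono hcr) hi0, inv_mul_cancel_left₀ hpi]

/-- The sum of a test function over the zeros of `f`, counted with multiplicity. -/
noncomputable def zeroStat (f φ : ℂ → ℂ) : ℂ := ∑ᶠ ξ, (analyticOrderNatAt f ξ : ℂ) * φ ξ

lemma zeroStat_eq_sum_of_subset {φ : ℂ → ℂ} {T : Finset ℂ}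
    (hT : ∀ z, f z = 0 → z ∈ tsupport φ → z ∈ T) :
    zeroStat f φ = ∑ ξ ∈ T, (analyticOrderNatAt f ξ : ℂ) * φ ξ := by
  refine finsum_eq_sum_of_support_subset _ fun z hz => ?_
  simp only [Function.mem_support, ne_eq, mul_eq_zero, Nat.cast_eq_zero, not_or] at hz
  exact hT z (apply_eq_zero_of_analyticOrderNatAt_ne_zero hz.1) (subset_tsupport φ hz.2)

/-- Moving every zero to ξ costs ε per zero, with at most ‖N‖ + ε zeros; miscounting them costs ε‖φ
ξ‖. -/
lemma norm_sum_mul_sub_le {φ : ℂ → ℂ} {S : Finset ℂ} (n : ℂ → ℕ) {ξ : ℂ} {ε : ℝ}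
    (h : ∀ z ∈ S, ‖φ z - φ ξ‖ ≤ ε) (N : ℂ) (hN : ‖(∑ z ∈ S, (n z : ℂ)) - N‖ ≤ ε) :
    ‖(∑ z ∈ S, (n z : ℂ) * φ z) - N * φ ξ‖ ≤ ε * (‖N‖ + ε + ‖φ ξ‖) := by
  have hε : 0 ≤ ε := (norm_nonneg _).trans hN
  have h1 : (∑ z ∈ S, (n z : ℂ) * φ z) - N * φ ξ =
      (∑ z ∈ S, (n z : ℂ) * (φ z - φ ξ)) + ((∑ z ∈ S, (n z : ℂ)) - N) * φ ξ := by
    simp only [mul_sub, Finset.sum_sub_distrib, sub_mul, Finset.sum_mul]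
    ring
  have h2 : ‖∑ z ∈ S, (n z : ℂ) * (φ z - φ ξ)‖ ≤ (∑ z ∈ S, (n z : ℝ)) * ε := by
    rw [Finset.sum_mul]
    refine norm_sum_le_of_le _ fun z hz => ?_
    rw [norm_mul, Complex.norm_natCast]
    exact mul_le_mul_of_nonneg_left (h z hz) (Nat.cast_nonneg _)
  have h3 : (∑ z ∈ S, (n z : ℝ)) ≤ ‖N‖ + ε := by
    have h4 : ‖(∑ z ∈ S, (n z : ℂ))‖ = ∑ z ∈ S, (n z : ℝ) := by
      rw [← Nat.cast_sum, Complex.norm_natCast, Nat.cast_sum]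
    rw [← h4]
    calc ‖(∑ z ∈ S, (n z : ℂ))‖ = ‖N + ((∑ z ∈ S, (n z : ℂ)) - N)‖ := by ring_nf
      _ ≤ ‖N‖ + ε := (norm_add_le _ _).trans (by gcongr)
  rw [h1]
  calc _ ≤ (∑ z ∈ S, (n z : ℝ)) * ε + ε * ‖φ ξ‖ := by
        refine (norm_add_le _ _).trans (add_le_add h2 ?_)
        rw [norm_mul]
        gcongr
    _ ≤ (‖N‖ + ε) * ε + ε * ‖φ ξ‖ := by gcongr
    _ = _ := by ring

/-- A version of Hurwitz's theorem: linear statistics of the zeros, counted with multiplicity, are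
continuous under locally uniform convergence to a function that does not vanish identically. -/
theorem tendsto_zeroStat [l.IsCountablyGenerated] (hU : IsOpen U) (hUc : IsPreconnected U)
    (hF : ∀ᶠ i in l, AnalyticOnNhd ℂ (F i) U) (hf : AnalyticOnNhd ℂ f U)
    (hne : ∃ z ∈ U, f z ≠ 0) (hlim : TendstoLocallyUniformlyOn F f l U) {φ : ℂ → ℂ}
    (hφ : Continuous φ) (hφc : HasCompactSupport φ) (hφU : tsupport φ ⊆ U) :
    Tendsto (fun i => zeroStat (F i) φ) l (𝓝 (zeroStat f φ)) := by
  classical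
  have hfin := finite_zeros_inter hf hUc hne hφc hφU
  set T := hfin.toFinset
  have hmT : ∀ z, z ∈ T ↔ f z = 0 ∧ z ∈ tsupport φ := fun z => by simp [T]
  set N : ℂ → ℂ := fun ξ => (analyticOrderNatAt f ξ : ℂ)
  -- The sum over the limiting zeros of the error factors in `norm_sum_mul_sub_le`, with ε there
  -- replaced by its upper bound 1.
  set C : ℝ := ∑ ξ ∈ T, (‖N ξ‖ + 1 + ‖φ ξ‖)
  have hC : 0 ≤ C := Finset.sum_nonneg fun ξ _ => by positivity
  rw [Metric.tendsto_nhds]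
  intro δ hδ
  obtain ⟨ε, hε0, hε1, hεC⟩ : ∃ ε : ℝ, 0 < ε ∧ ε ≤ 1 ∧ ε * C < δ := by
    refine ⟨min 1 (δ / (C + 1)), by positivity, min_le_left _ _, ?_⟩
    calc min 1 (δ / (C + 1)) * C ≤ δ / (C + 1) * C := by gcongr; exact min_le_right _ _
      _ < δ := by
        rw [div_mul_eq_mul_div, div_lt_iff₀ (by positivity)]
        nlinarith
  -- a common radius for small disks around the zeros
  have hsmall : ∀ ξ ∈ T, ∀ᶠ r in 𝓝[>] (0 : ℝ), closedBall ξ r ⊆ U ∧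
      (∀ z ∈ closedBall ξ r, z ≠ ξ → f z ≠ 0) ∧ (∀ z ∈ closedBall ξ r, ‖φ z - φ ξ‖ ≤ ε) := by
    intro ξ hξ
    have hξU : ξ ∈ U := hφU ((hmT ξ).1 hξ).2
    have h1 : ∀ᶠ z in 𝓝 ξ, z ∈ U ∧ (z ≠ ξ → f z ≠ 0) ∧ ‖φ z - φ ξ‖ ≤ ε := by
      refine (hU.eventually_mem hξU).and (Eventually.and ?_ ?_)
      · rcases (hf ξ hξU).eventually_eq_zero_or_eventually_ne_zero with h | h
        · exact absurd (analyticOrderAt_eq_top.2 h)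
            (analyticOrderAt_ne_top_of_ne_zero hf hUc hne hξU)
        · exact eventually_nhdsWithin_iff.1 h
      · have : Tendsto (fun z => ‖φ z - φ ξ‖) (𝓝 ξ) (𝓝 0) := by
          have := ((hφ.tendsto ξ).sub_const (φ ξ)).norm
          simpa using this
        exact this.eventually (Iic_mem_nhds hε0)
    obtain ⟨r₀, hr₀, hball⟩ := Metric.nhds_basis_closedBall.mem_iff.1 h1
    filter_upwards [Ioc_mem_nhdsGT hr₀] with r hr
    have hsub : closedBall ξ r ⊆ closedBall ξ r₀ := closedBall_subset_closedBall hr.2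
    exact ⟨fun z hz => (hball (hsub hz)).1, fun z hz => (hball (hsub hz)).2.1,
      fun z hz => (hball (hsub hz)).2.2⟩
  have hdisj : ∀ᶠ r in 𝓝[>] (0 : ℝ), ∀ ξ ∈ T, ∀ η ∈ T, ξ ≠ η →
      Disjoint (ball ξ r) (ball η r) := by
    rw [Finset.eventually_all]
    intro ξ _
    rw [Finset.eventually_all]
    intro η _
    by_cases h : ξ = η
    · simp [h]
    · filter_upwards [Ioc_mem_nhdsGT (half_pos (dist_pos.2 h))] with r hr _
      refine ball_disjoint_ball ?_
      linarith [hr.2]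
  obtain ⟨r, ⟨hr1, hr2⟩, hr0⟩ := (((Finset.eventually_all T).2 hsmall).and hdisj).and
    (self_mem_nhdsWithin) |>.exists
  have hr0 : 0 < r := hr0
  -- away from the disks there are no zeros
  set K := tsupport φ \ ⋃ ξ ∈ T, ball ξ r with hKdef
  have hK : IsCompact K :=
    hφc.diff (isOpen_biUnion fun ξ _ => isOpen_ball)
  have hK0 : ∀ z ∈ K, f z ≠ 0 := by
    intro z hz hz0
    exact hz.2 (mem_biUnion ((hmT z).2 ⟨hz0, hz.1⟩) (mem_ball_self hr0))
  have hevK := eventually_ne_zero_on_compact hlim hU hf.continuousOn hK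
    (sdiff_subset.trans hφU) hK0
  have hsph : ∀ ξ ∈ T, ∀ z ∈ sphere ξ r, f z ≠ 0 := fun ξ hξ z hz =>
    (hr1 ξ hξ).2.1 z (sphere_subset_closedBall hz) (by
      rintro rfl
      simp [hr0.ne] at hz)
  have hcount : ∀ ξ ∈ T, ∀ᶠ i in l,
      ‖(∑ᶠ z ∈ ball ξ r, (analyticOrderNatAt (F i) z : ℂ)) - N ξ‖ ≤ ε ∧
      (∀ z ∈ sphere ξ r, F i z ≠ 0) := by
    intro ξ hξ
    have h1 := tendsto_zero_count hU hF hf hlim hr0 (hr1 ξ hξ).1 (hsph ξ hξ)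
    have h2 : ∑ᶠ z ∈ ball ξ r, (analyticOrderNatAt f z : ℂ) = N ξ := by
      rw [finsum_mem_eq_sum_of_inter_support_eq (t := {ξ})]
      · simp [N]
      · ext z
        simp only [mem_inter_iff, Function.mem_support, Finset.mem_coe, Nat.cast_ne_zero,
          Finset.mem_singleton]
        constructor
        · rintro ⟨hz, hz0⟩
          refine ⟨?_, hz0⟩
          by_contra hzξ
          exact (hr1 ξ hξ).2.1 z (ball_subset_closedBall hz) hzξ
            (apply_eq_zero_of_analyticOrderNatAt_ne_zero hz0)
        · rintro ⟨rfl, hz0⟩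
          exact ⟨mem_ball_self hr0, hz0⟩
    rw [h2] at h1
    refine Eventually.and ?_ ?_
    · rw [Metric.tendsto_nhds] at h1
      filter_upwards [h1 ε hε0] with i hi
      rw [← dist_eq_norm]
      exact hi.le
    · exact eventually_ne_zero_on_compact hlim hU hf.continuousOn (isCompact_sphere ξ r)
        (sphere_subset_closedBall.trans (hr1 ξ hξ).1) (hsph ξ hξ)
  filter_upwards [hF, hevK, (Finset.eventually_all T).2 hcount] with i hi hiK hic
  -- the zeros of `F i` in each of the small disks
  have hZfin : ∀ ξ ∈ T, ({z | F i z = 0} ∩ closedBall ξ r).Finite := by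
    intro ξ hξ
    refine finite_zeros_inter (hi.mono (hr1 ξ hξ).1) (convex_closedBall ξ r).isPreconnected ?_
      (isCompact_closedBall ξ r) subset_rfl
    obtain ⟨w, hw⟩ : (sphere ξ r).Nonempty := NormedSpace.sphere_nonempty.mpr hr0.le
    exact ⟨w, sphere_subset_closedBall hw, (hic ξ hξ).2 w hw⟩
  have hZfin' : ∀ ξ ∈ T, ({z | F i z = 0} ∩ ball ξ r).Finite := fun ξ hξ =>
    (hZfin ξ hξ).subset (inter_subset_inter_right _ ball_subset_closedBall)
  -- The default ∅ is never used for ξ in `T`; it only makes `Z` a total function.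
  set Z : ℂ → Finset ℂ := fun ξ =>
    if h : ({z | F i z = 0} ∩ ball ξ r).Finite then h.toFinset else ∅ with hZdef
  have hmZ : ∀ ξ ∈ T, ∀ z, z ∈ Z ξ ↔ F i z = 0 ∧ z ∈ ball ξ r := by
    intro ξ hξ z
    simp only [hZdef, dif_pos (hZfin' ξ hξ), Finite.mem_toFinset]
    rfl
  have hsumF : zeroStat (F i) φ =
      ∑ ξ ∈ T, ∑ z ∈ Z ξ, (analyticOrderNatAt (F i) z : ℂ) * φ z := by
    rw [zeroStat_eq_sum_of_subset (T := T.biUnion Z), Finset.sum_biUnion]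
    · intro ξ hξ η hη hξη
      rw [Function.onFun, Finset.disjoint_left]
      intro z hz hz'
      exact Set.disjoint_left.1 (hr2 ξ hξ η hη hξη) ((hmZ ξ hξ z).1 hz).2 ((hmZ η hη z).1 hz').2
    · intro z hz hzφ
      by_cases hzK : z ∈ K
      · exact absurd hz (hiK z hzK)
      · have : z ∈ ⋃ ξ ∈ T, ball ξ r := by
          by_contra h
          exact hzK ⟨hzφ, h⟩
        simp only [mem_iUnion] at this
        obtain ⟨ξ, hξ, hzξ⟩ := this
        exact Finset.mem_biUnion.2 ⟨ξ, hξ, (hmZ ξ hξ z).2 ⟨hz, hzξ⟩⟩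
  have hsumf : zeroStat f φ = ∑ ξ ∈ T, N ξ * φ ξ :=
    zeroStat_eq_sum_of_subset fun z hz hzφ => (hmT z).2 ⟨hz, hzφ⟩
  rw [dist_eq_norm, hsumF, hsumf, ← Finset.sum_sub_distrib]
  refine lt_of_le_of_lt ?_ hεC
  rw [Finset.mul_sum]
  refine norm_sum_le_of_le _ fun ξ hξ => ?_
  have hcnt : ∑ᶠ z ∈ ball ξ r, (analyticOrderNatAt (F i) z : ℂ) =
      ∑ z ∈ Z ξ, (analyticOrderNatAt (F i) z : ℂ) := by
    refine finsum_mem_eq_sum_of_inter_support_eq _ ?_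
    ext z
    simp only [mem_inter_iff, Function.mem_support, Finset.mem_coe, Nat.cast_ne_zero, hmZ ξ hξ]
    constructor
    · rintro ⟨h1, h2⟩
      exact ⟨⟨apply_eq_zero_of_analyticOrderNatAt_ne_zero h2, h1⟩, h2⟩
    · rintro ⟨⟨_, h1⟩, h2⟩
      exact ⟨h1, h2⟩
  refine (norm_sum_mul_sub_le (analyticOrderNatAt (F i))
    (fun z hz => (hr1 ξ hξ).2.2 z (ball_subset_closedBall ((hmZ ξ hξ z).1 hz).2)) (N ξ)
    (hcnt ▸ (hic ξ hξ).1)).trans ?_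
  gcongr

end RandomAnalytic

/-! ### Weak convergence and a central limit theorem for infinite linear combinations -/

namespace RandomAnalytic

section Weak

variable {Ω Ω' E F : Type*} [MeasurableSpace Ω] [MeasurableSpace Ω']
  {P : Measure Ω} [IsProbabilityMeasure P] {P' : Measure Ω'} [IsProbabilityMeasure P']

/-- The mapping theorem for maps that are continuous on an open set of full limit measure. -/
lemma tendstoInDistribution_comp_of_continuousOn [PseudoEMetricSpace E] [MeasurableSpace E]
    [BorelSpace E] [TopologicalSpace F] [MeasurableSpace F] [BorelSpace F]
    {V : ℕ → Ω → E} {W : Ω' → E} (h : TendstoInDistribution V atTop W (fun _ => P) P')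
    {S : E → F} {U : Set E} (hS : ContinuousOn S U) (hU : IsOpen U) (hSm : Measurable S)
    (hW : ∀ᵐ ω ∂P', W ω ∈ U) :
    TendstoInDistribution (fun n ω => S (V n ω)) atTop (fun ω => S (W ω)) (fun _ => P) P' where
  forall_aemeasurable n := hSm.comp_aemeasurable (h.forall_aemeasurable n)
  aemeasurable_limit := hSm.comp_aemeasurable h.aemeasurable_limit
  tendsto := by
    refine tendsto_of_forall_isClosed_limsup_le' fun C hC => ?_
    have h1 := ProbabilityMeasure.limsup_measure_closed_le_of_tendsto h.tendsto
      (isClosed_closure (s := S ⁻¹' C))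
    have hCm : MeasurableSet C := hC.measurableSet
    simp only [ProbabilityMeasure.coe_mk] at h1 ⊢
    calc limsup (fun n => (P.map fun ω => S (V n ω)) C) atTop
        ≤ limsup (fun n => (P.map (V n)) (closure (S ⁻¹' C))) atTop := by
          refine limsup_le_limsup (Eventually.of_forall fun n => ?_)
          have hSV : AEMeasurable (fun ω => S (V n ω)) P :=
            hSm.comp_aemeasurable (h.forall_aemeasurable n)
          beta_reduce
          rw [Measure.map_apply_of_aemeasurable hSV hCm,
            Measure.map_apply_of_aemeasurable (h.forall_aemeasurable n)
            isClosed_closure.measurableSet]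
          exact measure_mono fun ω hω => subset_closure hω
      _ ≤ (P'.map W) (closure (S ⁻¹' C)) := h1
      _ ≤ (P'.map fun ω => S (W ω)) C := by
          have hSW : AEMeasurable (fun ω => S (W ω)) P' :=
            hSm.comp_aemeasurable h.aemeasurable_limit
          rw [Measure.map_apply_of_aemeasurable hSW hCm,
            Measure.map_apply_of_aemeasurable h.aemeasurable_limit isClosed_closure.measurableSet]
          -- At a point of `U`, continuity of `S` forces a limit of points of `S ⁻¹' C` to lie in `S
          -- ⁻¹' C`, so taking the closure adds only a null set for the limit law.
          refine measure_mono_ae ?_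
          filter_upwards [hW] with ω hω hcl
          have hcl : W ω ∈ closure (S ⁻¹' C) := hcl
          have hc : ContinuousAt S (W ω) := hS.continuousAt (hU.mem_nhds hω)
          exact hC.closure_subset_iff.2 subset_rfl
            (hc.continuousWithinAt.mem_closure hcl fun x hx => hx)

/-- Lipschitz test functions have close means on variables that are close in mean. -/
lemma edist_integral_comp_le [NormedAddCommGroup E] [MeasurableSpace E] [BorelSpace E]
    {f : E → ℝ} {B : ℝ} (hB : ∀ x y, dist (f x) (f y) ≤ B) {L : NNReal} (hL : LipschitzWith L f)
    {Y Y' : Ω → E} (hY : AEMeasurable Y P) (hY' : AEMeasurable Y' P) :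
    edist (∫ ω, f (Y ω) ∂P) (∫ ω, f (Y' ω) ∂P) ≤ L * ∫⁻ ω, edist (Y ω) (Y' ω) ∂P := by
  have hint : ∀ Y : Ω → E, AEMeasurable Y P → Integrable (fun ω => f (Y ω)) P := by
    intro Y hY
    refine Integrable.of_bound (hL.continuous.measurable.comp_aemeasurable hY).aestronglyMeasurable
      (|f 0| + B) (ae_of_all _ fun ω => ?_)
    have h1 := hB (Y ω) 0
    rw [Real.dist_eq] at h1
    rw [Real.norm_eq_abs]
    have := abs_sub_abs_le_abs_sub (f (Y ω)) (f 0)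
    linarith
  rw [edist_eq_enorm_sub, ← integral_sub (hint Y hY) (hint Y' hY')]
  refine (enorm_integral_le_lintegral_enorm _).trans ?_
  rw [← lintegral_const_mul' _ _ ENNReal.coe_ne_top]
  refine lintegral_mono fun ω => ?_
  rw [← edist_eq_enorm_sub]
  exact hL (Y ω) (Y' ω)

/-- Convergence in distribution follows from that of approximations that are uniformly close in
mean. -/
lemma tendstoInDistribution_of_approx [NormedAddCommGroup E] [MeasurableSpace E] [BorelSpace E]
    {V : ℕ → Ω → E} {W : Ω' → E} {VK : ℕ → ℕ → Ω → E} {WK : ℕ → Ω' → E}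
    (hV : ∀ m, AEMeasurable (V m) P) (hW : AEMeasurable W P')
    (hK : ∀ K, TendstoInDistribution (VK K) atTop (WK K) (fun _ => P) P')
    {η : ℕ → ℝ≥0∞} (hη : Tendsto η atTop (𝓝 0))
    (hVK : ∀ K m, ∫⁻ ω, edist (V m ω) (VK K m ω) ∂P ≤ η K)
    (hWK : ∀ K, ∫⁻ ω, edist (W ω) (WK K ω) ∂P' ≤ η K) :
    TendstoInDistribution V atTop W (fun _ => P) P' where
  forall_aemeasurable := hV
  aemeasurable_limit := hW
  tendsto := by
    refine tendsto_iff_forall_lipschitz_integral_tendsto.2 ?_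
    rintro f ⟨B, hB⟩ ⟨L, hL⟩
    have hfc := hL.continuous
    have hη' : Tendsto (fun K => (L : ℝ≥0∞) * η K) atTop (𝓝 0) := by
      have := ENNReal.Tendsto.const_mul hη (Or.inr (ENNReal.coe_ne_top (r := L)))
      simpa using this
    simp only [ProbabilityMeasure.coe_mk]
    have hVint : ∀ m, ∫ x, f x ∂(P.map (V m)) = ∫ ω, f (V m ω) ∂P := fun m =>
      integral_map (hV m) hfc.aestronglyMeasurable
    have hWint : ∫ x, f x ∂(P'.map W) = ∫ ω, f (W ω) ∂P' :=
      integral_map hW hfc.aestronglyMeasurable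
    simp only [hVint, hWint]
    rw [EMetric.tendsto_nhds]
    intro ε hε
    have hε3 : 0 < ε / 3 := ENNReal.div_pos hε.ne' (by simp)
    obtain ⟨K, hKε⟩ := (hη'.eventually (gt_mem_nhds hε3)).exists
    have hKt := tendsto_iff_forall_lipschitz_integral_tendsto.1 (hK K).tendsto f ⟨B, hB⟩ ⟨L, hL⟩
    simp only [ProbabilityMeasure.coe_mk] at hKt
    have hVKm := (hK K).forall_aemeasurable
    have hWKm := (hK K).aemeasurable_limit
    have hVKint : ∀ m, ∫ x, f x ∂(P.map (VK K m)) = ∫ ω, f (VK K m ω) ∂P := fun m =>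
      integral_map (hVKm m) hfc.aestronglyMeasurable
    have hWKint : ∫ x, f x ∂(P'.map (WK K)) = ∫ ω, f (WK K ω) ∂P' :=
      integral_map hWKm hfc.aestronglyMeasurable
    simp only [hVKint, hWKint] at hKt
    rw [EMetric.tendsto_nhds] at hKt
    filter_upwards [hKt (ε / 3) hε3] with m hm
    have h1 : edist (∫ ω, f (V m ω) ∂P) (∫ ω, f (VK K m ω) ∂P) < ε / 3 :=
      ((edist_integral_comp_le hB hL (hV m) (hVKm m)).trans (by gcongr; exact hVK K m)).trans_lt hKε
    have h2 : edist (∫ ω, f (WK K ω) ∂P') (∫ ω, f (W ω) ∂P') < ε / 3 := by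
      rw [edist_comm]
      exact ((edist_integral_comp_le hB hL hW hWKm).trans (by gcongr; exact hWK K)).trans_lt hKε
    calc _ ≤ edist (∫ ω, f (V m ω) ∂P) (∫ ω, f (VK K m ω) ∂P) +
          edist (∫ ω, f (VK K m ω) ∂P) (∫ ω, f (WK K ω) ∂P') +
          edist (∫ ω, f (WK K ω) ∂P') (∫ ω, f (W ω) ∂P') := edist_triangle4 _ _ _ _
      _ < ε / 3 + ε / 3 + ε / 3 := ENNReal.add_lt_add (ENNReal.add_lt_add h1 hm) h2
      _ = ε := ENNReal.add_thirds ε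

end Weak

/-- Independent identically distributed real random variables with mean zero and variance one. -/
structure IsStandardIID {Ω : Type*} [MeasurableSpace Ω] (X : ℕ → Ω → ℝ) (P : Measure Ω) :
    Prop where
  indep : iIndepFun X P
  ident : ∀ n, IdentDistrib (X n) (X 0) P P
  memLp : MemLp (X 0) 2 P
  mean : ∫ ω, X 0 ω ∂P = 0
  var : Var[X 0; P] = 1

namespace IsStandardIID

variable {Ω : Type*} [MeasurableSpace Ω] {X : ℕ → Ω → ℝ} {P : Measure Ω}

lemma aemeasurable (h : IsStandardIID X P) (n : ℕ) : AEMeasurable (X n) P :=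
  (h.ident n).aemeasurable_fst

lemma memLp_two (h : IsStandardIID X P) (n : ℕ) : MemLp (X n) 2 P :=
  (h.ident n).memLp_iff.2 h.memLp

lemma integral_eq_zero (h : IsStandardIID X P) (n : ℕ) : ∫ ω, X n ω ∂P = 0 :=
  (h.ident n).integral_eq.trans h.mean

lemma variance_eq_one (h : IsStandardIID X P) (n : ℕ) : Var[X n; P] = 1 :=
  (h.ident n).variance_eq.trans h.var

lemma integral_sq (h : IsStandardIID X P) : ∫ ω, (X 0 ^ 2) ω ∂P = 1 := by
  have := variance_of_integral_eq_zero (h.aemeasurable 0) h.mean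
  rw [h.var] at this
  simpa using this.symm

lemma integral_sum_sq [IsProbabilityMeasure P] (h : IsStandardIID X P) (b : ℕ → ℝ) (N : ℕ) :
    ∫ ω, (∑ n ∈ Finset.range N, b n * X n ω) ^ 2 ∂P = ∑ n ∈ Finset.range N, b n ^ 2 := by
  have hmem : ∀ n, MemLp (fun ω => b n * X n ω) 2 P := fun n => (h.memLp_two n).const_mul (b n)
  have h0 : ∫ ω, (∑ n ∈ Finset.range N, fun ω => b n * X n ω) ω ∂P = 0 := by
    simp only [Finset.sum_apply]
    rw [integral_finsetSum _ fun n _ => (hmem n).integrable (by norm_num)]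
    simp [integral_const_mul, h.integral_eq_zero]
  have h1 := variance_of_integral_eq_zero
    (Finset.aemeasurable_sum (Finset.range N) fun n _ => (hmem n).aemeasurable) h0
  rw [IndepFun.variance_sum (fun n _ => hmem n)] at h1
  · simp only [variance_const_mul, h.variance_eq_one, mul_one] at h1
    rw [h1]
    simp
  · intro i _ j _ hij
    exact (h.indep.indepFun hij).comp (measurable_const_mul (b i)) (measurable_const_mul (b j))

/-- Orthogonality bounds the L² norms, hence the L¹ norms, of the partial sums by `a`, and Fatou's
lemma passes to the limit. This first moment bound is what controls tails uniformly in `m`. -/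
lemma lintegral_enorm_le [IsProbabilityMeasure P] (h : IsStandardIID X P) {b : ℕ → ℝ}
    {W : Ω → ℝ} {a : ℝ} (ha : 0 ≤ a)
    (hb : ∀ N, ∑ n ∈ Finset.range N, b n ^ 2 ≤ a ^ 2)
    (hW : ∀ᵐ ω ∂P, HasSum (fun n => b n * X n ω) (W ω)) :
    ∫⁻ ω, ‖W ω‖ₑ ∂P ≤ ENNReal.ofReal a := by
  have hm : ∀ N, AEStronglyMeasurable (fun ω => ∑ n ∈ Finset.range N, b n * X n ω) P := fun N =>
    Finset.aestronglyMeasurable_fun_sum _ fun n _ =>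
      ((h.aemeasurable n).const_mul (b n)).aestronglyMeasurable
  have h1 : ∀ N, ∫⁻ ω, ‖∑ n ∈ Finset.range N, b n * X n ω‖ₑ ∂P ≤ ENNReal.ofReal a := by
    intro N
    have hL2 : MemLp (fun ω => ∑ n ∈ Finset.range N, b n * X n ω) 2 P :=
      memLp_finsetSum _ fun n _ => (h.memLp_two n).const_mul (b n)
    rw [← eLpNorm_one_eq_lintegral_enorm]
    refine (eLpNorm_le_eLpNorm_of_exponent_le (q := 2) (by norm_num) (hm N)).trans ?_
    rw [hL2.eLpNorm_eq_integral_rpow_norm (by norm_num) (by norm_num)]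
    refine ENNReal.ofReal_le_ofReal ?_
    have h2 : ∫ ω, ‖∑ n ∈ Finset.range N, b n * X n ω‖ ^ (2 : ℝ≥0∞).toReal ∂P =
        ∑ n ∈ Finset.range N, b n ^ 2 := by
      rw [← h.integral_sum_sq b N]
      refine integral_congr_ae (ae_of_all _ fun ω => ?_)
      simp
    rw [h2]
    calc (∑ n ∈ Finset.range N, b n ^ 2) ^ (2 : ℝ≥0∞).toReal⁻¹ ≤
        (a ^ 2) ^ (2 : ℝ≥0∞).toReal⁻¹ := by
          refine Real.rpow_le_rpow (Finset.sum_nonneg fun n _ => sq_nonneg _) (hb N) (by simp)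
      _ = a := by
          rw [show (2 : ℝ≥0∞).toReal⁻¹ = 1 / 2 by simp, ← Real.sqrt_eq_rpow, Real.sqrt_sq ha]
  calc ∫⁻ ω, ‖W ω‖ₑ ∂P =
      ∫⁻ ω, liminf (fun N => ‖∑ n ∈ Finset.range N, b n * X n ω‖ₑ) atTop ∂P := by
        refine lintegral_congr_ae ?_
        filter_upwards [hW] with ω hω
        exact (hω.tendsto_sum_nat.enorm.liminf_eq).symm
    _ ≤ liminf (fun N => ∫⁻ ω, ‖∑ n ∈ Finset.range N, b n * X n ω‖ₑ ∂P) atTop :=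
        lintegral_liminf_le' fun N => (hm N).enorm
    _ ≤ ENNReal.ofReal a := by
        refine (liminf_le_liminf (Eventually.of_forall h1)).trans ?_
        simp

lemma aemeasurable_of_hasSum (h : IsStandardIID X P) {b : ℕ → ℝ} {W : Ω → ℝ}
    (hW : ∀ᵐ ω ∂P, HasSum (fun n => b n * X n ω) (W ω)) : AEMeasurable W P := by
  refine aemeasurable_of_tendsto_metrizable_ae atTop
    (f := fun N ω => ∑ n ∈ Finset.range N, b n * X n ω) (fun N => ?_) ?_
  · exact Finset.aemeasurable_fun_sum _ fun n _ => (h.aemeasurable n).const_mul (b n)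
  · filter_upwards [hW] with ω hω using hω.tendsto_sum_nat

/-- The characteristic function of a standardized random variable agrees with that of a standard
normal one up to order two. -/
lemma charFun_sub_exp_le [IsProbabilityMeasure P] (h : IsStandardIID X P) {ε : ℝ} (hε : 0 < ε) :
    ∃ δ > 0, ∀ s : ℝ, |s| ≤ δ →
      ‖charFun (P.map (X 0)) s - Complex.exp (-(s : ℂ) ^ 2 / 2)‖ ≤ ε * s ^ 2 := by
  have h1 := taylor_charFun_two (h.aemeasurable 0) h.mean h.integral_sq
  have hvar : ∫ ω, ((id : ℝ → ℝ) ^ 2) ω ∂(gaussianReal 0 1) = 1 := by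
    have := variance_of_integral_eq_zero (μ := gaussianReal 0 1) (X := id)
      aemeasurable_id (by simp [integral_id_gaussianReal])
    rw [variance_id_gaussianReal] at this
    simpa using this.symm
  have h2 := taylor_charFun_two (P := gaussianReal 0 1) (X := id) aemeasurable_id
    (by simp [integral_id_gaussianReal]) hvar
  -- The two second-order Taylor polynomials coincide and cancel, leaving o(s²).
  have h3 := h1.sub h2
  rw [Asymptotics.isLittleO_iff] at h3
  obtain ⟨δ, hδ, hball⟩ := Metric.eventually_nhds_iff_ball.1 (h3 hε)
  -- Halving δ passes from the open ball to the closed condition |s| ≤ δ / 2.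
  refine ⟨δ / 2, by positivity, fun s hs => ?_⟩
  have := hball s (by rw [Metric.mem_ball, Real.dist_eq, sub_zero]; linarith)
  simp only [Measure.map_id, charFun_gaussianReal] at this
  convert this using 1
  · congr 1
    simp only [Complex.ofReal_zero, mul_zero, zero_mul, NNReal.coe_one, Complex.ofReal_one,
      one_mul, zero_sub, neg_div]
    ring
  · simp

end IsStandardIID

/-- Lindeberg's replacement: the factors are exchanged one at a time while all the others have
modulus at most one. -/
lemma norm_prod_sub_prod_le {ι : Type*} (s : Finset ι) (f g : ι → ℂ) (hf : ∀ i ∈ s, ‖f i‖ ≤ 1)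
    (hg : ∀ i ∈ s, ‖g i‖ ≤ 1) : ‖∏ i ∈ s, f i - ∏ i ∈ s, g i‖ ≤ ∑ i ∈ s, ‖f i - g i‖ := by
  classical
  induction s using Finset.induction_on with
  | empty => simp
  | insert a s ha ih =>
    rw [Finset.prod_insert ha, Finset.prod_insert ha, Finset.sum_insert ha]
    have ih' := ih (fun i hi => hf i (Finset.mem_insert_of_mem hi))
      (fun i hi => hg i (Finset.mem_insert_of_mem hi))
    have h1 : ‖∏ i ∈ s, f i‖ ≤ 1 := by
      rw [norm_prod]
      exact Finset.prod_le_one (fun i _ => norm_nonneg _)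
        fun i hi => hf i (Finset.mem_insert_of_mem hi)
    calc ‖f a * ∏ i ∈ s, f i - g a * ∏ i ∈ s, g i‖ =
        ‖(f a - g a) * ∏ i ∈ s, f i + g a * (∏ i ∈ s, f i - ∏ i ∈ s, g i)‖ := by ring_nf
      _ ≤ ‖f a - g a‖ * 1 + 1 * ∑ i ∈ s, ‖f i - g i‖ := by
          refine (norm_add_le _ _).trans ?_
          rw [norm_mul, norm_mul]
          have := hg a (Finset.mem_insert_self _ _)
          gcongr
      _ = _ := by ring

namespace IsStandardIID

variable {Ω : Type*} [MeasurableSpace Ω] {X : ℕ → Ω → ℝ} {P : Measure Ω}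

lemma integral_exp_sum (h : IsStandardIID X P) (b : ℕ → ℝ) (N : ℕ) :
    ∫ ω, Complex.exp ((∑ n ∈ Finset.range N, b n * X n ω : ℝ) * Complex.I) ∂P =
      ∏ n ∈ Finset.range N, charFun (P.map (X 0)) (b n) := by
  have hm : ∀ n, AEMeasurable (fun ω => b n * X n ω) P := fun n => (h.aemeasurable n).const_mul _
  have hind : iIndepFun (fun n ω => b n * X n ω) P :=
    h.indep.comp (fun n x => b n * x) fun n => measurable_const_mul (b n)
  have h1 := congrFun (iIndepFun.charFun_map_fun_finsetSum_eq_prod (s := Finset.range N)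
    (X := fun n ω => b n * X n ω) (fun n _ => hm n) (hind.restrict _)) 1
  rw [charFun_apply_real, integral_map (Finset.aemeasurable_fun_sum _ fun n _ => hm n)
    (by fun_prop)] at h1
  simp only [Complex.ofReal_one, one_mul] at h1
  rw [h1, Finset.prod_apply]
  refine Finset.prod_congr rfl fun n _ => ?_
  have h2 : P.map (fun ω => b n * X n ω) = (P.map (X n)).map (b n * ·) := by
    rw [AEMeasurable.map_map_of_aemeasurable (by fun_prop) (h.aemeasurable n)]
    rfl
  rw [h2, charFun_map_mul, (h.ident n).map_eq, mul_one]

/-- A central limit theorem for infinite linear combinations with uniformly small coefficients. -/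
theorem tendsto_integral_exp [IsProbabilityMeasure P] (h : IsStandardIID X P)
    {b : ℕ → ℕ → ℝ} {W : ℕ → Ω → ℝ} {v : ℝ}
    (hW : ∀ m, ∀ᵐ ω ∂P, HasSum (fun n => b m n * X n ω) (W m ω))
    (hv : ∀ m, HasSum (fun n => b m n ^ 2) v)
    (hsmall : ∀ δ > 0, ∀ᶠ m in atTop, ∀ n, |b m n| ≤ δ) :
    Tendsto (fun m => ∫ ω, Complex.exp (W m ω * Complex.I) ∂P) atTop
      (𝓝 (Complex.exp (-(v : ℂ) / 2))) := by
  have hv0 : 0 ≤ v := (hv 0).nonneg fun n => sq_nonneg _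
  rw [Metric.tendsto_nhds]
  intro ε hε
  -- The total replacement error is at most this constant times ∑ b² = v, hence below ε; `v + 1`
  -- guards against v = 0.
  obtain ⟨δ, hδ, hchar⟩ := h.charFun_sub_exp_le (show 0 < ε / (2 * (v + 1)) by positivity)
  filter_upwards [hsmall δ hδ] with m hm
  have hlim1 : Tendsto (fun N => ∏ n ∈ Finset.range N, charFun (P.map (X 0)) (b m n)) atTop
      (𝓝 (∫ ω, Complex.exp (W m ω * Complex.I) ∂P)) := by
    simp only [← h.integral_exp_sum (b m)]
    refine tendsto_integral_of_dominated_convergence (fun _ => 1) (fun N => ?_)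
      (integrable_const _) (fun N => ae_of_all _ fun ω => ?_) ?_
    · have : AEMeasurable (fun ω => ∑ n ∈ Finset.range N, b m n * X n ω) P :=
        Finset.aemeasurable_fun_sum _ fun n _ => (h.aemeasurable n).const_mul _
      exact (by fun_prop : AEMeasurable _ P).aestronglyMeasurable
    · rw [Complex.norm_exp_ofReal_mul_I]
    · filter_upwards [hW m] with ω hω
      have h1 := hω.tendsto_sum_nat
      have h2 : Continuous fun x : ℝ => Complex.exp (x * Complex.I) := by fun_prop
      exact (h2.tendsto _).comp h1
  have hlim2 : Tendsto (fun N => ∏ n ∈ Finset.range N, Complex.exp (-(b m n : ℂ) ^ 2 / 2)) atTop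
      (𝓝 (Complex.exp (-(v : ℂ) / 2))) := by
    simp only [← Complex.exp_sum]
    refine (Complex.continuous_exp.tendsto _).comp ?_
    have h1 := (Complex.continuous_ofReal.tendsto _).comp (hv m).tendsto_sum_nat
    have h2 := (h1.neg).div_const 2
    refine h2.congr fun N => ?_
    simp [Finset.sum_div, Finset.sum_neg_distrib, neg_div]
  have hbound : ∀ N, ‖∏ n ∈ Finset.range N, charFun (P.map (X 0)) (b m n) -
      ∏ n ∈ Finset.range N, Complex.exp (-(b m n : ℂ) ^ 2 / 2)‖ ≤ ε / (2 * (v + 1)) * v := by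
    intro N
    have : IsProbabilityMeasure (P.map (X 0)) :=
      Measure.isProbabilityMeasure_map (h.aemeasurable 0)
    refine (norm_prod_sub_prod_le _ _ _ (fun n _ => norm_charFun_le_one _) (fun n _ => ?_)).trans ?_
    · rw [Complex.norm_exp, show (-(b m n : ℂ) ^ 2 / 2) = ((-(b m n) ^ 2 / 2 : ℝ) : ℂ) by
        push_cast; ring, Complex.ofReal_re, Real.exp_le_one_iff]
      have := sq_nonneg (b m n)
      linarith
    · calc ∑ n ∈ Finset.range N, ‖charFun (P.map (X 0)) (b m n) -
            Complex.exp (-(b m n : ℂ) ^ 2 / 2)‖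
          ≤ ∑ n ∈ Finset.range N, ε / (2 * (v + 1)) * b m n ^ 2 :=
            Finset.sum_le_sum fun n _ => hchar _ (hm n)
        _ ≤ ε / (2 * (v + 1)) * v := by
            rw [← Finset.mul_sum]
            gcongr
            exact sum_le_hasSum _ (fun n _ => sq_nonneg _) (hv m)
  have h3 := le_of_tendsto (hlim1.sub hlim2).norm (Eventually.of_forall hbound)
  rw [dist_eq_norm]
  refine h3.trans_lt ?_
  rw [div_mul_eq_mul_div, div_lt_iff₀ (by positivity)]
  nlinarith

end IsStandardIID

end RandomAnalytic

/-! ### Convergence in distribution of random series in a normed space -/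

namespace RandomAnalytic

variable {Ω Ω' : Type*} [MeasurableSpace Ω] [MeasurableSpace Ω']
  {P : Measure Ω} {P' : Measure Ω'}
  {X : ℕ → Ω → ℝ} {Z : ℕ → Ω' → ℝ} {a : ℕ → ℝ} {c : ℕ → ℕ → ℕ → ℝ} {V : ℕ → ℕ → Ω → ℝ}

lemma IsStandardIID.of_gaussian (hZ : iIndepFun Z P')
    (hlaw : ∀ n, HasLaw (Z n) (gaussianReal 0 1) P') :
    IsStandardIID Z P' where
  indep := hZ
  ident n := ⟨(hlaw n).aemeasurable, (hlaw 0).aemeasurable, by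
    rw [(hlaw n).map_eq, (hlaw 0).map_eq]⟩
  memLp := by
    have h := memLp_id_gaussianReal (μ := 0) (v := 1) 2
    rw [← (hlaw 0).map_eq] at h
    exact h.comp_of_map (hlaw 0).aemeasurable
  mean := by
    rw [(hlaw 0).integral_eq]
    exact integral_id_gaussianReal
  var := by
    rw [(hlaw 0).variance_eq, variance_id_gaussianReal]
    simp

lemma aemeasurable_of_hasSum_smul {E : Type*} [NormedAddCommGroup E] [NormedSpace ℝ E]
    [MeasurableSpace E] [BorelSpace E] {e : ℕ → E} {v : ℕ → Ω → ℝ} {y : Ω → E}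
    (hv : ∀ k, AEMeasurable (v k) P) (hy : ∀ᵐ ω ∂P, HasSum (fun k => v k ω • e k) (y ω)) :
    AEMeasurable y P := by
  have : AEStronglyMeasurable y P := by
    refine aestronglyMeasurable_of_tendsto_ae atTop
      (f := fun K ω => ∑ k ∈ Finset.range K, v k ω • e k) (fun K => ?_) ?_
    · exact Finset.aestronglyMeasurable_fun_sum _ fun k _ =>
        (hv k).aestronglyMeasurable.smul_const _
    · filter_upwards [hy] with ω hω using hω.tendsto_sum_nat
  exact this.aemeasurable

/-- Only first moments enter, and the bound depends on `a` and `e` alone. It therefore serves all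
`m` and the Gaussian limit at once. -/
lemma lintegral_edist_sum_le {E : Type*} [NormedAddCommGroup E] [NormedSpace ℝ E]
    {e : ℕ → E} {v : ℕ → Ω → ℝ} {y : Ω → E} (ha : ∀ k, 0 ≤ a k)
    (hv : ∀ k, AEMeasurable (v k) P) (hy : ∀ᵐ ω ∂P, HasSum (fun k => v k ω • e k) (y ω))
    (hva : ∀ k, ∫⁻ ω, ‖v k ω‖ₑ ∂P ≤ ENNReal.ofReal (a k)) (K : ℕ) :
    ∫⁻ ω, edist (y ω) (∑ k : Fin K, v k ω • e k) ∂P ≤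
      ∑' k, ENNReal.ofReal (a (k + K) * ‖e (k + K)‖) := by
  calc ∫⁻ ω, edist (y ω) (∑ k : Fin K, v k ω • e k) ∂P
      ≤ ∫⁻ ω, ∑' k, ‖v (k + K) ω‖ₑ * ‖e (k + K)‖ₑ ∂P := by
        refine lintegral_mono_ae ?_
        filter_upwards [hy] with ω hω
        rw [Fin.sum_univ_eq_sum_range (fun k => v k ω • e k), edist_eq_enorm_sub]
        have h1 := (hasSum_nat_add_iff' K).2 hω
        rw [← h1.tsum_eq]
        refine enorm_tsum_le_tsum_enorm.trans (le_of_eq ?_)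
        simp only [enorm_smul]
    _ = ∑' k, (∫⁻ ω, ‖v (k + K) ω‖ₑ ∂P) * ‖e (k + K)‖ₑ := by
        rw [lintegral_tsum fun k => ((hv _).enorm.mul_const _)]
        refine tsum_congr fun k => ?_
        rw [lintegral_mul_const'' _ (hv _).enorm]
    _ ≤ ∑' k, ENNReal.ofReal (a (k + K) * ‖e (k + K)‖) := by
        refine ENNReal.tsum_le_tsum fun k => ?_
        rw [ENNReal.ofReal_mul (ha _), ofReal_norm]
        gcongr
        exact hva _

lemma IsStandardIID.lintegral_enorm_mul_le [IsProbabilityMeasure P] (hX : IsStandardIID X P)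
    {a : ℕ → ℝ} (ha : ∀ k, 0 ≤ a k) (k : ℕ) : ∫⁻ ω, ‖a k * X k ω‖ₑ ∂P ≤ ENNReal.ofReal (a k) := by
  refine hX.lintegral_enorm_le (b := fun n => if n = k then a k else 0) (ha k) (fun N => ?_)
    (ae_of_all _ fun ω => ?_)
  · simp only [ite_pow, Finset.sum_ite_eq', ne_eq, OfNat.ofNat_ne_zero, not_false_eq_true,
      zero_pow]
    split_ifs
    · exact le_rfl
    · positivity
  · refine (hasSum_ite_eq k (a k * X k ω)).congr_fun fun n => ?_
    by_cases h : n = k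
    · simp [h]
    · simp [h]

variable [IsProbabilityMeasure P] [IsProbabilityMeasure P']

/-- Characteristic functions reduce the claim to the pairing with a fixed `t`, which is a single
series in the `X n`. Orthogonality makes its squared coefficients sum to ∑ t_k² a_k² for every `m`,
and its coefficients are uniformly small, so `tendsto_integral_exp` applies. -/
lemma tendstoInDistribution_euclidean (hX : IsStandardIID X P) (hZ : IsStandardIID Z P')
    (hZlaw : HasLaw (Z 0) (gaussianReal 0 1) P')
    (hV : ∀ m k, ∀ᵐ ω ∂P, HasSum (fun n => c m k n * X n ω) (V m k ω))
    (horth : ∀ m k l, HasSum (fun n => c m k n * c m l n) (if k = l then a k ^ 2 else 0))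
    (hsmall : ∀ k, ∀ δ > 0, ∀ᶠ m in atTop, ∀ n, |c m k n| ≤ δ) (K : ℕ) :
    TendstoInDistribution (fun m ω => WithLp.toLp 2 (fun k : Fin K => V m k ω)) atTop
      (fun ω => WithLp.toLp 2 (fun k : Fin K => a k * Z k ω)) (fun _ => P) P' where
  forall_aemeasurable m := by
    have := fun k => hX.aemeasurable_of_hasSum (hV m k)
    have h1 : AEMeasurable (fun ω => fun k : Fin K => V m k ω) P :=
      aemeasurable_pi_lambda _ fun k => this k
    exact (WithLp.measurable_toLp 2 _).comp_aemeasurable h1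
  aemeasurable_limit := by
    have h1 : AEMeasurable (fun ω => fun k : Fin K => a k * Z k ω) P' :=
      aemeasurable_pi_lambda _ fun k => (hZ.aemeasurable k).const_mul _
    exact (WithLp.measurable_toLp 2 _).comp_aemeasurable h1
  tendsto := by
    refine ProbabilityMeasure.tendsto_iff_tendsto_charFun.2 fun t => ?_
    have h1 : ∀ m, AEMeasurable (fun ω => WithLp.toLp 2 (fun k : Fin K => V m k ω)) P := fun m =>
      (WithLp.measurable_toLp 2 _).comp_aemeasurable
        (aemeasurable_pi_lambda _ fun k => hX.aemeasurable_of_hasSum (hV m k))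
    have h2 : AEMeasurable (fun ω => WithLp.toLp 2 (fun k : Fin K => a k * Z k ω)) P' :=
      (WithLp.measurable_toLp 2 _).comp_aemeasurable
        (aemeasurable_pi_lambda _ fun k => (hZ.aemeasurable k).const_mul _)
    simp only [ProbabilityMeasure.coe_mk, charFun_apply]
    rw [integral_map h2 (by fun_prop)]
    simp only [fun m => integral_map (h1 m) (f := fun x : EuclideanSpace ℝ (Fin K) =>
      Complex.exp ((inner ℝ x t : ℝ) * Complex.I)) (by fun_prop)]
    simp only [PiLp.inner_apply, RCLike.inner_apply, conj_trivial]
    have hlim := hX.tendsto_integral_exp (b := fun m n => ∑ k : Fin K, t k * c m k n)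
      (W := fun m ω => ∑ k : Fin K, t k * V m k ω) (v := ∑ k : Fin K, t k ^ 2 * a k ^ 2)
      (fun m => by
        have : ∀ᵐ ω ∂P, ∀ k : Fin K, HasSum (fun n => c m k n * X n ω) (V m k ω) :=
          ae_all_iff.2 fun k => hV m k
        filter_upwards [this] with ω hω
        have := hasSum_sum (s := Finset.univ) fun (k : Fin K) _ => (hω k).mul_left (t k)
        refine this.congr_fun fun n => ?_
        rw [Finset.sum_mul]
        exact Finset.sum_congr rfl fun k _ => by ring)
      (fun m => by
        have := hasSum_sum (s := Finset.univ) fun (k : Fin K) _ =>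
          hasSum_sum (s := Finset.univ) fun (l : Fin K) _ =>
            (horth m k l).mul_left (t k * t l)
        have hs : ∑ k : Fin K, ∑ l : Fin K,
            t k * t l * (if (k : ℕ) = l then a k ^ 2 else 0) = ∑ k : Fin K, t k ^ 2 * a k ^ 2 := by
          refine Finset.sum_congr rfl fun k _ => ?_
          rw [Finset.sum_eq_single k]
          · simp [sq]
          · intro l _ hl
            rw [if_neg fun h => hl (Fin.ext h).symm, mul_zero]
          · simp
        rw [hs] at this
        refine this.congr_fun fun n => ?_
        rw [sq, Finset.sum_mul_sum]
        exact Finset.sum_congr rfl fun k _ => Finset.sum_congr rfl fun l _ => by ring)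
      (fun δ hδ => by
        set B := ∑ k : Fin K, |t k| with hB
        have hB0 : 0 ≤ B := Finset.sum_nonneg fun k _ => abs_nonneg _
        have hall : ∀ᶠ m in atTop, ∀ k : Fin K, ∀ n, |c m k n| ≤ δ / (B + 1) :=
          eventually_all.2 fun k => hsmall k _ (by positivity)
        filter_upwards [hall] with m hm n
        calc |∑ k : Fin K, t k * c m k n| ≤ ∑ k : Fin K, |t k * c m k n| :=
              Finset.abs_sum_le_sum_abs _ _
          _ ≤ ∑ k : Fin K, |t k| * (δ / (B + 1)) := by
              refine Finset.sum_le_sum fun k _ => ?_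
              rw [abs_mul]
              gcongr
              exact hm k n
          _ = B * (δ / (B + 1)) := by rw [Finset.sum_mul]
          _ ≤ δ := by
              rw [mul_div_assoc', div_le_iff₀ (by positivity)]
              nlinarith)
    have hgauss : ∫ ω, Complex.exp ((∑ k : Fin K, t k * (a k * Z k ω) : ℝ) * Complex.I) ∂P' =
        Complex.exp (-((∑ k : Fin K, t k ^ 2 * a k ^ 2 : ℝ) : ℂ) / 2) := by
      -- `t` is extended by zero so that the sum over `Fin K` becomes one over `Finset.range K`.
      have h3 := hZ.integral_exp_sum (fun n => if h : n < K then t ⟨n, h⟩ * a n else 0) K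
      rw [hZlaw.map_eq] at h3
      simp only [← Fin.sum_univ_eq_sum_range (fun n => (if h : n < K then t ⟨n, h⟩ * a n else 0) *
        Z n _), ← Fin.prod_univ_eq_prod_range (fun n => charFun (gaussianReal 0 1)
          (if h : n < K then t ⟨n, h⟩ * a n else 0)), Fin.is_lt, dite_true, Fin.eta] at h3
      simp only [← mul_assoc]
      rw [h3]
      simp only [charFun_gaussianReal, ← Complex.exp_sum]
      congr 1
      simp only [Complex.ofReal_zero, mul_zero, zero_mul, NNReal.coe_one, Complex.ofReal_one,
        one_mul, zero_sub, Complex.ofReal_sum, Complex.ofReal_mul, Complex.ofReal_pow,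
        Finset.sum_neg_distrib, neg_div, Finset.sum_div, mul_pow]
    rw [hgauss]
    exact hlim

/-- Random series with values in a normed space whose coordinates are orthogonal linear
combinations, with uniformly small coefficients, of standardized independent variables converge in
distribution to the corresponding Gaussian series. -/
theorem tendstoInDistribution_series {E : Type*} [NormedAddCommGroup E] [NormedSpace ℝ E]
    [MeasurableSpace E] [BorelSpace E] (hX : IsStandardIID X P) (hZ : IsStandardIID Z P')
    (hZlaw : HasLaw (Z 0) (gaussianReal 0 1) P') (ha : ∀ k, 0 ≤ a k)
    (hV : ∀ m k, ∀ᵐ ω ∂P, HasSum (fun n => c m k n * X n ω) (V m k ω))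
    (horth : ∀ m k l, HasSum (fun n => c m k n * c m l n) (if k = l then a k ^ 2 else 0))
    (hsmall : ∀ k, ∀ δ > 0, ∀ᶠ m in atTop, ∀ n, |c m k n| ≤ δ)
    {e : ℕ → E} (he : Summable fun k => a k * ‖e k‖) {Y : ℕ → Ω → E} {G : Ω' → E}
    (hY : ∀ m, ∀ᵐ ω ∂P, HasSum (fun k => V m k ω • e k) (Y m ω))
    (hG : ∀ᵐ ω ∂P', HasSum (fun k => (a k * Z k ω) • e k) (G ω)) :
    TendstoInDistribution Y atTop G (fun _ => P) P' := by
  have hVm : ∀ m k, AEMeasurable (V m k) P := fun m k => hX.aemeasurable_of_hasSum (hV m k)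
  have hZm : ∀ k, AEMeasurable (fun ω => a k * Z k ω) P' := fun k =>
    (hZ.aemeasurable k).const_mul _
  have hη : Tendsto (fun K => ∑' k, ENNReal.ofReal (a (k + K) * ‖e (k + K)‖)) atTop (𝓝 0) := by
    refine ENNReal.tendsto_sum_nat_add (fun k => ENNReal.ofReal (a k * ‖e k‖)) ?_
    exact he.tsum_ofReal_ne_top
  refine tendstoInDistribution_of_approx
    (VK := fun K m ω => ∑ k : Fin K, V m k ω • e k)
    (WK := fun K ω => ∑ k : Fin K, (a k * Z k ω) • e k)
    (fun m => aemeasurable_of_hasSum_smul (hVm m) (hY m)) (aemeasurable_of_hasSum_smul hZm hG)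
    (fun K => ?_) hη
    (fun K m => lintegral_edist_sum_le ha (hVm m) (hY m) (fun k => ?_) K)
    (lintegral_edist_sum_le ha hZm hG (hZ.lintegral_enorm_mul_le ha))
  · exact (tendstoInDistribution_euclidean hX hZ hZlaw hV horth hsmall K).continuous_comp
      (g := fun x : EuclideanSpace ℝ (Fin K) => ∑ k : Fin K, x k • e k) (by fun_prop)
  · refine hX.lintegral_enorm_le (ha k) (fun N => ?_) (hV m k)
    have h1 := horth m k k
    rw [if_pos rfl] at h1
    have h2 : HasSum (fun n => c m k n ^ 2) (a k ^ 2) := h1.congr_fun fun n => sq _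
    exact sum_le_hasSum _ (fun n _ => sq_nonneg _) h2

end RandomAnalytic

/-! ### Absolutely summable sequences as analytic functions on a disk -/

namespace RandomAnalytic

open Metric Set

/-- Absolutely summable sequences of complex numbers. -/
noncomputable abbrev SummableSeq := lp (fun _ : ℕ => ℂ) 1

/-- The function with Taylor coefficients `y k / R ^ k`. -/
noncomputable def powerFn (R : ℝ) (y : SummableSeq) (w : ℂ) : ℂ := ∑' k, y k * (w / R) ^ k

lemma summable_norm_seq (y : SummableSeq) : Summable fun k => ‖y k‖ := by
  simpa using (lp.memℓp y).summable (by simp)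

lemma norm_eq_tsum_norm (y : SummableSeq) : ‖y‖ = ∑' k, ‖y k‖ := by
  rw [lp.norm_eq_tsum_rpow (by simp)]
  simp

lemma norm_term_le {R : ℝ} (hR : 0 < R) (y : SummableSeq) {w : ℂ} (hw : ‖w‖ ≤ R) (k : ℕ) :
    ‖y k * (w / R) ^ k‖ ≤ ‖y k‖ := by
  rw [norm_mul, norm_pow, norm_div, Complex.norm_real, Real.norm_eq_abs, abs_of_pos hR]
  exact mul_le_of_le_one_right (norm_nonneg _)
    (pow_le_one₀ (by positivity) ((div_le_one hR).2 hw))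

lemma summable_term {R : ℝ} (hR : 0 < R) (y : SummableSeq) {w : ℂ} (hw : ‖w‖ ≤ R) :
    Summable fun k => y k * (w / R) ^ k :=
  Summable.of_norm_bounded (summable_norm_seq y) (norm_term_le hR y hw)

lemma analyticOnNhd_powerFn {R : ℝ} (hR : 0 < R) (y : SummableSeq) :
    AnalyticOnNhd ℂ (powerFn R y) (ball 0 R) := by
  refine DifferentiableOn.analyticOnNhd ?_ isOpen_ball
  refine Complex.differentiableOn_tsum_of_summable_norm (summable_norm_seq y)
    (fun k => by fun_prop) isOpen_ball fun k w hw => norm_term_le hR y ?_ k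
  exact (mem_ball_zero_iff.1 hw).le

lemma norm_powerFn_sub_le {R : ℝ} (hR : 0 < R) (y y' : SummableSeq) {w : ℂ} (hw : ‖w‖ ≤ R) :
    ‖powerFn R y w - powerFn R y' w‖ ≤ ‖y - y'‖ := by
  rw [powerFn, powerFn, ← (summable_term hR y hw).tsum_sub (summable_term hR y' hw),
    norm_eq_tsum_norm]
  refine tsum_of_norm_bounded (summable_norm_seq (y - y')).hasSum fun k => ?_
  have := norm_term_le hR (y - y') hw k
  simpa [sub_mul] using this

lemma exists_powerFn_ne_zero {R : ℝ} (hR : 0 < R) {y : SummableSeq} (hy : y ≠ 0) :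
    ∃ z ∈ ball (0 : ℂ) R, powerFn R y z ≠ 0 := by
  by_contra! h
  refine hy (lp.ext (funext fun k => ?_))
  set p : FormalMultilinearSeries ℂ ℂ ℂ := FormalMultilinearSeries.ofScalars ℂ
    (fun k => y k / (R : ℂ) ^ k) with hp
  have hR' : (R : ℂ) ≠ 0 := by exact_mod_cast hR.ne'
  have hball : HasFPowerSeriesOnBall (powerFn R y) p 0 (ENNReal.ofReal R) := by
    refine HasFPowerSeriesOnBall.mk ?_ (by simpa using hR) ?_
    · refine ENNReal.le_of_forall_nnreal_lt fun r hr => ?_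
      refine p.le_radius_of_bound ‖y‖ fun n => ?_
      have hrR : (r : ℝ) ≤ R := by
        rw [ENNReal.lt_ofReal_iff_toReal_lt (by simp)] at hr
        simpa using hr.le
      rw [hp, FormalMultilinearSeries.ofScalars_norm, norm_div, norm_pow, Complex.norm_real,
        Real.norm_eq_abs, abs_of_pos hR]
      calc ‖y n‖ / R ^ n * r ^ n ≤ ‖y n‖ / R ^ n * R ^ n := by gcongr
        _ = ‖y n‖ := by field_simp
        _ ≤ ‖y‖ := lp.norm_apply_le_norm (by simp) y n
    · intro w hw
      have hw' : ‖w‖ ≤ R := by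
        rw [Metric.mem_eball, edist_zero_right, ← ofReal_norm,
          ENNReal.ofReal_lt_ofReal_iff hR] at hw
        exact hw.le
      rw [zero_add]
      refine (summable_term hR y hw').hasSum.congr_fun fun n => ?_
      rw [hp, FormalMultilinearSeries.ofScalars_apply_eq, smul_eq_mul, div_pow]
      ring
  have hz : powerFn R y =ᶠ[𝓝 0] 0 := by
    filter_upwards [isOpen_ball.mem_nhds (mem_ball_self hR)] with z hz using h z hz
  have hp0 := (hball.hasFPowerSeriesAt.congr hz).eq_zero
  have := congrArg (fun q => q.coeff k) hp0
  simp only [hp, FormalMultilinearSeries.coeff_ofScalars] at this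
  have h2 : y k / (R : ℂ) ^ k = 0 := this.trans rfl
  rcases div_eq_zero_iff.1 h2 with h3 | h3
  · simpa using h3
  · exact absurd h3 (pow_ne_zero _ hR')

/-- The ℓ¹ norm dominates the supremum norm on the disk of radius `R`, so Hurwitz's theorem applies.
The zero sequence is excluded because the limit function must not vanish identically. -/
lemma continuousOn_zeroStat_powerFn {R : ℝ} (hR : 0 < R) {φ : ℂ → ℂ} (hφ : Continuous φ)
    (hφc : HasCompactSupport φ) (hφR : tsupport φ ⊆ ball 0 R) :
    ContinuousOn (fun y : SummableSeq => zeroStat (powerFn R y) φ) {0}ᶜ := by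
  intro y hy
  refine ContinuousAt.continuousWithinAt ?_
  refine tendsto_zeroStat (F := fun y => powerFn R y) isOpen_ball
    (convex_ball (0 : ℂ) R).isPreconnected
    (Eventually.of_forall fun y => analyticOnNhd_powerFn hR y) (analyticOnNhd_powerFn hR y)
    (exists_powerFn_ne_zero hR hy) ?_ hφ hφc hφR
  refine TendstoUniformlyOn.tendstoLocallyUniformlyOn ?_
  rw [Metric.tendstoUniformlyOn_iff]
  intro ε hε
  filter_upwards [Metric.ball_mem_nhds y hε] with y' hy' w hw
  rw [dist_eq_norm]
  refine (norm_powerFn_sub_le hR y y' (mem_ball_zero_iff.1 hw).le).trans_lt ?_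
  rw [← dist_eq_norm, dist_comm]
  exact hy'

lemma measurable_zeroStat_powerFn [MeasurableSpace SummableSeq] [BorelSpace SummableSeq] {R : ℝ}
    (hR : 0 < R) {φ : ℂ → ℂ} (hφ : Continuous φ) (hφc : HasCompactSupport φ)
    (hφR : tsupport φ ⊆ ball 0 R) :
    Measurable (fun y : SummableSeq => zeroStat (powerFn R y) φ) :=
  measurable_of_continuousOn_compl_singleton 0 (continuousOn_zeroStat_powerFn hR hφ hφc hφR)

end RandomAnalytic

/-! ### Zero statistics of random analytic functions with orthogonal coefficients -/

namespace RandomAnalytic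

open Metric Set

variable {Ω Ω' : Type*} [MeasurableSpace Ω] [MeasurableSpace Ω']
  {P : Measure Ω} {P' : Measure Ω'}
  {X : ℕ → Ω → ℝ} {Z : ℕ → Ω' → ℝ} {a : ℕ → ℝ} {c : ℕ → ℕ → ℕ → ℝ} {V : ℕ → ℕ → Ω → ℝ}

/-- By Tonelli the expected sum is at most ∑ a_k b_k, which is finite, so the sum is finite almost
surely. -/
lemma ae_summable_of_lintegral_le {v : ℕ → Ω → ℝ} {b : ℕ → ℝ} (ha : ∀ k, 0 ≤ a k)
    (hb : ∀ k, 0 ≤ b k) (hv : ∀ k, AEMeasurable (v k) P)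
    (hva : ∀ k, ∫⁻ ω, ‖v k ω‖ₑ ∂P ≤ ENNReal.ofReal (a k)) (hab : Summable fun k => a k * b k) :
    ∀ᵐ ω ∂P, Summable fun k => |v k ω| * b k := by
  have hm : ∀ k, AEMeasurable (fun ω => ‖v k ω‖ₑ * ENNReal.ofReal (b k)) P := fun k =>
    (hv k).enorm.mul_const _
  have h1 : ∫⁻ ω, ∑' k, ‖v k ω‖ₑ * ENNReal.ofReal (b k) ∂P ≠ ∞ := by
    rw [lintegral_tsum hm]
    refine ne_top_of_le_ne_top hab.tsum_ofReal_ne_top (ENNReal.tsum_le_tsum fun k => ?_)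
    rw [lintegral_mul_const'' _ (hv k).enorm, ENNReal.ofReal_mul (ha k)]
    gcongr
    exact hva k
  filter_upwards [ae_lt_top' (AEMeasurable.tsum hm) h1] with ω hω
  have h2 := ENNReal.summable_toReal hω.ne
  refine h2.congr fun k => ?_
  rw [ENNReal.toReal_mul, ENNReal.toReal_ofReal (hb k), toReal_enorm, Real.norm_eq_abs]

/-- By the strong law the averages of X_n² tend to 1, which is impossible where all X_n vanish. This
keeps the random series from being identically zero. -/
lemma IsStandardIID.ae_exists_ne_zero [IsProbabilityMeasure P] (hX : IsStandardIID X P) :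
    ∀ᵐ ω ∂P, ∃ n, X n ω ≠ 0 := by
  have hsq : ∀ n, IdentDistrib (fun ω => X n ω ^ 2) (fun ω => X 0 ω ^ 2) P P := fun n =>
    (hX.ident n).comp (measurable_id.pow_const 2)
  have h := strong_law_ae_real (fun n ω => X n ω ^ 2)
    ((memLp_two_iff_integrable_sq hX.memLp.1).1 hX.memLp)
    (fun i j hij => (hX.indep.indepFun hij).comp (measurable_id.pow_const 2)
      (measurable_id.pow_const 2)) hsq
  filter_upwards [h] with ω hω
  by_contra! h0
  have h1 : ∫ ω, X 0 ω ^ 2 ∂P = 1 := hX.integral_sq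
  simp only [h0, h1] at hω
  simp at hω

lemma zeroStat_congr {f g φ : ℂ → ℂ} {U : Set ℂ} (hU : IsOpen U) (hfg : EqOn f g U)
    (hφU : tsupport φ ⊆ U) : zeroStat f φ = zeroStat g φ := by
  refine finsum_congr fun ξ => ?_
  by_cases hξ : ξ ∈ tsupport φ
  · have : f =ᶠ[𝓝 ξ] g := by
      filter_upwards [hU.mem_nhds (hφU hξ)] with z hz using hfg hz
    rw [analyticOrderNatAt, analyticOrderNatAt, analyticOrderAt_congr this]
  · simp [image_eq_zero_of_notMem_tsupport hξ]

open Classical in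
/-- The absolutely summable sequence `v k * R ^ k`, or zero if it is not summable. -/
noncomputable def scaledSeq (R : ℝ) (v : ℕ → ℝ) : SummableSeq :=
  if h : Summable fun k => |v k| * R ^ k then
    ⟨fun k => ((v k * R ^ k : ℝ) : ℂ), memℓp_gen (by
      refine (h.abs).congr fun k => ?_
      simp [abs_mul])⟩
  else 0

lemma scaledSeq_apply {R : ℝ} {v : ℕ → ℝ} (h : Summable fun k => |v k| * R ^ k) (k : ℕ) :
    scaledSeq R v k = ((v k * R ^ k : ℝ) : ℂ) := by
  rw [scaledSeq, dif_pos h]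

lemma hasSum_scaledSeq {R : ℝ} {v : ℕ → ℝ} (h : Summable fun k => |v k| * R ^ k) :
    HasSum (fun k => v k • (lp.single 1 k ((R ^ k : ℝ) : ℂ) : SummableSeq)) (scaledSeq R v) := by
  refine (lp.hasSum_single (by simp) (scaledSeq R v)).congr_fun fun k => ?_
  rw [scaledSeq_apply h, ← lp.single_smul]
  simp

lemma hasSum_powerFn_scaledSeq {R : ℝ} (hR : 0 < R) {v : ℕ → ℝ}
    (h : Summable fun k => |v k| * R ^ k) {w : ℂ} (hw : ‖w‖ ≤ R) :
    HasSum (fun k => (v k : ℂ) * w ^ k) (powerFn R (scaledSeq R v) w) := by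
  refine (summable_term hR _ hw).hasSum.congr_fun fun k => ?_
  have hR' : (R : ℂ) ≠ 0 := by exact_mod_cast hR.ne'
  rw [scaledSeq_apply h, div_pow]
  push_cast
  field_simp

/-- Convergence in distribution of the linear statistics of the zeros of random analytic functions
whose Taylor coefficients are orthogonal linear combinations, with uniformly small coefficients,
of standardized independent variables. -/
theorem tendstoInDistribution_zeroStat [IsProbabilityMeasure P] [IsProbabilityMeasure P']
    (hX : IsStandardIID X P) (hZ : IsStandardIID Z P')
    (hZlaw : HasLaw (Z 0) (gaussianReal 0 1) P') (ha : ∀ k, 0 < a k)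
    (hV : ∀ m k, ∀ᵐ ω ∂P, HasSum (fun n => c m k n * X n ω) (V m k ω))
    (horth : ∀ m k l, HasSum (fun n => c m k n * c m l n) (if k = l then a k ^ 2 else 0))
    (hsmall : ∀ k, ∀ δ > 0, ∀ᶠ m in atTop, ∀ n, |c m k n| ≤ δ)
    {R : ℝ} (hR : 0 < R) (haR : Summable fun k => a k * R ^ k)
    {f : ℕ → Ω → ℂ → ℂ} {g : Ω' → ℂ → ℂ}
    (hf : ∀ m, ∀ᵐ ω ∂P, ∀ w ∈ ball (0 : ℂ) R, HasSum (fun k => (V m k ω : ℂ) * w ^ k) (f m ω w))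
    (hg : ∀ᵐ ω ∂P', ∀ w ∈ ball (0 : ℂ) R,
      HasSum (fun k => ((a k * Z k ω : ℝ) : ℂ) * w ^ k) (g ω w))
    {φ : ℂ → ℂ} (hφ : Continuous φ) (hφc : HasCompactSupport φ) (hφR : tsupport φ ⊆ ball 0 R) :
    TendstoInDistribution (fun m ω => zeroStat (f m ω) φ) atTop (fun ω => zeroStat (g ω) φ)
      (fun _ => P) P' := by
  let _ : MeasurableSpace SummableSeq := borel _
  have _ : BorelSpace SummableSeq := ⟨rfl⟩
  have hVm : ∀ m k, AEMeasurable (V m k) P := fun m k => hX.aemeasurable_of_hasSum (hV m k)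
  have hVs : ∀ m, ∀ᵐ ω ∂P, Summable fun k => |V m k ω| * R ^ k := by
    intro m
    refine ae_summable_of_lintegral_le (fun k => (ha k).le) (fun k => by positivity) (hVm m)
      (fun k => ?_) haR
    refine hX.lintegral_enorm_le (ha k).le (fun N => ?_) (hV m k)
    have h1 := horth m k k
    rw [if_pos rfl] at h1
    have h2 : HasSum (fun n => c m k n ^ 2) (a k ^ 2) := h1.congr_fun fun n => sq _
    exact sum_le_hasSum _ (fun n _ => sq_nonneg _) h2
  have hZs : ∀ᵐ ω ∂P', Summable fun k => |a k * Z k ω| * R ^ k :=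
    ae_summable_of_lintegral_le (fun k => (ha k).le) (fun k => by positivity)
      (fun k => (hZ.aemeasurable k).const_mul _)
      (hZ.lintegral_enorm_mul_le fun k => (ha k).le) haR
  -- The Gaussian limit almost surely avoids the origin, the one point of ℓ¹ where continuity of the
  -- zero statistic is not known.
  have hne : ∀ᵐ ω ∂P', scaledSeq R (fun k => a k * Z k ω) ∈ ({0}ᶜ : Set SummableSeq) := by
    filter_upwards [hZs, hZ.ae_exists_ne_zero] with ω hω ⟨n, hn⟩ h0
    have h1 := scaledSeq_apply hω n
    rw [mem_singleton_iff.1 h0] at h1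
    have h2 : a n * Z n ω * R ^ n = 0 := by
      have h3 : ((a n * Z n ω * R ^ n : ℝ) : ℂ) = 0 := h1.symm.trans (by simp)
      exact_mod_cast h3
    exact mul_ne_zero (mul_ne_zero (ha n).ne' hn) (pow_pos hR n).ne' h2
  have hconv : TendstoInDistribution (fun m ω => scaledSeq R fun k => V m k ω) atTop
      (fun ω => scaledSeq R fun k => a k * Z k ω) (fun _ => P) P' := by
    refine tendstoInDistribution_series hX hZ hZlaw (fun k => (ha k).le) hV horth hsmall
      (e := fun k => (lp.single 1 k ((R ^ k : ℝ) : ℂ) : SummableSeq)) ?_ (fun m => ?_) ?_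
    · refine haR.congr fun k => ?_
      rw [lp.norm_single (by simp), Complex.norm_real, Real.norm_eq_abs, abs_of_pos (pow_pos hR k)]
    · filter_upwards [hVs m] with ω hω using hasSum_scaledSeq hω
    · filter_upwards [hZs] with ω hω using hasSum_scaledSeq hω
  have hmain := tendstoInDistribution_comp_of_continuousOn hconv
    (continuousOn_zeroStat_powerFn hR hφ hφc hφR) isOpen_compl_singleton
    (measurable_zeroStat_powerFn hR hφ hφc hφR) hne
  -- The given functions agree with the power series only on the ball, which suffices since φ is
  -- supported there.
  refine TendstoInDistribution.congr (fun m => ?_) ?_ hmain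
  · filter_upwards [hVs m, hf m] with ω hω hfω
    refine zeroStat_congr isOpen_ball (fun w hw => ?_) hφR
    exact (hasSum_powerFn_scaledSeq hR hω (mem_ball_zero_iff.1 hw).le).unique (hfω w hw)
  · filter_upwards [hZs, hg] with ω hω hgω
    refine zeroStat_congr isOpen_ball (fun w hw => ?_) hφR
    exact (hasSum_powerFn_scaledSeq hR hω (mem_ball_zero_iff.1 hw).le).unique (hgω w hw)

end RandomAnalytic

/-! ### The coefficients and the covariance kernel -/

namespace RandomAnalytic

open Metric Set

variable {κ : ℝ}

lemma coeff_zero : coeff κ 0 = 1 := by simp [coeff]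

lemma coeff_succ (n : ℕ) :
    coeff κ (n + 1) = coeff κ n * Real.sqrt ((1 - n * κ) / (n + 1)) := by
  rw [coeff, Finset.prod_Icc_succ_top (by omega), ← coeff]
  push_cast
  ring_nf

lemma ratio_pos (hκ : κ ≤ 0) (n : ℕ) : 0 < (1 - n * κ) / ((n : ℝ) + 1) := by
  have : (n : ℝ) * κ ≤ 0 := mul_nonpos_of_nonneg_of_nonpos (Nat.cast_nonneg n) hκ
  have : 0 < 1 - (n : ℝ) * κ := by linarith
  positivity

lemma coeff_pos (hκ : κ ≤ 0) (n : ℕ) : 0 < coeff κ n := by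
  induction n with
  | zero => simp [coeff_zero]
  | succ n ih =>
    rw [coeff_succ]
    exact mul_pos ih (Real.sqrt_pos.2 (ratio_pos hκ n))

/-- The power series form of the differential equation (1 + κz) k' = k. -/
lemma coeff_succ_sq (hκ : κ ≤ 0) (n : ℕ) :
    ((n : ℝ) + 1) * coeff κ (n + 1) ^ 2 = (1 - n * κ) * coeff κ n ^ 2 := by
  rw [coeff_succ, mul_pow, Real.sq_sqrt (ratio_pos hκ n).le]
  field_simp

lemma tendsto_ratio : Tendsto (fun n : ℕ => (1 - n * κ) / ((n : ℝ) + 1)) atTop (𝓝 (-κ)) := by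
  have h1 : Tendsto (fun n : ℕ => (1 : ℝ) / ((n : ℝ) + 1)) atTop (𝓝 0) :=
    tendsto_one_div_add_atTop_nhds_zero_nat
  have h2 := (h1.mul_const (1 + κ)).sub_const κ
  rw [zero_mul, zero_sub] at h2
  refine h2.congr fun n => ?_
  have : (n : ℝ) + 1 ≠ 0 := by positivity
  field_simp
  ring

/-- Successive terms have ratio tending to -κx. Here and below `0 < 1 + κ * x` encodes x < ρ_κ²,
with κ = 0 included. -/
lemma summable_coeff_sq (hκ : κ ≤ 0) {x : ℝ} (hx : 0 ≤ x) (h : 0 < 1 + κ * x) :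
    Summable fun n => coeff κ n ^ 2 * x ^ n := by
  rcases hx.eq_or_lt with rfl | hx
  · refine summable_of_ne_finset_zero (s := {0}) fun n hn => ?_
    simp only [Finset.mem_singleton] at hn
    simp [hn]
  refine summable_of_ratio_test_tendsto_lt_one (l := -κ * x) (by linarith)
    (Eventually.of_forall fun n => (mul_pos (pow_pos (coeff_pos hκ n) 2) (pow_pos hx n)).ne') ?_
  refine (tendsto_ratio.mul_const x).congr fun n => ?_
  have h1 := coeff_succ_sq hκ n
  have h2 := coeff_pos hκ n
  rw [Real.norm_of_nonneg (by positivity), Real.norm_of_nonneg (by positivity),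
    show coeff κ (n + 1) ^ 2 = (1 - n * κ) * coeff κ n ^ 2 / (n + 1) by
      rw [← h1]; field_simp]
  field_simp
  ring

lemma summable_coeff (hκ : κ ≤ 0) {s : ℝ} (hs : 0 ≤ s) (h : 0 < 1 + κ * s ^ 2) :
    Summable fun n => coeff κ n * s ^ n := by
  rcases hs.eq_or_lt with rfl | hs
  · refine summable_of_ne_finset_zero (s := {0}) fun n hn => ?_
    simp only [Finset.mem_singleton] at hn
    simp [hn]
  refine summable_of_ratio_test_tendsto_lt_one (l := Real.sqrt (-κ) * s) ?_
    (Eventually.of_forall fun n => (mul_pos (coeff_pos hκ n) (pow_pos hs n)).ne') ?_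
  · rw [← abs_of_pos hs, ← Real.sqrt_sq_eq_abs, ← Real.sqrt_mul (by linarith), Real.sqrt_lt' one_pos]
    linarith
  · refine ((Real.continuous_sqrt.tendsto _).comp tendsto_ratio |>.mul_const s).congr fun n => ?_
    have h2 := coeff_pos hκ n
    have h3 := coeff_pos hκ (n + 1)
    rw [Real.norm_of_nonneg (by positivity), Real.norm_of_nonneg (by positivity), coeff_succ,
      Function.comp_apply]
    field_simp
    ring

/-- The covariance kernel of the Gaussian series, as a function of the product of its arguments. -/
noncomputable def kern (κ : ℝ) (z : ℂ) : ℂ := ∑' n : ℕ, ((coeff κ n ^ 2 : ℝ) : ℂ) * z ^ n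

/-- The covariance kernel at a real argument. -/
noncomputable def kernReal (κ : ℝ) (x : ℝ) : ℝ := ∑' n : ℕ, coeff κ n ^ 2 * x ^ n

lemma kern_ofReal (x : ℝ) : kern κ x = kernReal κ x := by
  rw [kern, kernReal, Complex.ofReal_tsum]
  push_cast
  rfl

lemma kern_zero : kern κ 0 = 1 := by
  rw [kern, tsum_eq_single 0]
  · simp [coeff_zero]
  · intro n hn
    simp [hn]

lemma kern_conj (z : ℂ) : kern κ (starRingEnd ℂ z) = starRingEnd ℂ (kern κ z) := by
  rw [kern, kern, Complex.conj_tsum]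
  simp

lemma norm_kern_term_le {z : ℂ} {x : ℝ} (hz : ‖z‖ ≤ x) (n : ℕ) :
    ‖((coeff κ n ^ 2 : ℝ) : ℂ) * z ^ n‖ ≤ coeff κ n ^ 2 * x ^ n := by
  rw [norm_mul, norm_pow, Complex.norm_real, Real.norm_of_nonneg (sq_nonneg _)]
  gcongr

lemma hasSum_kern (hκ : κ ≤ 0) {z : ℂ} (hz : 0 < 1 + κ * ‖z‖) :
    HasSum (fun n => ((coeff κ n ^ 2 : ℝ) : ℂ) * z ^ n) (kern κ z) :=
  (Summable.of_norm_bounded (summable_coeff_sq hκ (norm_nonneg z) hz)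
    (norm_kern_term_le le_rfl)).hasSum

lemma hasSum_kernReal (hκ : κ ≤ 0) {x : ℝ} (hx : 0 ≤ x) (h : 0 < 1 + κ * x) :
    HasSum (fun n => coeff κ n ^ 2 * x ^ n) (kernReal κ x) :=
  (summable_coeff_sq hκ hx h).hasSum

lemma norm_kern_le (hκ : κ ≤ 0) {z : ℂ} {x : ℝ} (hz : ‖z‖ ≤ x) (h : 0 < 1 + κ * x) :
    ‖kern κ z‖ ≤ kernReal κ x :=
  tsum_of_norm_bounded (hasSum_kernReal hκ ((norm_nonneg z).trans hz) h) (norm_kern_term_le hz)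

lemma one_le_kernReal (hκ : κ ≤ 0) {x : ℝ} (hx : 0 ≤ x) (h : 0 < 1 + κ * x) :
    1 ≤ kernReal κ x := by
  have := (hasSum_kernReal hκ hx h)
  have h1 := le_hasSum this 0 fun n _ => by positivity
  simpa [coeff_zero] using h1

lemma exists_gt_of_pos {t : ℝ} (h : 0 < 1 + κ * t) : ∃ x, t < x ∧ 0 < 1 + κ * x := by
  have hc : ContinuousAt (fun x => 1 + κ * x) t := by fun_prop
  have h1 : ∀ᶠ x in 𝓝[>] t, 0 < 1 + κ * x :=
    (hc.eventually (lt_mem_nhds h)).filter_mono nhdsWithin_le_nhds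
  obtain ⟨x, hx, hx'⟩ := (h1.and self_mem_nhdsWithin).exists
  exact ⟨x, hx', hx⟩

lemma pos_of_le (hκ : κ ≤ 0) {t x : ℝ} (ht : t ≤ x) (h : 0 < 1 + κ * x) : 0 < 1 + κ * t := by
  have := mul_le_mul_of_nonpos_left ht hκ
  linarith

lemma one_add_mul_ne_zero (hκ : κ ≤ 0) {z : ℂ} (h : 0 < 1 + κ * ‖z‖) : 1 + (κ : ℂ) * z ≠ 0 := by
  intro h0
  have h1 : (κ : ℂ) * z = -1 := by linear_combination h0
  have h2 := congrArg norm h1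
  rw [norm_mul, Complex.norm_real, Real.norm_eq_abs, abs_of_nonpos hκ, norm_neg, norm_one] at h2
  linarith

/-- Differentiation term by term is justified on a slightly larger ball, where ∑ a_n² x^n is a
majorant. The recursion `coeff_succ_sq` then yields the equation. -/
lemma differentiableAt_kern_and_ode (hκ : κ ≤ 0) {z : ℂ} (hz : 0 < 1 + κ * ‖z‖) :
    DifferentiableAt ℂ (kern κ) z ∧ (1 + κ * z) * deriv (kern κ) z = kern κ z := by
  obtain ⟨x, hzx, hx⟩ := exists_gt_of_pos hz
  have hx0 : 0 ≤ x := (norm_nonneg z).trans hzx.le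
  have hzb : z ∈ ball (0 : ℂ) x := mem_ball_zero_iff.2 hzx
  have hu := summable_coeff_sq hκ hx0 hx
  have hd : ∀ n, DifferentiableOn ℂ (fun z : ℂ => ((coeff κ n ^ 2 : ℝ) : ℂ) * z ^ n) (ball 0 x) :=
    fun n => by fun_prop
  have hb : ∀ n, ∀ w ∈ ball (0 : ℂ) x, ‖((coeff κ n ^ 2 : ℝ) : ℂ) * w ^ n‖ ≤
      coeff κ n ^ 2 * x ^ n := fun n w hw => norm_kern_term_le (mem_ball_zero_iff.1 hw).le n
  have h1 := Complex.differentiableOn_tsum_of_summable_norm hu hd isOpen_ball hb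
  have h2 := Complex.hasSum_deriv_of_summable_norm hu hd isOpen_ball hb hzb
  refine ⟨h1.differentiableAt (isOpen_ball.mem_nhds hzb), ?_⟩
  have h3 : HasSum (fun n : ℕ => ((coeff κ n ^ 2 : ℝ) : ℂ) * (n * z ^ (n - 1)))
      (deriv (kern κ) z) := by
    refine h2.congr_fun fun n => ?_
    simp
  have h4 : HasSum (fun n : ℕ => ((coeff κ (n + 1) ^ 2 : ℝ) : ℂ) * ((n + 1) * z ^ n))
      (deriv (kern κ) z) := by
    rw [← hasSum_nat_add_iff' 1] at h3
    simpa using h3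
  have h5 : HasSum (fun n : ℕ => ((coeff κ n ^ 2 : ℝ) : ℂ) * z ^ n -
      κ * z * (((coeff κ n ^ 2 : ℝ) : ℂ) * (n * z ^ (n - 1)))) (kern κ z - κ * z * deriv (kern κ) z) :=
    (hasSum_kern hκ hz).sub (h3.mul_left (κ * z))
  have h6 : deriv (kern κ) z = kern κ z - κ * z * deriv (kern κ) z := by
    refine h4.unique (h5.congr_fun fun n => ?_)
    have h7 : ((n : ℂ) + 1) * ((coeff κ (n + 1) ^ 2 : ℝ) : ℂ) =
        (1 - n * κ) * ((coeff κ n ^ 2 : ℝ) : ℂ) := by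
      exact_mod_cast coeff_succ_sq hκ n
    rcases n with _ | n
    · simp only [Nat.cast_zero] at h7 ⊢
      linear_combination h7
    · have h8 : z * z ^ (n + 1 - 1) = z ^ (n + 1) := by rw [Nat.add_sub_cancel]; ring
      linear_combination z ^ (n + 1) * h7 +
        κ * (((coeff κ (n + 1) ^ 2 : ℝ) : ℂ)) * ((n + 1 : ℕ) : ℂ) * h8
  linear_combination h6

lemma convex_norm_region (hκ : κ ≤ 0) : Convex ℝ {z : ℂ | 0 < 1 + κ * ‖z‖} := by
  have h := ((convexOn_univ_norm (E := ℂ)).smul (neg_nonneg.2 hκ)).convex_lt 1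
  have h2 : {z : ℂ | 0 < 1 + κ * ‖z‖} = {z ∈ univ | (-κ) • ‖z‖ < 1} := by
    ext z
    simp only [Set.mem_ofPred_eq, mem_univ, true_and, smul_eq_mul]
    constructor <;> intro h <;> linarith
  rw [h2]
  exact h

lemma isOpen_norm_region : IsOpen {z : ℂ | 0 < 1 + κ * ‖z‖} :=
  isOpen_lt continuous_const (by fun_prop)

/-- By the differential equation `kern κ * exp (-L)` has zero derivative on a connected region, and
it equals 1 at the origin. Leaving `L` abstract covers both L(z) = z for κ = 0 and L(z) = κ⁻¹ log(1
+ κz) for κ < 0. -/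
lemma kern_eq_exp (hκ : κ ≤ 0) {L : ℂ → ℂ} (hL0 : L 0 = 0)
    (hL : ∀ z : ℂ, 0 < 1 + κ * ‖z‖ → HasDerivAt L (1 + κ * z)⁻¹ z) {z : ℂ}
    (hz : 0 < 1 + κ * ‖z‖) : kern κ z = Complex.exp (L z) := by
  have hder : ∀ z : ℂ, 0 < 1 + κ * ‖z‖ →
      HasDerivAt (fun z => kern κ z * Complex.exp (-L z)) 0 z := by
    intro z hz
    obtain ⟨h1, h2⟩ := differentiableAt_kern_and_ode hκ hz
    have h3 := h1.hasDerivAt.mul (hL z hz).neg.cexp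
    refine h3.congr_deriv ?_
    have h4 := one_add_mul_ne_zero hκ hz
    rw [← h2, Pi.neg_apply]
    field_simp
    ring
  have hconst := isOpen_norm_region.is_const_of_deriv_eq_zero (𝕜 := ℂ)
    (convex_norm_region hκ).isPreconnected
    (fun z hz => (hder z hz).differentiableAt.differentiableWithinAt)
    (fun z hz => (hder z hz).deriv) (x := z) (y := 0) hz (by simp)
  simp only [hL0, kern_zero, neg_zero, Complex.exp_zero, mul_one] at hconst
  rw [Complex.exp_neg] at hconst
  have := Complex.exp_ne_zero (L z)
  field_simp at hconst
  exact hconst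

lemma one_add_mul_mem_slitPlane (hκ : κ ≤ 0) {z : ℂ} (hz : 0 < 1 + κ * ‖z‖) :
    1 + (κ : ℂ) * z ∈ Complex.slitPlane := by
  left
  rw [Complex.add_re, Complex.one_re, Complex.re_ofReal_mul]
  have := mul_le_mul_of_nonpos_left (Complex.re_le_norm z) hκ
  linarith

lemma kern_zero_left (z : ℂ) : kern 0 z = Complex.exp z :=
  kern_eq_exp le_rfl (L := fun z => z) rfl
    (fun z _ => (hasDerivAt_id z).congr_deriv (by simp)) (by simp)

lemma kern_of_neg (hκ : κ < 0) {z : ℂ} (hz : 0 < 1 + κ * ‖z‖) :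
    kern κ z = Complex.exp ((κ : ℂ)⁻¹ * Complex.log (1 + κ * z)) := by
  refine kern_eq_exp hκ.le (L := fun z => (κ : ℂ)⁻¹ * Complex.log (1 + κ * z)) (by simp)
    (fun z hz => ?_) hz
  have h1 : HasDerivAt (fun z : ℂ => 1 + (κ : ℂ) * z) κ z := by
    exact (((hasDerivAt_id z).const_mul (κ : ℂ)).const_add 1).congr_deriv (mul_one _)
  have h2 := (h1.clog (one_add_mul_mem_slitPlane hκ.le hz)).const_mul (κ : ℂ)⁻¹
  refine h2.congr_deriv ?_
  have : (κ : ℂ) ≠ 0 := by exact_mod_cast hκ.ne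
  have h4 := one_add_mul_ne_zero hκ.le hz
  field_simp

lemma kern_ne_zero (hκ : κ ≤ 0) {z : ℂ} (hz : 0 < 1 + κ * ‖z‖) : kern κ z ≠ 0 := by
  rcases hκ.eq_or_lt with rfl | hκ
  · rw [kern_zero_left]
    exact Complex.exp_ne_zero _
  · rw [kern_of_neg hκ hz]
    exact Complex.exp_ne_zero _

lemma hasDerivAt_kern (hκ : κ ≤ 0) {z : ℂ} (hz : 0 < 1 + κ * ‖z‖) :
    HasDerivAt (kern κ) (kern κ z * (1 + κ * z)⁻¹) z := by
  obtain ⟨h1, h2⟩ := differentiableAt_kern_and_ode hκ hz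
  refine h1.hasDerivAt.congr_deriv ?_
  have h4 := one_add_mul_ne_zero hκ hz
  rw [← h2]
  field_simp

/-- Cauchy's formula for the n-th coefficient. The gain over the trivial bound `kernReal κ x` is
that the maximum of the modulus on the circle is replaced by its mean. -/
lemma kern_circle_bound (hκ : κ ≤ 0) {x : ℝ} (hx : 0 < x) (h : 0 < 1 + κ * x) (n : ℕ) :
    coeff κ n ^ 2 * x ^ n ≤
      (2 * Real.pi)⁻¹ * ∫ θ in (0 : ℝ)..2 * Real.pi, ‖kern κ (circleMap 0 x θ)‖ := by
  have hb : ∀ w ∈ closedBall (0 : ℂ) x, DifferentiableAt ℂ (kern κ) w := fun w hw =>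
    (differentiableAt_kern_and_ode hκ (pos_of_le hκ (mem_closedBall_zero_iff.1 hw) h)).1
  have h1 : HasFPowerSeriesAt (kern κ) (cauchyPowerSeries (kern κ) 0 x) 0 := by
    lift x to NNReal using hx.le
    exact (DifferentiableOn.hasFPowerSeriesOnBall
      (fun w hw => (hb w hw).differentiableWithinAt) (by exact_mod_cast hx)).hasFPowerSeriesAt
  have h2 : HasFPowerSeriesAt (kern κ)
      (FormalMultilinearSeries.ofScalars ℂ fun n => ((coeff κ n ^ 2 : ℝ) : ℂ)) 0 := by
    rw [hasFPowerSeriesAt_iff]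
    filter_upwards [ball_mem_nhds (0 : ℂ) hx] with z hz
    rw [zero_add]
    refine (hasSum_kern hκ (pos_of_le hκ (mem_ball_zero_iff.1 hz).le h)).congr_fun fun n => ?_
    rw [FormalMultilinearSeries.coeff_ofScalars, smul_eq_mul, mul_comm]
  have h3 := norm_cauchyPowerSeries_le (kern κ) 0 x n
  rw [h1.eq_formalMultilinearSeries h2, FormalMultilinearSeries.ofScalars_norm, Complex.norm_real,
    Real.norm_of_nonneg (sq_nonneg _), abs_of_pos hx, inv_pow, ← div_eq_mul_inv,
    le_div_iff₀ (by positivity)] at h3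
  exact h3

end RandomAnalytic

/-! ### Real Möbius maps and the transformation of the kernel -/

namespace RandomAnalytic

open Metric Set

variable {κ : ℝ}

lemma convex_sq_region (hκ : κ ≤ 0) : Convex ℝ {z : ℂ | 0 < 1 + κ * ‖z‖ ^ 2} := by
  have h := (((convexOn_univ_norm (E := ℂ)).pow (fun _ _ => norm_nonneg _) 2).smul
    (neg_nonneg.2 hκ)).convex_lt 1
  have h2 : {z : ℂ | 0 < 1 + κ * ‖z‖ ^ 2} = {z ∈ univ | (-κ) • (norm ^ 2) z < 1} := by
    ext z
    simp only [Set.mem_ofPred_eq, mem_univ, true_and, smul_eq_mul, Pi.pow_apply]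
    constructor <;> intro h <;> linarith
  rw [h2]
  exact h

lemma isOpen_sq_region : IsOpen {z : ℂ | 0 < 1 + κ * ‖z‖ ^ 2} :=
  isOpen_lt continuous_const (by fun_prop)

/-- The arithmetic-geometric mean inequality: ‖z‖‖w‖ ≤ (‖z‖² + ‖w‖²) / 2. -/
lemma pos_mul (hκ : κ ≤ 0) {z w : ℂ} (hz : 0 < 1 + κ * ‖z‖ ^ 2) (hw : 0 < 1 + κ * ‖w‖ ^ 2) :
    0 < 1 + κ * ‖z * w‖ := by
  rw [norm_mul]
  nlinarith [mul_nonneg (neg_nonneg.2 hκ) (sq_nonneg (‖z‖ - ‖w‖))]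

lemma mobius_ofReal (r : ℝ) (z : ℂ) : mobius κ r z = (z - r) / (1 + κ * (r * z)) := by
  rw [mobius, Complex.conj_ofReal, mul_assoc]

lemma norm_ofReal_pos {r : ℝ} (hr : 0 < 1 + κ * r ^ 2) : 0 < 1 + κ * ‖(r : ℂ)‖ ^ 2 := by
  rwa [Complex.norm_real, Real.norm_eq_abs, sq_abs]

lemma neg_sq_pos {r : ℝ} (hr : 0 < 1 + κ * r ^ 2) : 0 < 1 + κ * (-r) ^ 2 := by rwa [neg_sq]

lemma mobius_denom_ne_zero (hκ : κ ≤ 0) {r : ℝ} (hr : 0 < 1 + κ * r ^ 2) {z : ℂ}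
    (hz : 0 < 1 + κ * ‖z‖ ^ 2) : 1 + (κ : ℂ) * (r * z) ≠ 0 :=
  one_add_mul_ne_zero hκ (pos_mul hκ (norm_ofReal_pos hr) hz)

/-- Besides invariance of the disk, this identity shows how the image is pushed to the boundary when
1 + κr² tends to 0. -/
lemma one_add_norm_mobius_sq (hκ : κ ≤ 0) {r : ℝ} (hr : 0 < 1 + κ * r ^ 2) {z : ℂ}
    (hz : 0 < 1 + κ * ‖z‖ ^ 2) :
    1 + κ * ‖mobius κ r z‖ ^ 2 =
      (1 + κ * r ^ 2) * (1 + κ * ‖z‖ ^ 2) / ‖1 + (κ : ℂ) * (r * z)‖ ^ 2 := by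
  have h := mobius_denom_ne_zero hκ hr hz
  have h' : ‖1 + (κ : ℂ) * (r * z)‖ ^ 2 ≠ 0 := pow_ne_zero _ (norm_ne_zero_iff.2 h)
  rw [mobius_ofReal, norm_div, div_pow, eq_div_iff h', add_mul, mul_assoc, div_mul_cancel₀ _ h']
  simp only [Complex.sq_norm, Complex.normSq_apply, Complex.sub_re, Complex.sub_im,
    Complex.add_re, Complex.add_im, Complex.one_re, Complex.one_im, Complex.re_ofReal_mul,
    Complex.im_ofReal_mul, Complex.ofReal_re, Complex.ofReal_im]
  ring

lemma one_add_norm_mobius_sq_pos (hκ : κ ≤ 0) {r : ℝ} (hr : 0 < 1 + κ * r ^ 2) {z : ℂ}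
    (hz : 0 < 1 + κ * ‖z‖ ^ 2) : 0 < 1 + κ * ‖mobius κ r z‖ ^ 2 := by
  rw [one_add_norm_mobius_sq hκ hr hz]
  have h := norm_pos_iff.2 (mobius_denom_ne_zero hκ hr hz)
  positivity

lemma mobius_mobius_neg (hκ : κ ≤ 0) {r : ℝ} (hr : 0 < 1 + κ * r ^ 2) {z : ℂ}
    (hz : 0 < 1 + κ * ‖z‖ ^ 2) : mobius κ r (mobius κ ((-r : ℝ) : ℂ) z) = z := by
  have h1 := mobius_denom_ne_zero hκ (neg_sq_pos hr) hz
  have h2 := mobius_denom_ne_zero hκ hr (one_add_norm_mobius_sq_pos hκ (neg_sq_pos hr) hz)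
  rw [mobius_ofReal, div_eq_iff h2]
  have h3 : mobius κ ((-r : ℝ) : ℂ) z * (1 + κ * (((-r : ℝ) : ℂ) * z)) = z - ((-r : ℝ) : ℂ) := by
    rw [mobius_ofReal, div_mul_cancel₀ _ h1]
  push_cast at h3 ⊢
  linear_combination h3

lemma mobius_neg_mobius (hκ : κ ≤ 0) {r : ℝ} (hr : 0 < 1 + κ * r ^ 2) {z : ℂ}
    (hz : 0 < 1 + κ * ‖z‖ ^ 2) : mobius κ ((-r : ℝ) : ℂ) (mobius κ r z) = z := by
  simpa using mobius_mobius_neg hκ (neg_sq_pos hr) hz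

lemma mobius_conj (r : ℝ) (z : ℂ) :
    mobius κ r (starRingEnd ℂ z) = starRingEnd ℂ (mobius κ r z) := by
  simp [mobius_ofReal]

lemma hasDerivAt_mobius (hκ : κ ≤ 0) {r : ℝ} (hr : 0 < 1 + κ * r ^ 2) {z : ℂ}
    (hz : 0 < 1 + κ * ‖z‖ ^ 2) :
    HasDerivAt (mobius κ r) (((1 + κ * r ^ 2 : ℝ) : ℂ) / (1 + κ * (r * z)) ^ 2) z := by
  have h := mobius_denom_ne_zero hκ hr hz
  have h1 : HasDerivAt (fun z : ℂ => z - r) 1 z := (hasDerivAt_id z).sub_const _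
  have h2 : HasDerivAt (fun z : ℂ => 1 + (κ : ℂ) * (r * z)) (κ * r) z :=
    ((((hasDerivAt_id z).const_mul (r : ℂ)).const_mul (κ : ℂ)).const_add 1).congr_deriv
      (by rw [mul_one])
  have h3 := h1.div h2 h
  have h4 : mobius κ r = (fun z : ℂ => z - r) / fun z : ℂ => 1 + (κ : ℂ) * (r * z) :=
    funext fun z => mobius_ofReal r z
  rw [h4]
  refine h3.congr_deriv ?_
  push_cast
  congr 1
  ring

/-- The transformation rule of the covariance kernel under real Möbius transformations. -/
lemma kern_mobius (hκ : κ ≤ 0) {r : ℝ} (hr : 0 < 1 + κ * r ^ 2) {w v : ℂ}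
    (hw : 0 < 1 + κ * ‖w‖ ^ 2) (hv : 0 < 1 + κ * ‖v‖ ^ 2) :
    kern κ (mobius κ ((-r : ℝ) : ℂ) w * mobius κ ((-r : ℝ) : ℂ) v) *
      kern κ (((-r : ℝ) : ℂ) * w) * kern κ (((-r : ℝ) : ℂ) * v) =
      kernReal κ (r ^ 2) * kern κ (w * v) := by
  set q : ℝ := -r with hq
  have hqr : 0 < 1 + κ * q ^ 2 := neg_sq_pos hr
  have hqn := norm_ofReal_pos hqr
  set b := mobius κ q v with hb
  have hbn : 0 < 1 + κ * ‖b‖ ^ 2 := one_add_norm_mobius_sq_pos hκ hqr hv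
  -- With `v` fixed, both sides are compared as functions of the first variable. Since k'/k = 1/(1 +
  -- κ·), vanishing of the logarithmic derivative of this quotient is the rational identity `key`.
  have hder : ∀ z : ℂ, 0 < 1 + κ * ‖z‖ ^ 2 →
      HasDerivAt (fun z => kern κ (mobius κ q z * b) * kern κ (q * z) / kern κ (z * v)) 0 z := by
    intro z hz
    have hmz := one_add_norm_mobius_sq_pos hκ hqr hz
    have p1 := pos_mul hκ hmz hbn
    have p2 := pos_mul hκ hqn hz
    have p3 := pos_mul hκ hz hv
    have d1 : HasDerivAt (fun z => kern κ (mobius κ q z * b)) _ z :=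
      HasDerivAt.comp z (h := fun z => mobius κ q z * b) (hasDerivAt_kern hκ p1)
        ((hasDerivAt_mobius hκ hqr hz).mul_const b)
    have d2 : HasDerivAt (fun z => kern κ (q * z)) _ z :=
      HasDerivAt.comp z (h := fun z : ℂ => q * z) (hasDerivAt_kern hκ p2)
        ((hasDerivAt_id z).const_mul (q : ℂ))
    have d3 : HasDerivAt (fun z => kern κ (z * v)) _ z :=
      HasDerivAt.comp z (h := fun z : ℂ => z * v) (hasDerivAt_kern hκ p3)
        ((hasDerivAt_id z).mul_const v)
    refine ((d1.mul d2).div d3 (kern_ne_zero hκ p3)).congr_deriv ?_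
    have n1 := one_add_mul_ne_zero hκ p1
    have n2 := one_add_mul_ne_zero hκ p2
    have n3 := one_add_mul_ne_zero hκ p3
    have n4 := mobius_denom_ne_zero hκ hqr hv
    have n2' : 1 + (κ : ℂ) * q * z ≠ 0 := by rwa [mul_assoc]
    have n3' : 1 + (κ : ℂ) * z * v ≠ 0 := by rwa [mul_assoc]
    have n4' : 1 + (κ : ℂ) * q * v ≠ 0 := by rwa [mul_assoc]
    have key : (((1 + κ * q ^ 2 : ℝ) : ℂ) / (1 + κ * (q * z)) ^ 2) * b *
        (1 + κ * (mobius κ q z * b))⁻¹ + q * (1 + κ * (q * z))⁻¹ = v * (1 + κ * (z * v))⁻¹ := by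
      have e1 : 1 + (κ : ℂ) * (mobius κ q z * b) =
          ((1 + κ * q ^ 2 : ℝ) : ℂ) * (1 + κ * (z * v)) /
            ((1 + κ * (q * z)) * (1 + κ * (q * v))) := by
        have ha' : mobius κ q z * (1 + κ * (q * z)) = z - q := by
          rw [mobius_ofReal, div_mul_cancel₀ _ n2]
        have hb' : b * (1 + κ * (q * v)) = v - q := by
          rw [hb, mobius_ofReal, div_mul_cancel₀ _ n4]
        rw [eq_div_iff (mul_ne_zero n2 n4)]
        push_cast
        linear_combination κ * (b * (1 + κ * (q * v))) * ha' + κ * (z - q) * hb'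
      have n5 : ((1 + κ * q ^ 2 : ℝ) : ℂ) ≠ 0 := by exact_mod_cast hqr.ne'
      rw [e1, hb, mobius_ofReal]
      simp only [← mul_assoc]
      field_simp
      ring
    simp only [mul_one, one_mul, Pi.mul_apply]
    have : kern κ (z * v) ≠ 0 := kern_ne_zero hκ p3
    rw [div_eq_zero_iff]
    left
    linear_combination kern κ (mobius κ q z * b) * kern κ (q * z) * kern κ (z * v) * key
  -- The constant is evaluated at `q`, which the Möbius map sends to 0, where the kernel is 1.
  have hconst := isOpen_sq_region.is_const_of_deriv_eq_zero (𝕜 := ℂ)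
    (convex_sq_region hκ).isPreconnected
    (fun z hz => (hder z hz).differentiableAt.differentiableWithinAt)
    (fun z hz => (hder z hz).deriv) (x := w) (y := (q : ℂ)) hw hqn
  have hz0 : mobius κ q (q : ℂ) = 0 := by rw [mobius_ofReal, sub_self, zero_div]
  have h3 := kern_ne_zero hκ (pos_mul hκ hw hv)
  have h4 := kern_ne_zero hκ (pos_mul hκ hqn hv)
  simp only [hz0, zero_mul, kern_zero, one_mul] at hconst
  rw [div_eq_div_iff h3 h4] at hconst
  rw [hconst]
  congr 1
  rw [← kern_ofReal]
  congr 1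
  rw [hq]
  push_cast
  ring

/-- The factor that makes the composition with a Möbius transformation preserve the covariance. -/
noncomputable def normalizer (κ r : ℝ) (w : ℂ) : ℂ :=
  kern κ (((-r : ℝ) : ℂ) * w) / (Real.sqrt (kernReal κ (r ^ 2)) : ℂ)

lemma kernReal_pos (hκ : κ ≤ 0) {x : ℝ} (hx : 0 ≤ x) (h : 0 < 1 + κ * x) : 0 < kernReal κ x :=
  one_pos.trans_le (one_le_kernReal hκ hx h)

lemma normalizer_ne_zero (hκ : κ ≤ 0) {r : ℝ} (hr : 0 < 1 + κ * r ^ 2) {w : ℂ}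
    (hw : 0 < 1 + κ * ‖w‖ ^ 2) : normalizer κ r w ≠ 0 := by
  refine div_ne_zero (kern_ne_zero hκ (pos_mul hκ (norm_ofReal_pos (neg_sq_pos hr)) hw)) ?_
  have := Real.sqrt_pos.2 (kernReal_pos hκ (sq_nonneg r) hr)
  exact_mod_cast this.ne'

lemma normalizer_conj (r : ℝ) (w : ℂ) :
    normalizer κ r (starRingEnd ℂ w) = starRingEnd ℂ (normalizer κ r w) := by
  rw [normalizer, normalizer, map_div₀, ← kern_conj, map_mul, Complex.conj_ofReal,
    Complex.conj_ofReal]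

lemma differentiableAt_normalizer (hκ : κ ≤ 0) {r : ℝ} (hr : 0 < 1 + κ * r ^ 2) {w : ℂ}
    (hw : 0 < 1 + κ * ‖w‖ ^ 2) : DifferentiableAt ℂ (normalizer κ r) w := by
  have h1 := (hasDerivAt_kern hκ (pos_mul hκ (norm_ofReal_pos (neg_sq_pos hr)) hw)).comp w
    ((hasDerivAt_id w).const_mul (((-r : ℝ) : ℂ)))
  exact (h1.div_const _).differentiableAt

/-- Invariance of the covariance: the left side is E g(w) g(v) for the shifted function g, and the
right side is E f(w) f(v). -/
lemma normalizer_mul_kern (hκ : κ ≤ 0) {r : ℝ} (hr : 0 < 1 + κ * r ^ 2) {w v : ℂ}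
    (hw : 0 < 1 + κ * ‖w‖ ^ 2) (hv : 0 < 1 + κ * ‖v‖ ^ 2) :
    normalizer κ r w * normalizer κ r v *
      kern κ (mobius κ ((-r : ℝ) : ℂ) w * mobius κ ((-r : ℝ) : ℂ) v) = kern κ (w * v) := by
  have h1 := kern_mobius hκ hr hw hv
  have hpos := kernReal_pos hκ (sq_nonneg r) hr
  have h2 : (Real.sqrt (kernReal κ (r ^ 2)) : ℂ) * (Real.sqrt (kernReal κ (r ^ 2)) : ℂ) =
      kernReal κ (r ^ 2) := by
    rw [← Complex.ofReal_mul, Real.mul_self_sqrt hpos.le]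
  have h3 : (kernReal κ (r ^ 2) : ℂ) ≠ 0 := by exact_mod_cast hpos.ne'
  rw [normalizer, normalizer, div_mul_div_comm, h2, div_mul_eq_mul_div, div_eq_iff h3]
  linear_combination h1

/-- The case v = w̄ of `normalizer_mul_kern`, since for real `r` everything commutes with
conjugation. -/
lemma norm_normalizer_sq (hκ : κ ≤ 0) {r : ℝ} (hr : 0 < 1 + κ * r ^ 2) {w : ℂ}
    (hw : 0 < 1 + κ * ‖w‖ ^ 2) :
    ‖normalizer κ r w‖ ^ 2 * kernReal κ (‖mobius κ ((-r : ℝ) : ℂ) w‖ ^ 2) =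
      kernReal κ (‖w‖ ^ 2) := by
  have hw' : 0 < 1 + κ * ‖starRingEnd ℂ w‖ ^ 2 := by rwa [RCLike.norm_conj]
  have h := normalizer_mul_kern hκ hr hw hw'
  rw [normalizer_conj, mobius_conj, Complex.mul_conj, Complex.mul_conj, Complex.mul_conj,
    Complex.normSq_eq_norm_sq, Complex.normSq_eq_norm_sq, Complex.normSq_eq_norm_sq,
    kern_ofReal, kern_ofReal] at h
  exact_mod_cast h

end RandomAnalytic

/-! ### No term of the kernel dominates near the boundary -/

namespace RandomAnalytic

open Metric Set

variable {κ : ℝ}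

/-- The mean modulus of the kernel on a circle, relative to its maximum. -/
noncomputable def circleRatio (κ x : ℝ) : ℝ :=
  ∫ θ in (0 : ℝ)..2 * Real.pi, ‖kern κ (circleMap 0 x θ)‖ / kernReal κ x

lemma continuous_kern_circleMap (hκ : κ ≤ 0) {x : ℝ} (hx : 0 ≤ x) (h : 0 < 1 + κ * x) :
    Continuous fun θ => kern κ (circleMap 0 x θ) := by
  refine continuous_iff_continuousAt.2 fun θ => ?_
  have h1 : 0 < 1 + κ * ‖circleMap 0 x θ‖ := by
    rwa [norm_circleMap_zero, abs_of_nonneg hx]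
  exact (hasDerivAt_kern hκ h1).continuousAt.comp (f := circleMap 0 x)
    (continuous_circleMap 0 x).continuousAt

/-- Dominated convergence with majorant 1, as the kernel is largest on the positive axis. The
endpoints θ = 0 and 2π, where the ratio is 1, form a null set. -/
lemma tendsto_circleRatio (hκ : κ ≤ 0) {l : Filter ℝ} [l.IsCountablyGenerated]
    (hl : ∀ᶠ x in l, 0 ≤ x ∧ 0 < 1 + κ * x)
    (hlim : ∀ θ ∈ Ioo 0 (2 * Real.pi),
      Tendsto (fun x : ℝ => ‖kern κ (circleMap 0 x θ)‖ / kernReal κ x) l (𝓝 0)) :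
    Tendsto (circleRatio κ) l (𝓝 0) := by
  have h := intervalIntegral.tendsto_integral_filter_of_dominated_convergence (μ := volume)
    (a := 0) (b := 2 * Real.pi) (l := l) (f := fun _ => (0 : ℝ))
    (F := fun x θ => ‖kern κ (circleMap 0 x θ)‖ / kernReal κ x) (fun _ => 1) ?_ ?_
    intervalIntegrable_const ?_
  · rw [intervalIntegral.integral_zero] at h
    exact h
  · filter_upwards [hl] with x hx
    exact ((continuous_kern_circleMap hκ hx.1 hx.2).norm.div_const _).aestronglyMeasurable
  · filter_upwards [hl] with x hx
    refine ae_of_all _ fun θ _ => ?_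
    have hpos := kernReal_pos hκ hx.1 hx.2
    rw [Real.norm_of_nonneg (by positivity), div_le_one hpos]
    refine norm_kern_le hκ ?_ hx.2
    rw [norm_circleMap_zero, abs_of_nonneg hx.1]
  · have h0 : ∀ᵐ θ : ℝ, θ ≠ 2 * Real.pi := by simp [ae_iff, measure_singleton]
    filter_upwards [h0] with θ hθ hmem
    rw [uIoc_of_le Real.two_pi_pos.le] at hmem
    exact hlim θ ⟨hmem.1, lt_of_le_of_ne hmem.2 hθ⟩

lemma cos_lt_one_of_mem {θ : ℝ} (hθ : θ ∈ Ioo 0 (2 * Real.pi)) : Real.cos θ < 1 := by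
  refine lt_of_le_of_ne (Real.cos_le_one θ) fun h => ?_
  have := (Real.cos_eq_one_iff_of_lt_of_lt (by linarith [hθ.1, Real.pi_pos]) hθ.2).1 h
  exact hθ.1.ne' this

lemma tendsto_circleRatio_zero : Tendsto (circleRatio 0) atTop (𝓝 0) := by
  refine tendsto_circleRatio le_rfl ?_ fun θ hθ => ?_
  · filter_upwards [eventually_ge_atTop 0] with x hx
    exact ⟨hx, by simp⟩
  · have h1 : Tendsto (fun x : ℝ => Real.exp (x * (Real.cos θ - 1))) atTop (𝓝 0) := by
      refine Real.tendsto_exp_atBot.comp ?_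
      exact tendsto_id.atTop_mul_const_of_neg (by linarith [cos_lt_one_of_mem hθ])
    refine h1.congr fun x => ?_
    have h2 : kernReal 0 x = Real.exp x := by
      have := kern_ofReal (κ := 0) x
      rw [kern_zero_left] at this
      exact_mod_cast this.symm
    rw [h2, kern_zero_left, Complex.norm_exp, ← Real.exp_sub]
    congr 1
    simp [circleMap, Complex.exp_re, mul_sub]

lemma norm_kern_of_neg (hκ : κ < 0) {z : ℂ} (hz : 0 < 1 + κ * ‖z‖) :
    ‖kern κ z‖ = Real.exp (κ⁻¹ * Real.log ‖1 + (κ : ℂ) * z‖) := by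
  rw [kern_of_neg hκ hz, Complex.norm_exp, ← Complex.ofReal_inv, Complex.re_ofReal_mul,
    Complex.log_re]

lemma kernReal_of_neg (hκ : κ < 0) {x : ℝ} (hx : 0 ≤ x) (h : 0 < 1 + κ * x) :
    kernReal κ x = Real.exp (κ⁻¹ * Real.log (1 + κ * x)) := by
  have h1 := norm_kern_of_neg hκ (z := x) (by rwa [Complex.norm_real, Real.norm_of_nonneg hx])
  rw [kern_ofReal, Complex.norm_real, Real.norm_of_nonneg (kernReal_pos hκ.le hx h).le] at h1
  rw [h1]
  congr 2
  have : (1 : ℂ) + κ * x = ((1 + κ * x : ℝ) : ℂ) := by push_cast; ring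
  rw [this, Complex.norm_real, Real.norm_of_nonneg h.le]

/-- On the circle of radius -κ⁻¹ the kernel is singular only on the positive axis. At any other
angle its modulus has a finite limit, while `kernReal κ x` tends to infinity. -/
lemma tendsto_circleRatio_of_neg (hκ : κ < 0) :
    Tendsto (circleRatio κ) (𝓝[<] (-κ⁻¹)) (𝓝 0) := by
  have hb : 0 < -κ⁻¹ := neg_pos.2 (inv_lt_zero.2 hκ)
  have hl : ∀ᶠ x in 𝓝[<] (-κ⁻¹), 0 ≤ x ∧ 0 < 1 + κ * x := by
    filter_upwards [Ico_mem_nhdsLT hb] with x hx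
    refine ⟨hx.1, ?_⟩
    have := mul_lt_mul_of_neg_left hx.2 hκ
    rw [mul_neg, mul_inv_cancel₀ hκ.ne] at this
    linarith
  refine tendsto_circleRatio hκ.le hl fun θ hθ => ?_
  have hne : 1 + (κ : ℂ) * circleMap 0 (-κ⁻¹) θ ≠ 0 := by
    intro h0
    have hκ' : (κ : ℂ) ≠ 0 := by exact_mod_cast hκ.ne
    have h1 : Complex.exp (θ * Complex.I) = 1 := by
      rw [circleMap_zero] at h0
      push_cast at h0
      field_simp at h0
      linear_combination -h0
    have h2 := congrArg Complex.re h1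
    rw [Complex.exp_ofReal_mul_I_re, Complex.one_re] at h2
    exact (cos_lt_one_of_mem hθ).ne h2
  have hc : Tendsto (fun x : ℝ => Real.log ‖1 + (κ : ℂ) * circleMap 0 x θ‖) (𝓝[<] (-κ⁻¹))
      (𝓝 (Real.log ‖1 + (κ : ℂ) * circleMap 0 (-κ⁻¹) θ‖)) := by
    have : ContinuousAt (fun x : ℝ => Real.log ‖1 + (κ : ℂ) * circleMap 0 x θ‖) (-κ⁻¹) := by
      refine ContinuousAt.log ?_ (norm_ne_zero_iff.2 hne)
      simp only [circleMap]
      fun_prop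
    exact this.tendsto.mono_left nhdsWithin_le_nhds
  have hlog : Tendsto (fun x : ℝ => Real.log (1 + κ * x)) (𝓝[<] (-κ⁻¹)) atBot := by
    refine Real.tendsto_log_nhdsGT_zero.comp (tendsto_nhdsWithin_iff.2 ⟨?_, ?_⟩)
    · have : ContinuousAt (fun x : ℝ => 1 + κ * x) (-κ⁻¹) := by fun_prop
      have h2 := this.tendsto.mono_left (nhdsWithin_le_nhds (s := Iio (-κ⁻¹)))
      rwa [mul_neg, mul_inv_cancel₀ hκ.ne, add_neg_cancel] at h2
    · filter_upwards [hl] with x hx using hx.2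
  have hmain : Tendsto (fun x : ℝ => Real.exp (κ⁻¹ *
      (Real.log ‖1 + (κ : ℂ) * circleMap 0 x θ‖ - Real.log (1 + κ * x)))) (𝓝[<] (-κ⁻¹)) (𝓝 0) := by
    refine Real.tendsto_exp_atBot.comp ?_
    refine Tendsto.const_mul_atTop_of_neg (inv_lt_zero.2 hκ) ?_
    simp only [sub_eq_add_neg]
    exact hc.add_atTop (tendsto_neg_atBot_atTop.comp hlog)
  refine hmain.congr' ?_
  filter_upwards [hl] with x hx
  have h1 : 0 < 1 + κ * ‖circleMap 0 x θ‖ := by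
    rw [norm_circleMap_zero, abs_of_nonneg hx.1]
    exact hx.2
  rw [norm_kern_of_neg hκ h1, kernReal_of_neg hκ hx.1 hx.2, ← Real.exp_sub, mul_sub]

/-- No single term dominates the power series of the kernel near the boundary. -/
lemma exists_forall_term_le (hκ : κ ≤ 0) {ε : ℝ} (hε : 0 < ε) :
    ∃ x₀, 0 < x₀ ∧ 0 < 1 + κ * x₀ ∧ ∀ x, x₀ ≤ x → 0 < 1 + κ * x → ∀ n,
      coeff κ n ^ 2 * x ^ n ≤ ε * kernReal κ x := by
  obtain ⟨x₀, hx₀, hx₀', hsmall⟩ : ∃ x₀, 0 < x₀ ∧ 0 < 1 + κ * x₀ ∧ ∀ x, x₀ ≤ x →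
      0 < 1 + κ * x → circleRatio κ x ≤ ε := by
    rcases hκ.eq_or_lt with rfl | hκ
    · obtain ⟨x₀, hx₀⟩ := eventually_atTop.1
        (tendsto_circleRatio_zero.eventually (Iic_mem_nhds hε))
      exact ⟨max x₀ 1, by positivity, by simp,
        fun x hx _ => hx₀ x ((le_max_left _ _).trans hx)⟩
    · have hb : 0 < -κ⁻¹ := neg_pos.2 (inv_lt_zero.2 hκ)
      have h1 := ((tendsto_circleRatio_of_neg hκ).eventually (Iic_mem_nhds hε)).and
        (Ioo_mem_nhdsLT hb)
      obtain ⟨y, hy, hyb⟩ := (mem_nhdsLT_iff_exists_Ico_subset).1 h1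
      have hiff : ∀ x, 0 < 1 + κ * x ↔ x < -κ⁻¹ := by
        intro x
        have h2 : κ * (x + κ⁻¹) = κ * x + 1 := by rw [mul_add, mul_inv_cancel₀ hκ.ne]
        constructor
        · intro h
          by_contra! hx
          have : κ * (x + κ⁻¹) ≤ 0 := mul_nonpos_of_nonpos_of_nonneg hκ.le (by linarith)
          linarith
        · intro h
          have : 0 < κ * (x + κ⁻¹) := mul_pos_of_neg_of_neg hκ (by linarith)
          linarith
      have hy' : y < -κ⁻¹ := hy
      refine ⟨y, (hyb ⟨le_rfl, hy'⟩).2.1, (hiff y).2 hy', fun x hx hx' => ?_⟩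
      exact (hyb ⟨hx, (hiff x).1 hx'⟩).1
  refine ⟨x₀, hx₀, hx₀', fun x hx hx' n => ?_⟩
  have hxpos : 0 < x := hx₀.trans_le hx
  have hk := kernReal_pos hκ hxpos.le hx'
  refine (kern_circle_bound hκ hxpos hx' n).trans ?_
  have h1 : ∫ θ in (0 : ℝ)..2 * Real.pi, ‖kern κ (circleMap 0 x θ)‖ =
      circleRatio κ x * kernReal κ x := by
    rw [circleRatio, intervalIntegral.integral_div, div_mul_cancel₀ _ hk.ne']
  have h0 : 0 ≤ circleRatio κ x :=
    intervalIntegral.integral_nonneg Real.two_pi_pos.le fun θ _ => by positivity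
  have hpi : (2 * Real.pi)⁻¹ ≤ 1 := inv_le_one_of_one_le₀ (by linarith [Real.pi_gt_three])
  rw [h1, ← mul_assoc]
  refine mul_le_mul_of_nonneg_right ?_ hk.le
  calc (2 * Real.pi)⁻¹ * circleRatio κ x ≤ 1 * circleRatio κ x := by gcongr
    _ ≤ ε := by rw [one_mul]; exact hsmall x hx hx'

/-- As `r` approaches the boundary, the image of a compact disk leaves every smaller disk. -/
lemma eventually_le_norm_mobius_sq (hκ : κ ≤ 0) {r : ℕ → ℝ} (hr : ∀ m, 0 < 1 + κ * r m ^ 2)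
    (hlim : ∀ x, 0 ≤ x → 0 < 1 + κ * x → ∀ᶠ m in atTop, x < r m ^ 2) {s : ℝ} (hs : 0 < s)
    (hs' : 0 < 1 + κ * s ^ 2) {x₀ : ℝ} (hx₀ : 0 < x₀) (hx₀' : 0 < 1 + κ * x₀) :
    ∀ᶠ m in atTop, ∀ w : ℂ, ‖w‖ ≤ s → x₀ ≤ ‖mobius κ ((-r m : ℝ) : ℂ) w‖ ^ 2 := by
  rcases hκ.eq_or_lt with rfl | hκ
  -- For κ = 0 the map is translation by `r m`, so |r m| > √x₀ + s suffices.
  · filter_upwards [hlim ((Real.sqrt x₀ + s) ^ 2) (by positivity) (by simp)] with m hm w hw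
    have h1 : Real.sqrt x₀ + s < |r m| := by
      rw [← abs_of_pos (show 0 < Real.sqrt x₀ + s by positivity)]
      exact sq_lt_sq.1 hm
    have h2 : mobius 0 ((-r m : ℝ) : ℂ) w = w + r m := by
      rw [mobius_ofReal]
      push_cast
      simp
    have h3 : Real.sqrt x₀ ≤ ‖w + r m‖ := by
      have h4 := norm_sub_le (w + r m) w
      rw [add_sub_cancel_left, Complex.norm_real, Real.norm_eq_abs] at h4
      linarith
    rw [h2]
    calc x₀ = Real.sqrt x₀ ^ 2 := (Real.sq_sqrt hx₀.le).symm
      _ ≤ _ := by gcongr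
  · -- `1 + κ ‖ψ w‖² ≤ (1 + κ r²) / (1 - √(-κ) s)²`
    set q := Real.sqrt (-κ) with hqdef
    have hq : q ^ 2 = -κ := Real.sq_sqrt (by linarith)
    have hq0 : 0 < q := Real.sqrt_pos.2 (by linarith)
    have hqs : q * s < 1 := by
      have : (q * s) ^ 2 < 1 ^ 2 := by rw [mul_pow, hq]; linarith
      exact lt_of_pow_lt_pow_left₀ 2 (by norm_num) this
    set D := (1 - q * s) ^ 2 with hD
    have hDpos : 0 < D := by
      have : 0 < 1 - q * s := by linarith
      positivity
    -- `D` bounds the squared denominator from below, so 1 + κr² ≤ D(1 + κx₀) forces the image past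
    -- x₀. The cap 1/2 keeps (1 - η)/(-κ) nonnegative, as `hlim` requires.
    set η := min (D * (1 + κ * x₀)) (1 / 2) with hη
    have hηpos : 0 < η := by positivity
    have hη2 : η ≤ 1 / 2 := min_le_right _ _
    have hx1 : 1 + κ * ((1 - η) / (-κ)) = η := by
      have := hκ.ne
      field_simp
      ring
    filter_upwards [hlim ((1 - η) / (-κ)) (div_nonneg (by linarith) (by linarith))
      (by rw [hx1]; exact hηpos)] with m hm w hw
    have hw' : 0 < 1 + κ * ‖w‖ ^ 2 := pos_of_le hκ.le (by gcongr) hs'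
    have h1 : 1 + κ * r m ^ 2 < η := by
      rw [← hx1]
      have := mul_lt_mul_of_neg_left hm hκ
      linarith
    have hqr : q * |r m| ≤ 1 := by
      have : (q * |r m|) ^ 2 ≤ 1 ^ 2 := by
        rw [mul_pow, hq, sq_abs]
        linarith [hr m]
      exact le_of_sq_le_sq this (by norm_num)
    have hden : D ≤ ‖1 + (κ : ℂ) * (((-r m : ℝ) : ℂ) * w)‖ ^ 2 := by
      have h2 : 1 - q * s ≤ ‖1 + (κ : ℂ) * (((-r m : ℝ) : ℂ) * w)‖ := by
        have h3 : ‖(κ : ℂ) * (((-r m : ℝ) : ℂ) * w)‖ ≤ q * s := by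
          rw [norm_mul, norm_mul, Complex.norm_real, Complex.norm_real, Real.norm_eq_abs,
            Real.norm_eq_abs, abs_of_neg hκ, abs_neg, ← hq]
          calc q ^ 2 * (|r m| * ‖w‖) = (q * |r m|) * (q * ‖w‖) := by ring
            _ ≤ 1 * (q * s) := by gcongr
            _ = q * s := one_mul _
        have h4 := norm_sub_le (1 + (κ : ℂ) * (((-r m : ℝ) : ℂ) * w))
          ((κ : ℂ) * (((-r m : ℝ) : ℂ) * w))
        rw [add_sub_cancel_right, norm_one] at h4
        linarith
      rw [hD]
      exact pow_le_pow_left₀ (by linarith) h2 2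
    have h5 : 1 + κ * ‖mobius κ ((-r m : ℝ) : ℂ) w‖ ^ 2 ≤ 1 + κ * x₀ := by
      rw [one_add_norm_mobius_sq hκ.le (neg_sq_pos (hr m)) hw', neg_sq,
        div_le_iff₀ (hDpos.trans_le hden)]
      have h6 : (1 + κ * r m ^ 2) * (1 + κ * ‖w‖ ^ 2) ≤ η * 1 := by
        have h7 : κ * ‖w‖ ^ 2 ≤ 0 := mul_nonpos_of_nonpos_of_nonneg hκ.le (sq_nonneg _)
        have := hr m
        gcongr
        linarith
      calc _ ≤ η := by linarith
        _ ≤ D * (1 + κ * x₀) := min_le_left _ _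
        _ ≤ (1 + κ * x₀) * ‖1 + (κ : ℂ) * (((-r m : ℝ) : ℂ) * w)‖ ^ 2 := by
          rw [mul_comm]
          gcongr
    have h8 : κ * ‖mobius κ ((-r m : ℝ) : ℂ) w‖ ^ 2 ≤ κ * x₀ := by linarith
    exact (mul_le_mul_left_of_neg hκ).1 h8

end RandomAnalytic

/-! ### Taylor coefficients at the origin and coefficient extraction from kernels -/

namespace RandomAnalytic

open Metric Set

/-- The Taylor coefficients of a function at the origin. -/
noncomputable def taylorCoeff (k : ℕ) (g : ℂ → ℂ) : ℂ := iteratedDeriv k g 0 / k.factorial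

lemma norm_taylorCoeff_le {g : ℂ → ℂ} {s C : ℝ} (k : ℕ) (hs : 0 < s)
    (hg : DiffContOnCl ℂ g (ball 0 s)) (hC : ∀ z ∈ sphere 0 s, ‖g z‖ ≤ C) :
    ‖taylorCoeff k g‖ ≤ C / s ^ k := by
  have h := Complex.norm_iteratedDeriv_le_of_forall_mem_sphere_norm_le k hs hg hC
  have hk : (0 : ℝ) < k.factorial := by exact_mod_cast k.factorial_pos
  rw [taylorCoeff, norm_div, Complex.norm_natCast, div_le_iff₀ hk]
  calc _ ≤ _ := h
    _ = _ := by ring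

lemma hasSum_taylorCoeff {g : ℂ → ℂ} {s : ℝ} (hg : DiffContOnCl ℂ g (ball 0 s)) {z : ℂ}
    (hz : z ∈ ball 0 s) : HasSum (fun k => taylorCoeff k g * z ^ k) (g z) := by
  refine (Complex.hasSum_taylorSeries_on_ball hg.differentiableOn hz).congr_fun fun k => ?_
  rw [taylorCoeff, sub_zero, smul_eq_mul, smul_eq_mul]
  ring

lemma taylorCoeff_eq {g : ℂ → ℂ} {s : ℝ} (hs : 0 < s) {b : ℕ → ℂ}
    (h : ∀ z ∈ ball 0 s, HasSum (fun k => b k * z ^ k) (g z)) (k : ℕ) : taylorCoeff k g = b k := by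
  have h1 : HasFPowerSeriesAt g (FormalMultilinearSeries.ofScalars ℂ b) 0 := by
    rw [hasFPowerSeriesAt_iff]
    filter_upwards [ball_mem_nhds (0 : ℂ) hs] with z hz
    rw [zero_add]
    refine (h z hz).congr_fun fun k => ?_
    rw [FormalMultilinearSeries.coeff_ofScalars, smul_eq_mul, mul_comm]
  have h2 := h1.analyticAt.hasFPowerSeriesAt
  have h3 := congrArg (fun p => FormalMultilinearSeries.coeff p k)
    (h2.eq_formalMultilinearSeries h1)
  simpa [FormalMultilinearSeries.coeff_ofScalars, taylorCoeff] using h3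

lemma taylorCoeff_conj {g : ℂ → ℂ} {s : ℝ} (hs : 0 < s) (hg : DiffContOnCl ℂ g (ball 0 s))
    (h : ∀ z ∈ ball 0 s, g (starRingEnd ℂ z) = starRingEnd ℂ (g z)) (k : ℕ) :
    starRingEnd ℂ (taylorCoeff k g) = taylorCoeff k g := by
  refine (taylorCoeff_eq hs (b := fun k => starRingEnd ℂ (taylorCoeff k g)) (fun z hz => ?_) k).symm
  have hz' : starRingEnd ℂ z ∈ ball (0 : ℂ) s := by
    rw [mem_ball_zero_iff] at hz ⊢
    rwa [RCLike.norm_conj]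
  have h1 := (Complex.hasSum_conj'.2 (hasSum_taylorCoeff hg hz'))
  rw [h z hz, Complex.conj_conj] at h1
  exact h1.congr_fun fun k => by simp

/-- Cauchy's estimate bounds the error of each partial sum by the corresponding tail of ∑ u_n,
divided by s^k. -/
lemma hasSum_taylorCoeff_of_hasSum {g : ℂ → ℂ} {G : ℕ → ℂ → ℂ} {s : ℝ} (hs : 0 < s)
    (hg : DiffContOnCl ℂ g (ball 0 s)) (hG : ∀ n, DiffContOnCl ℂ (G n) (ball 0 s)) {u : ℕ → ℝ}
    (hu : Summable u) (hGu : ∀ n, ∀ z ∈ sphere 0 s, ‖G n z‖ ≤ u n)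
    (hsum : ∀ z ∈ sphere 0 s, HasSum (fun n => G n z) (g z)) (k : ℕ) :
    HasSum (fun n => taylorCoeff k (G n)) (taylorCoeff k g) := by
  have hdiff : ∀ F : Finset ℕ, DiffContOnCl ℂ (fun z => g z - ∑ n ∈ F, G n z) (ball 0 s) := by
    intro F
    refine hg.sub ⟨?_, ?_⟩
    · exact DifferentiableOn.fun_sum fun n _ => (hG n).differentiableOn
    · exact continuousOn_finsetSum _ fun n _ => (hG n).continuousOn
  have h1 : ∀ F : Finset ℕ, ‖taylorCoeff k g - ∑ n ∈ F, taylorCoeff k (G n)‖ ≤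
      (∑' n, u n - ∑ n ∈ F, u n) / s ^ k := by
    intro F
    have h2 : taylorCoeff k (fun z => g z - ∑ n ∈ F, G n z) =
        taylorCoeff k g - ∑ n ∈ F, taylorCoeff k (G n) := by
      refine taylorCoeff_eq hs
        (b := fun k => taylorCoeff k g - ∑ n ∈ F, taylorCoeff k (G n)) (fun z hz => ?_) k
      refine ((hasSum_taylorCoeff hg hz).sub
        (hasSum_sum fun n (_ : n ∈ F) => hasSum_taylorCoeff (hG n) hz)).congr_fun fun k => ?_
      rw [sub_mul, Finset.sum_mul]
    rw [← h2]
    refine norm_taylorCoeff_le k hs (hdiff F) fun z hz => ?_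
    have h3 : HasSum (fun n : {n // n ∉ F} => G n z) (g z - ∑ n ∈ F, G n z) :=
      by
      refine (F.hasSum_compl_iff (f := fun n => G n z)).2 ?_
      rw [sub_add_cancel]
      exact hsum z hz
    have h4 : HasSum (fun n : {n // n ∉ F} => u n) (∑' n, u n - ∑ n ∈ F, u n) :=
      by
      refine (F.hasSum_compl_iff (f := u)).2 ?_
      rw [sub_add_cancel]
      exact hu.hasSum
    exact h3.norm_le_of_bounded h4 fun n => hGu n z hz
  have h5 : Tendsto (fun F : Finset ℕ => (∑' n, u n - ∑ n ∈ F, u n) / s ^ k) atTop (𝓝 0) := by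
    have := (hu.hasSum.const_sub (∑' n, u n)).div_const (s ^ k)
    simpa using this
  have h6 := squeeze_zero_norm h1 h5
  have h7 := h6.const_sub (taylorCoeff k g)
  simpa [HasSum] using h7

lemma taylorCoeff_const_mul {g : ℂ → ℂ} {s : ℝ} (hs : 0 < s) (hg : DiffContOnCl ℂ g (ball 0 s))
    (c : ℂ) (k : ℕ) : taylorCoeff k (fun z => c * g z) = c * taylorCoeff k g :=
  taylorCoeff_eq hs (b := fun k => c * taylorCoeff k g)
    (fun _ hz => ((hasSum_taylorCoeff hg hz).mul_left c).congr_fun fun _ => mul_assoc _ _ _) k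

/-- An expansion of a diagonal kernel into products gives orthogonality relations between the
Taylor coefficients of the factors. -/
lemma hasSum_taylorCoeff_mul {G : ℕ → ℂ → ℂ} {s : ℝ} (hs : 0 < s)
    (hG : ∀ n, DiffContOnCl ℂ (G n) (ball 0 s)) {u : ℕ → ℝ} (hu : Summable u)
    (hGu : ∀ n, ∀ z ∈ closedBall 0 s, ‖G n z‖ ≤ u n) {b : ℕ → ℂ} {K : ℂ → ℂ → ℂ}
    (hK : ∀ w ∈ closedBall 0 s, DiffContOnCl ℂ (fun z => K z w) (ball 0 s))
    (hKG : ∀ z ∈ closedBall 0 s, ∀ w ∈ closedBall 0 s, HasSum (fun n => G n z * G n w) (K z w))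
    (hKb : ∀ z ∈ closedBall 0 s, ∀ w ∈ closedBall 0 s,
      HasSum (fun k => b k * (z * w) ^ k) (K z w)) (k l : ℕ) :
    HasSum (fun n => taylorCoeff k (G n) * taylorCoeff l (G n)) (if k = l then b k else 0) := by
  have hu0 : ∀ n, 0 ≤ u n := fun n =>
    (norm_nonneg _).trans (hGu n 0 (mem_closedBall_self hs.le))
  have huu : Summable fun n => u n * u n := by
    refine Summable.of_nonneg_of_le (fun n => mul_nonneg (hu0 n) (hu0 n)) (fun n => ?_)
      (hu.mul_left (∑' n, u n))
    exact mul_le_mul_of_nonneg_right (hu.le_tsum n fun m _ => hu0 m) (hu0 n)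
  -- Coefficients are extracted one variable at a time: z^k with `w` frozen here, then w^l in `h4`.
  have h1 : ∀ w ∈ closedBall (0 : ℂ) s,
      HasSum (fun n => taylorCoeff k (G n) * G n w) (b k * w ^ k) := by
    intro w hw
    have h2 := hasSum_taylorCoeff_of_hasSum hs (hK w hw) (G := fun n z => G n w * G n z)
      (fun n => (hG n).const_smul (G n w)) huu (fun n z hz => ?_) (fun z hz => ?_) k
    · have h3 : taylorCoeff k (fun z => K z w) = b k * w ^ k := by
        refine taylorCoeff_eq hs (b := fun k => b k * w ^ k) (fun z hz => ?_) k
        refine (hKb z (ball_subset_closedBall hz) w hw).congr_fun fun k => ?_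
        rw [mul_pow]
        ring
      rw [h3] at h2
      refine h2.congr_fun fun n => ?_
      rw [taylorCoeff_const_mul hs (hG n), mul_comm]
    · rw [norm_mul]
      exact mul_le_mul (hGu n w hw) (hGu n z (sphere_subset_closedBall hz)) (norm_nonneg _) (hu0 n)
    · exact (hKG z (sphere_subset_closedBall hz) w hw).congr_fun fun n => mul_comm _ _
  have h4 := hasSum_taylorCoeff_of_hasSum hs (g := fun w => b k * w ^ k)
    (G := fun n w => taylorCoeff k (G n) * G n w) (u := fun n => u n / s ^ k * u n)
    (Differentiable.diffContOnCl (by fun_prop)) (fun n => (hG n).const_smul (taylorCoeff k (G n)))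
    ((huu.div_const (s ^ k)).congr fun n => by ring) (fun n z hz => ?_)
    (fun z hz => h1 z (sphere_subset_closedBall hz)) l
  · have h5 : taylorCoeff l (fun w => b k * w ^ k) = if k = l then b k else 0 := by
      refine taylorCoeff_eq hs (b := fun l => if k = l then b k else 0) (fun z _ => ?_) l
      have := hasSum_ite_eq k (b k * z ^ k)
      refine this.congr_fun fun n => ?_
      by_cases h : n = k
      · simp [h]
      · simp [h, Ne.symm h]
    rw [h5] at h4
    exact h4.congr_fun fun n => (taylorCoeff_const_mul hs (hG n) _ _).symm
  · rw [norm_mul]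
    refine mul_le_mul (norm_taylorCoeff_le k hs (hG n)
      fun z hz => hGu n z (sphere_subset_closedBall hz)) (hGu n z (sphere_subset_closedBall hz))
      (norm_nonneg _) (div_nonneg (hu0 n) (by positivity))

end RandomAnalytic

/-! ### The shifted series: orthogonality and smallness of its coefficients -/

namespace RandomAnalytic

open Metric Set

variable {κ : ℝ}

/-- The coefficient sequence gives a power series converging absolutely on the disk. -/
def AbsSummable (κ : ℝ) (x : ℕ → ℝ) : Prop :=
  ∀ t, 0 ≤ t → 0 < 1 + κ * t ^ 2 → Summable fun n => |coeff κ n * x n| * t ^ n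

lemma exists_rat_gt_of_pos {t : ℝ} (hκ : κ ≤ 0) (ht : 0 ≤ t) (h : 0 < 1 + κ * t ^ 2) :
    ∃ q : ℚ, t ≤ q ∧ 0 < 1 + κ * (q : ℝ) ^ 2 := by
  obtain ⟨x, htx, hx⟩ := exists_gt_of_pos h
  obtain ⟨q, hq1, hq2⟩ := exists_rat_btwn (Real.lt_sqrt_of_sq_lt htx)
  refine ⟨q, hq1.le, pos_of_le hκ ?_ hx⟩
  exact ((Real.lt_sqrt (ht.trans hq1.le)).1 hq2).le

/-- For one radius t this follows from E|X_n| ≤ 1 and ∑ a_n t^n < ∞. Rational radii exhaust the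
disk, so a single null set serves all of them. -/
lemma IsStandardIID.ae_absSummable {Ω : Type*} [MeasurableSpace Ω] {P : Measure Ω}
    [IsProbabilityMeasure P] {X : ℕ → Ω → ℝ} (hX : IsStandardIID X P) (hκ : κ ≤ 0) :
    ∀ᵐ ω ∂P, AbsSummable κ fun n => X n ω := by
  have h : ∀ q : ℚ, 0 ≤ (q : ℝ) → 0 < 1 + κ * (q : ℝ) ^ 2 →
      ∀ᵐ ω ∂P, Summable fun n => |coeff κ n * X n ω| * (q : ℝ) ^ n := fun q hq hq' =>
    ae_summable_of_lintegral_le (fun k => (coeff_pos hκ k).le) (fun k => by positivity)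
      (fun k => (hX.aemeasurable k).const_mul _)
      (hX.lintegral_enorm_mul_le fun k => (coeff_pos hκ k).le) (summable_coeff hκ hq hq')
  have h' : ∀ᵐ ω ∂P, ∀ q : ℚ, 0 ≤ (q : ℝ) → 0 < 1 + κ * (q : ℝ) ^ 2 →
      Summable fun n => |coeff κ n * X n ω| * (q : ℝ) ^ n := by
    refine ae_all_iff.2 fun q => ?_
    by_cases hq : 0 ≤ (q : ℝ) ∧ 0 < 1 + κ * (q : ℝ) ^ 2
    · filter_upwards [h q hq.1 hq.2] with ω hω _ _ using hω
    · exact ae_of_all _ fun ω h1 h2 => absurd ⟨h1, h2⟩ hq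
  filter_upwards [h'] with ω hω t ht ht'
  obtain ⟨q, hq, hq'⟩ := exists_rat_gt_of_pos hκ ht ht'
  refine Summable.of_nonneg_of_le (fun n => by positivity) (fun n => ?_) (hω q (ht.trans hq) hq')
  gcongr

section Deterministic

variable {x : ℕ → ℝ}

lemma norm_series_term_le {z : ℂ} {t : ℝ} (hz : ‖z‖ ≤ t) (n : ℕ) :
    ‖(coeff κ n : ℂ) * (x n : ℂ) * z ^ n‖ ≤ |coeff κ n * x n| * t ^ n := by
  rw [← Complex.ofReal_mul, norm_mul, Complex.norm_real, Real.norm_eq_abs, norm_pow]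
  gcongr

lemma AbsSummable.summable (hx : AbsSummable κ x) {z : ℂ} (hz : 0 < 1 + κ * ‖z‖ ^ 2) :
    Summable fun n => (coeff κ n : ℂ) * (x n : ℂ) * z ^ n :=
  Summable.of_norm_bounded (hx _ (norm_nonneg z) hz) fun n => norm_series_term_le le_rfl n

lemma AbsSummable.hasSum (hx : AbsSummable κ x) {z : ℂ} (hz : 0 < 1 + κ * ‖z‖ ^ 2) :
    HasSum (fun n => (coeff κ n : ℂ) * (x n : ℂ) * z ^ n) (series κ (fun n => (x n : ℂ)) z) :=
  (hx.summable hz).hasSum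

lemma AbsSummable.differentiableOn (hx : AbsSummable κ x) :
    DifferentiableOn ℂ (series κ fun n => (x n : ℂ)) {z | 0 < 1 + κ * ‖z‖ ^ 2} := by
  intro z hz
  have hz' : 0 < 1 + κ * ‖z‖ ^ 2 := hz
  obtain ⟨y, hzy, hy⟩ := exists_gt_of_pos hz'
  have hy0 : 0 ≤ y := (sq_nonneg _).trans hzy.le
  have h1 : DifferentiableOn ℂ (series κ fun n => (x n : ℂ)) (ball 0 (Real.sqrt y)) := by
    refine Complex.differentiableOn_tsum_of_summable_norm
      (hx (Real.sqrt y) (Real.sqrt_nonneg y) (by rwa [Real.sq_sqrt hy0]))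
      (fun n => (by fun_prop : Differentiable ℂ _).differentiableOn) isOpen_ball
      fun n w hw => norm_series_term_le (mem_ball_zero_iff.1 hw).le n
  exact (h1.differentiableAt (isOpen_ball.mem_nhds
    (mem_ball_zero_iff.2 (Real.lt_sqrt_of_sq_lt hzy)))).differentiableWithinAt

lemma closedBall_subset_sq_region (hκ : κ ≤ 0) {s : ℝ} (hs' : 0 < 1 + κ * s ^ 2) :
    closedBall (0 : ℂ) s ⊆ {z | 0 < 1 + κ * ‖z‖ ^ 2} := by
  intro z hz
  rw [mem_closedBall_zero_iff] at hz
  exact pos_of_le hκ (by gcongr) hs'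

lemma differentiableOn_mobius (hκ : κ ≤ 0) {r : ℝ} (hr : 0 < 1 + κ * r ^ 2) :
    DifferentiableOn ℂ (mobius κ r) {z | 0 < 1 + κ * ‖z‖ ^ 2} := fun _ hz =>
  (hasDerivAt_mobius hκ hr hz).differentiableAt.differentiableWithinAt

lemma differentiableOn_normalizer (hκ : κ ≤ 0) {r : ℝ} (hr : 0 < 1 + κ * r ^ 2) :
    DifferentiableOn ℂ (normalizer κ r) {z | 0 < 1 + κ * ‖z‖ ^ 2} := fun _ hz =>
  (differentiableAt_normalizer hκ hr hz).differentiableWithinAt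

/-- The power series transported by a Möbius transformation, normalized to keep the covariance. -/
noncomputable def shifted (κ : ℝ) (x : ℕ → ℂ) (r : ℝ) (w : ℂ) : ℂ :=
  normalizer κ r w * series κ x (mobius κ ((-r : ℝ) : ℂ) w)

/-- The terms of the transported power series. -/
noncomputable def shiftedTerm (κ r : ℝ) (n : ℕ) (w : ℂ) : ℂ :=
  coeff κ n * (normalizer κ r w * mobius κ ((-r : ℝ) : ℂ) w ^ n)

lemma AbsSummable.differentiableOn_shifted (hx : AbsSummable κ x) (hκ : κ ≤ 0) {r : ℝ}
    (hr : 0 < 1 + κ * r ^ 2) :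
    DifferentiableOn ℂ (shifted κ (fun n => (x n : ℂ)) r) {z | 0 < 1 + κ * ‖z‖ ^ 2} :=
  (differentiableOn_normalizer hκ hr).mul (hx.differentiableOn.comp
    (differentiableOn_mobius hκ (neg_sq_pos hr))
    fun _ hz => one_add_norm_mobius_sq_pos hκ (neg_sq_pos hr) hz)

lemma differentiableOn_shiftedTerm (hκ : κ ≤ 0) {r : ℝ} (hr : 0 < 1 + κ * r ^ 2) (n : ℕ) :
    DifferentiableOn ℂ (shiftedTerm κ r n) {z | 0 < 1 + κ * ‖z‖ ^ 2} :=
  ((differentiableOn_normalizer hκ hr).mul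
    ((differentiableOn_mobius hκ (neg_sq_pos hr)).pow n)).const_mul _

lemma diffContOnCl_shiftedTerm (hκ : κ ≤ 0) {r s : ℝ} (hr : 0 < 1 + κ * r ^ 2)
    (hs : 0 < 1 + κ * s ^ 2) (n : ℕ) : DiffContOnCl ℂ (shiftedTerm κ r n) (ball 0 s) :=
  (differentiableOn_shiftedTerm hκ hr n).diffContOnCl_ball (closedBall_subset_sq_region hκ hs)

lemma exists_norm_mobius_le (hκ : κ ≤ 0) {r s : ℝ} (hr : 0 < 1 + κ * r ^ 2) (hs : 0 ≤ s)
    (hs' : 0 < 1 + κ * s ^ 2) : ∃ t C, 0 ≤ t ∧ 0 < 1 + κ * t ^ 2 ∧ 0 ≤ C ∧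
      ∀ w ∈ closedBall (0 : ℂ) s, ‖mobius κ ((-r : ℝ) : ℂ) w‖ ≤ t ∧ ‖normalizer κ r w‖ ≤ C := by
  have hsub := closedBall_subset_sq_region hκ hs'
  have hne : (closedBall (0 : ℂ) s).Nonempty := ⟨0, mem_closedBall_self hs⟩
  have hcpt := isCompact_closedBall (0 : ℂ) s
  obtain ⟨w₁, hw₁, h1⟩ := hcpt.exists_isMaxOn hne
    ((differentiableOn_mobius hκ (neg_sq_pos hr)).continuousOn.mono hsub).norm
  obtain ⟨w₂, hw₂, h2⟩ := hcpt.exists_isMaxOn hne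
    ((differentiableOn_normalizer hκ hr).continuousOn.mono hsub).norm
  exact ⟨_, _, norm_nonneg _, one_add_norm_mobius_sq_pos hκ (neg_sq_pos hr) (hsub hw₁),
    norm_nonneg _, fun w hw => ⟨h1 hw, h2 hw⟩⟩

lemma norm_shiftedTerm_le (hκ : κ ≤ 0) {r t C : ℝ} {w : ℂ}
    (ht : ‖mobius κ ((-r : ℝ) : ℂ) w‖ ≤ t) (hC : ‖normalizer κ r w‖ ≤ C) (n : ℕ) :
    ‖shiftedTerm κ r n w‖ ≤ C * (coeff κ n * t ^ n) := by
  rw [shiftedTerm, norm_mul, norm_mul, norm_pow, Complex.norm_real,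
    Real.norm_of_nonneg (coeff_pos hκ n).le, mul_left_comm]
  have := (coeff_pos hκ n).le
  have := (norm_nonneg _).trans hC
  gcongr

lemma AbsSummable.hasSum_shiftedTerm (hx : AbsSummable κ x) (hκ : κ ≤ 0) {r : ℝ}
    (hr : 0 < 1 + κ * r ^ 2) {w : ℂ} (hw : 0 < 1 + κ * ‖w‖ ^ 2) :
    HasSum (fun n => (x n : ℂ) * shiftedTerm κ r n w) (shifted κ (fun n => (x n : ℂ)) r w) := by
  refine ((hx.hasSum (one_add_norm_mobius_sq_pos hκ (neg_sq_pos hr) hw)).mul_left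
    (normalizer κ r w)).congr_fun fun n => ?_
  rw [shiftedTerm]
  ring

/-- For real `r` each term commutes with conjugation. The Taylor coefficients of the shifted series
are thus real combinations of the x_n, within reach of the real central limit theorem. -/
lemma taylorCoeff_shiftedTerm (hκ : κ ≤ 0) {r : ℝ} (hr : 0 < 1 + κ * r ^ 2) (k n : ℕ) :
    ((taylorCoeff k (shiftedTerm κ r n)).re : ℂ) = taylorCoeff k (shiftedTerm κ r n) := by
  -- Any disk around 0 inside the domain will do; `x` is its squared radius.
  obtain ⟨x, hx0, hx⟩ := exists_gt_of_pos (κ := κ) (t := 0) (by simp)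
  have hs' : 0 < 1 + κ * Real.sqrt x ^ 2 := by rwa [Real.sq_sqrt hx0.le]
  refine Complex.conj_eq_iff_re.1 (taylorCoeff_conj (Real.sqrt_pos.2 hx0)
    (diffContOnCl_shiftedTerm hκ hr hs' n) (fun z _ => ?_) k)
  rw [shiftedTerm, shiftedTerm, normalizer_conj, mobius_conj]
  simp

lemma AbsSummable.hasSum_taylorCoeff_shifted (hx : AbsSummable κ x) (hκ : κ ≤ 0) {r : ℝ}
    (hr : 0 < 1 + κ * r ^ 2) (k : ℕ) :
    HasSum (fun n => (x n : ℂ) * taylorCoeff k (shiftedTerm κ r n))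
      (taylorCoeff k (shifted κ (fun n => (x n : ℂ)) r)) := by
  obtain ⟨y, hy0, hy⟩ := exists_gt_of_pos (κ := κ) (t := 0) (by simp)
  have hs' : 0 < 1 + κ * Real.sqrt y ^ 2 := by rwa [Real.sq_sqrt hy0.le]
  set s := Real.sqrt y with hs_def
  have hs : 0 < s := Real.sqrt_pos.2 hy0
  have hsub := closedBall_subset_sq_region hκ hs'
  obtain ⟨t, C, ht, ht', hC, hbound⟩ := exists_norm_mobius_le hκ hr hs.le hs'
  have h := hasSum_taylorCoeff_of_hasSum hs
    ((hx.differentiableOn_shifted hκ hr).diffContOnCl_ball hsub)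
    (G := fun n w => (x n : ℂ) * shiftedTerm κ r n w)
    (fun n => (diffContOnCl_shiftedTerm hκ hr hs' n).const_smul (x n : ℂ))
    ((hx t ht ht').mul_left C) (fun n z hz => ?_)
    (fun z hz => hx.hasSum_shiftedTerm hκ hr (hsub (sphere_subset_closedBall hz))) k
  · exact h.congr_fun fun n =>
      (taylorCoeff_const_mul hs (diffContOnCl_shiftedTerm hκ hr hs' n) _ _).symm
  · have h1 := hbound z (sphere_subset_closedBall hz)
    have h2 := norm_shiftedTerm_le hκ h1.1 h1.2 n
    rw [norm_mul, Complex.norm_real, Real.norm_eq_abs, abs_mul, abs_of_pos (coeff_pos hκ n)]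
    calc _ ≤ |x n| * (C * (coeff κ n * t ^ n)) := by gcongr
      _ = _ := by ring

lemma AbsSummable.hasSum_taylorCoeff_shifted_re (hx : AbsSummable κ x) (hκ : κ ≤ 0) {r : ℝ}
    (hr : 0 < 1 + κ * r ^ 2) (k : ℕ) :
    HasSum (fun n => (taylorCoeff k (shiftedTerm κ r n)).re * x n)
      (taylorCoeff k (shifted κ (fun n => (x n : ℂ)) r)).re := by
  refine (Complex.hasSum_re (hx.hasSum_taylorCoeff_shifted hκ hr k)).congr_fun fun n => ?_
  rw [Complex.re_ofReal_mul, mul_comm]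

lemma AbsSummable.taylorCoeff_shifted_re (hx : AbsSummable κ x) (hκ : κ ≤ 0) {r : ℝ}
    (hr : 0 < 1 + κ * r ^ 2) (k : ℕ) :
    ((taylorCoeff k (shifted κ (fun n => (x n : ℂ)) r)).re : ℂ) =
      taylorCoeff k (shifted κ (fun n => (x n : ℂ)) r) := by
  refine HasSum.unique ?_ (hx.hasSum_taylorCoeff_shifted hκ hr k)
  refine (Complex.hasSum_ofReal.2 (hx.hasSum_taylorCoeff_shifted_re hκ hr k)).congr_fun fun n => ?_
  rw [Complex.ofReal_mul, taylorCoeff_shiftedTerm hκ hr, mul_comm]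

/-- By `normalizer_mul_kern` the products of shifted terms add up to k(zw), whose own expansion ∑
a_k² (zw)^k is diagonal. Comparing coefficients gives the claim. -/
lemma hasSum_taylorCoeff_shiftedTerm_mul (hκ : κ ≤ 0) {r : ℝ} (hr : 0 < 1 + κ * r ^ 2) (k l : ℕ) :
    HasSum (fun n => (taylorCoeff k (shiftedTerm κ r n)).re *
      (taylorCoeff l (shiftedTerm κ r n)).re) (if k = l then coeff κ k ^ 2 else 0) := by
  obtain ⟨y, hy0, hy⟩ := exists_gt_of_pos (κ := κ) (t := 0) (by simp)
  have hs' : 0 < 1 + κ * Real.sqrt y ^ 2 := by rwa [Real.sq_sqrt hy0.le]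
  set s := Real.sqrt y with hs_def
  have hs : 0 < s := Real.sqrt_pos.2 hy0
  have hsub := closedBall_subset_sq_region hκ hs'
  obtain ⟨t, C, ht, ht', hC, hbound⟩ := exists_norm_mobius_le hκ hr hs.le hs'
  have h := hasSum_taylorCoeff_mul hs (fun n => diffContOnCl_shiftedTerm hκ hr hs' n)
    ((summable_coeff hκ ht ht').mul_left C)
    (fun n z hz => norm_shiftedTerm_le hκ (hbound z hz).1 (hbound z hz).2 n)
    (b := fun k => ((coeff κ k ^ 2 : ℝ) : ℂ)) (K := fun z w => kern κ (z * w))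
    (fun w hw => ?_) (fun z hz w hw => ?_)
    (fun z hz w hw => hasSum_kern hκ (pos_mul hκ (hsub hz) (hsub hw))) k l
  · rw [← Complex.hasSum_ofReal]
    have h2 : ((if k = l then coeff κ k ^ 2 else 0 : ℝ) : ℂ) =
        if k = l then ((coeff κ k ^ 2 : ℝ) : ℂ) else 0 := by split_ifs <;> simp
    rw [h2]
    refine h.congr_fun fun n => ?_
    rw [Complex.ofReal_mul, taylorCoeff_shiftedTerm hκ hr, taylorCoeff_shiftedTerm hκ hr]
  · refine DifferentiableOn.diffContOnCl_ball (fun z hz => ?_) hsub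
    have h1 : DifferentiableAt ℂ (fun z => kern κ (z * w)) z :=
      (hasDerivAt_kern hκ (pos_mul hκ hz (hsub hw))).differentiableAt.comp
        (f := fun z : ℂ => z * w) z (by fun_prop)
    exact h1.differentiableWithinAt
  · have h1 := hasSum_kern hκ (pos_mul hκ
      (one_add_norm_mobius_sq_pos hκ (neg_sq_pos hr) (hsub hz))
      (one_add_norm_mobius_sq_pos hκ (neg_sq_pos hr) (hsub hw)))
    have h2 := h1.mul_left (normalizer κ r z * normalizer κ r w)
    rw [normalizer_mul_kern hκ hr (hsub hz) (hsub hw)] at h2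
    refine h2.congr_fun fun n => ?_
    rw [shiftedTerm, shiftedTerm]
    push_cast
    ring

/-- The Lindeberg condition. On the circle |w| = s the squared term is |N_r(w)|² times one term of
`kernReal` at |Φ^{-r}(w)|², a small share of the whole, while |N_r(w)|² times the whole is the fixed
number `kernReal κ (s ^ 2)`. Cauchy's estimate passes to the coefficients. -/
lemma eventually_abs_taylorCoeff_shiftedTerm_le (hκ : κ ≤ 0) {r : ℕ → ℝ}
    (hr : ∀ m, 0 < 1 + κ * r m ^ 2)
    (hlim : ∀ x, 0 ≤ x → 0 < 1 + κ * x → ∀ᶠ m in atTop, x < r m ^ 2) (k : ℕ) {δ : ℝ}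
    (hδ : 0 < δ) :
    ∀ᶠ m in atTop, ∀ n, |(taylorCoeff k (shiftedTerm κ (r m) n)).re| ≤ δ := by
  obtain ⟨y, hy0, hy⟩ := exists_gt_of_pos (κ := κ) (t := 0) (by simp)
  have hs' : 0 < 1 + κ * Real.sqrt y ^ 2 := by rwa [Real.sq_sqrt hy0.le]
  set s := Real.sqrt y with hs_def
  have hs : 0 < s := Real.sqrt_pos.2 hy0
  have hsub := closedBall_subset_sq_region hκ hs'
  have hk := kernReal_pos hκ (sq_nonneg s) hs'
  -- This ε makes the terms at most δ s^k on the circle, hence the k-th coefficients at most δ.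
  obtain ⟨x₀, hx₀, hx₀', hterm⟩ := exists_forall_term_le hκ
    (ε := (δ * s ^ k) ^ 2 / kernReal κ (s ^ 2)) (by positivity)
  filter_upwards [eventually_le_norm_mobius_sq hκ hr hlim hs hs' hx₀ hx₀'] with m hm n
  refine (Complex.abs_re_le_norm _).trans ?_
  have h1 := norm_taylorCoeff_le (C := δ * s ^ k) k hs
    (diffContOnCl_shiftedTerm hκ (hr m) hs' n) fun w hw => ?_
  · rwa [mul_div_cancel_right₀ _ (by positivity)] at h1
  · have hw' := hsub (sphere_subset_closedBall hw)
    have hws : ‖w‖ = s := mem_sphere_zero_iff_norm.1 hw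
    have h2 := hterm _ (hm w hws.le) (one_add_norm_mobius_sq_pos hκ (neg_sq_pos (hr m)) hw') n
    have h3 := norm_normalizer_sq hκ (hr m) hw'
    rw [hws] at h3
    refine le_of_sq_le_sq ?_ (by positivity)
    rw [shiftedTerm, norm_mul, norm_mul, norm_pow, Complex.norm_real,
      Real.norm_of_nonneg (coeff_pos hκ n).le]
    calc _ = ‖normalizer κ (r m) w‖ ^ 2 *
          (coeff κ n ^ 2 * (‖mobius κ ((-r m : ℝ) : ℂ) w‖ ^ 2) ^ n) := by ring
      _ ≤ ‖normalizer κ (r m) w‖ ^ 2 * _ := mul_le_mul_of_nonneg_left h2 (sq_nonneg _)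
      _ = (δ * s ^ k) ^ 2 / kernReal κ (s ^ 2) * (‖normalizer κ (r m) w‖ ^ 2 *
          kernReal κ (‖mobius κ ((-r m : ℝ) : ℂ) w‖ ^ 2)) := by ring
      _ = _ := by rw [h3, div_mul_cancel₀ _ hk.ne']

end Deterministic

/-- Convergence of the linear statistics of the transported and normalized power series. -/
theorem tendstoInDistribution_zeroStat_shifted {Ω Ω' : Type*} [MeasurableSpace Ω]
    [MeasurableSpace Ω'] {P : Measure Ω} [IsProbabilityMeasure P] {P' : Measure Ω'}
    [IsProbabilityMeasure P'] {X : ℕ → Ω → ℝ} {Z : ℕ → Ω' → ℝ} (hX : IsStandardIID X P)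
    (hZ : IsStandardIID Z P') (hZlaw : HasLaw (Z 0) (gaussianReal 0 1) P') (hκ : κ ≤ 0)
    {r : ℕ → ℝ} (hr : ∀ m, 0 < 1 + κ * r m ^ 2)
    (hlim : ∀ x, 0 ≤ x → 0 < 1 + κ * x → ∀ᶠ m in atTop, x < r m ^ 2) {R : ℝ} (hR : 0 < R)
    (hR' : 0 < 1 + κ * R ^ 2) {φ : ℂ → ℂ} (hφ : Continuous φ) (hφc : HasCompactSupport φ)
    (hφR : tsupport φ ⊆ ball 0 R) :
    TendstoInDistribution
      (fun m ω => zeroStat (shifted κ (fun n => (X n ω : ℂ)) (r m)) φ) atTop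
      (fun ω => zeroStat (series κ fun n => (Z n ω : ℂ)) φ) (fun _ => P) P' := by
  have hsub := closedBall_subset_sq_region hκ hR'
  refine tendstoInDistribution_zeroStat hX hZ hZlaw (coeff_pos hκ)
    (c := fun m k n => (taylorCoeff k (shiftedTerm κ (r m) n)).re)
    (V := fun m k ω => (taylorCoeff k (shifted κ (fun n => (X n ω : ℂ)) (r m))).re)
    (fun m k => ?_) (fun m k l => hasSum_taylorCoeff_shiftedTerm_mul hκ (hr m) k l)
    (fun k δ hδ => eventually_abs_taylorCoeff_shiftedTerm_le hκ hr hlim k hδ) hR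
    (summable_coeff hκ hR.le hR') (fun m => ?_) ?_ hφ hφc hφR
  · filter_upwards [hX.ae_absSummable hκ] with ω hω
      using hω.hasSum_taylorCoeff_shifted_re hκ (hr m) k
  · filter_upwards [hX.ae_absSummable hκ] with ω hω w hw
    refine (hasSum_taylorCoeff ((hω.differentiableOn_shifted hκ (hr m)).diffContOnCl_ball hsub)
      hw).congr_fun fun k => ?_
    rw [hω.taylorCoeff_shifted_re hκ (hr m)]
  · filter_upwards [hZ.ae_absSummable hκ] with ω hω w hw
    refine (hω.hasSum (hsub (ball_subset_closedBall hw))).congr_fun fun k => ?_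
    push_cast
    ring

end RandomAnalytic

/-! ### Transport of zeros and the main theorem -/

namespace RandomAnalytic

open Metric Set

variable {κ : ℝ}

/-- The bridge from ρ_κ to the polynomial inequality used throughout; for κ = 0 the radius is ∞ as a
negative power of 0. -/
lemma enorm_lt_rho_iff {E : Type*} [SeminormedAddGroup E] (hκ : κ ≤ 0) (z : E) :
    ‖z‖ₑ < rho κ ↔ 0 < 1 + κ * ‖z‖ ^ 2 := by
  rcases hκ.eq_or_lt with rfl | hκ
  · simp [rho, ENNReal.zero_rpow_of_neg]
  · have hpos : 0 < -κ := by linarith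
    have h1 : rho κ = ENNReal.ofReal ((-κ) ^ (-(1 / 2) : ℝ)) := by
      rw [rho, abs_of_neg hκ, ENNReal.ofReal_rpow_of_pos hpos]
    have h2 : ((-κ) ^ (-(1 / 2) : ℝ)) = (Real.sqrt (-κ))⁻¹ := by
      rw [Real.rpow_neg hpos.le, ← Real.sqrt_eq_rpow]
    have hq := Real.sqrt_pos.2 hpos
    rw [h1, h2, ← ofReal_norm, ENNReal.ofReal_lt_ofReal_iff (by positivity),
      ← one_div, lt_div_iff₀ hq]
    have h3 : (‖z‖ * Real.sqrt (-κ)) ^ 2 = -κ * ‖z‖ ^ 2 := by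
      rw [mul_pow, Real.sq_sqrt hpos.le, mul_comm]
    rw [← sq_lt_one_iff₀ (by positivity), h3]
    constructor <;> intro h <;> linarith

lemma disk_eq (hκ : κ ≤ 0) : disk κ = {z | 0 < 1 + κ * ‖z‖ ^ 2} :=
  Set.ext fun z => enorm_lt_rho_iff hκ z

section Deterministic

variable {x : ℕ → ℝ}

lemma AbsSummable.convergesOnDisk (hx : AbsSummable κ x) (hκ : κ ≤ 0) :
    ConvergesOnDisk κ fun n => (x n : ℂ) := fun _ hz =>
  hx.summable ((enorm_lt_rho_iff hκ _).1 hz)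

lemma AbsSummable.exists_series_ne_zero (hx : AbsSummable κ x) (hκ : κ ≤ 0)
    (hne : ∃ n, x n ≠ 0) : ∃ z ∈ {z : ℂ | 0 < 1 + κ * ‖z‖ ^ 2},
      series κ (fun n => (x n : ℂ)) z ≠ 0 := by
  by_contra! h
  obtain ⟨n, hn⟩ := hne
  obtain ⟨y, hy0, hy⟩ := exists_gt_of_pos (κ := κ) (t := 0) (by simp)
  have hs' : 0 < 1 + κ * Real.sqrt y ^ 2 := by rwa [Real.sq_sqrt hy0.le]
  have hs : 0 < Real.sqrt y := Real.sqrt_pos.2 hy0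
  have hsub := ball_subset_closedBall.trans (closedBall_subset_sq_region hκ hs')
  have h1 := taylorCoeff_eq hs (g := series κ fun n => (x n : ℂ))
    (fun z hz => hx.hasSum (hsub hz)) n
  have h2 := taylorCoeff_eq hs (g := series κ fun n => (x n : ℂ)) (b := 0)
    (fun z hz => by simp [h z (hsub hz)]) n
  have h3 : (coeff κ n : ℂ) ≠ 0 := by exact_mod_cast (coeff_pos hκ n).ne'
  rw [h2] at h1
  exact mul_ne_zero h3 (by exact_mod_cast hn) h1.symm

lemma AbsSummable.locallyFiniteZeros (hx : AbsSummable κ x) (hκ : κ ≤ 0) (hne : ∃ n, x n ≠ 0) :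
    LocallyFiniteZeros κ fun n => (x n : ℂ) := by
  intro K hK hKU
  rw [disk_eq hκ] at hKU
  refine (finite_zeros_inter (hx.differentiableOn.analyticOnNhd isOpen_sq_region)
    (convex_sq_region hκ).isPreconnected (hx.exists_series_ne_zero hκ hne) hK hKU).subset ?_
  exact inter_subset_inter_left _ fun z hz => hz.2

lemma analyticOrderNatAt_eq_zero_of_ne {f : ℂ → ℂ} {z : ℂ} (h : f z ≠ 0) :
    analyticOrderNatAt f z = 0 := by
  by_cases hf : AnalyticAt ℂ f z
  · rw [analyticOrderNatAt, hf.analyticOrderAt_eq_zero.2 h, ENat.toNat_zero]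
  · rw [analyticOrderNatAt, analyticOrderAt_of_not_analyticAt hf, ENat.toNat_zero]

/-- The linear statistic is a sum over the disk, since only zeros contribute. -/
lemma zeroSum_eq_finsum (x : ℕ → ℂ) (ψ : ℂ → ℂ) :
    zeroSum κ x ψ = ∑ᶠ ξ ∈ disk κ, (analyticOrderNatAt (series κ x) ξ : ℂ) * ψ ξ := by
  rw [zeroSum]
  refine finsum_mem_inter_support_eq' _ _ _ fun ξ hξ => ?_
  refine ⟨fun h => h.1, fun h => ⟨h, ?_⟩⟩
  by_contra h0
  exact hξ (by simp [analyticOrderNatAt_eq_zero_of_ne h0])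

lemma zeroStat_eq_finsum_mem (f : ℂ → ℂ) {φ : ℂ → ℂ} {U : Set ℂ} (hφ : tsupport φ ⊆ U) :
    zeroStat f φ = ∑ᶠ ξ ∈ U, (analyticOrderNatAt f ξ : ℂ) * φ ξ := by
  rw [zeroStat, ← finsum_mem_univ]
  refine finsum_mem_inter_support_eq' _ _ _ fun ξ hξ => ?_
  simp [hφ (subset_tsupport φ (right_ne_zero_of_mul hξ))]

lemma zeroSum_eq_zeroStat (x : ℕ → ℂ) {φ : ℂ → ℂ} (hφ : tsupport φ ⊆ disk κ) :
    zeroSum κ x φ = zeroStat (series κ x) φ := by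
  rw [zeroSum_eq_finsum, zeroStat_eq_finsum_mem _ hφ]

lemma bijOn_mobius (hκ : κ ≤ 0) {r : ℝ} (hr : 0 < 1 + κ * r ^ 2) :
    BijOn (mobius κ ((-r : ℝ) : ℂ)) (disk κ) (disk κ) := by
  rw [disk_eq hκ]
  refine ⟨fun z hz => one_add_norm_mobius_sq_pos hκ (neg_sq_pos hr) hz, fun z hz w hw h => ?_,
    fun z hz => ⟨mobius κ r z, one_add_norm_mobius_sq_pos hκ hr hz, mobius_neg_mobius hκ hr hz⟩⟩
  rw [← mobius_mobius_neg hκ hr hz, h, mobius_mobius_neg hκ hr hw]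

/-- Multiplicities survive because the normalizer has no zeros and the Möbius map has nonvanishing
derivative. -/
lemma analyticOrderNatAt_shifted (hκ : κ ≤ 0) {r : ℝ} (hr : 0 < 1 + κ * r ^ 2)
    (hx : AbsSummable κ x) {w : ℂ} (hw : 0 < 1 + κ * ‖w‖ ^ 2) :
    analyticOrderNatAt (shifted κ (fun n => (x n : ℂ)) r) w =
      analyticOrderNatAt (series κ fun n => (x n : ℂ)) (mobius κ ((-r : ℝ) : ℂ) w) := by
  have hr' := neg_sq_pos hr
  have h1 : AnalyticAt ℂ (normalizer κ r) w :=
    (differentiableOn_normalizer hκ hr).analyticAt (isOpen_sq_region.mem_nhds hw)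
  have h2 : AnalyticAt ℂ (mobius κ ((-r : ℝ) : ℂ)) w :=
    (differentiableOn_mobius hκ hr').analyticAt (isOpen_sq_region.mem_nhds hw)
  have h3 : AnalyticAt ℂ (series κ fun n => (x n : ℂ)) (mobius κ ((-r : ℝ) : ℂ) w) :=
    hx.differentiableOn.analyticAt
      (isOpen_sq_region.mem_nhds (one_add_norm_mobius_sq_pos hκ hr' hw))
  have h4 : deriv (mobius κ ((-r : ℝ) : ℂ)) w ≠ 0 := by
    rw [(hasDerivAt_mobius hκ hr' hw).deriv]
    exact div_ne_zero (by exact_mod_cast hr'.ne') (pow_ne_zero _ (mobius_denom_ne_zero hκ hr' hw))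
  have h5 : shifted κ (fun n => (x n : ℂ)) r = normalizer κ r *
      ((series κ fun n => (x n : ℂ)) ∘ mobius κ ((-r : ℝ) : ℂ)) := rfl
  rw [analyticOrderNatAt, analyticOrderNatAt, h5, analyticOrderAt_mul h1 (h3.comp h2),
    h1.analyticOrderAt_eq_zero.2 (normalizer_ne_zero hκ hr hw), zero_add,
    analyticOrderAt_comp_of_deriv_ne_zero h2 h4]

lemma AbsSummable.zeroSum_comp_mobius (hx : AbsSummable κ x) (hκ : κ ≤ 0) {r : ℝ}
    (hr : 0 < 1 + κ * r ^ 2) {φ : ℂ → ℂ} (hφ : tsupport φ ⊆ disk κ) :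
    zeroSum κ (fun n => (x n : ℂ)) (fun ξ => φ (mobius κ r ξ)) =
      zeroStat (shifted κ (fun n => (x n : ℂ)) r) φ := by
  rw [zeroSum_eq_finsum, zeroStat_eq_finsum_mem _ hφ]
  refine (finsum_mem_eq_of_bijOn _ (bijOn_mobius hκ hr) fun w hw => ?_).symm
  rw [disk_eq hκ] at hw
  rw [analyticOrderNatAt_shifted hκ hr hx hw, mobius_mobius_neg hκ hr hw]

lemma exists_radius (hκ : κ ≤ 0) {K : Set ℂ} (hK : IsCompact K) (hKU : K ⊆ disk κ) :
    ∃ R, 0 < R ∧ 0 < 1 + κ * R ^ 2 ∧ K ⊆ ball 0 R := by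
  rcases K.eq_empty_or_nonempty with rfl | hne
  · obtain ⟨y, hy0, hy⟩ := exists_gt_of_pos (κ := κ) (t := 0) (by simp)
    exact ⟨Real.sqrt y, Real.sqrt_pos.2 hy0, by rwa [Real.sq_sqrt hy0.le], empty_subset _⟩
  · obtain ⟨w, hw, hmax⟩ := hK.exists_isMaxOn hne continuous_norm.continuousOn
    obtain ⟨y, hwy, hy⟩ := exists_gt_of_pos ((enorm_lt_rho_iff hκ w).1 (hKU hw))
    have hwy' := Real.lt_sqrt_of_sq_lt hwy
    refine ⟨Real.sqrt y, (norm_nonneg w).trans_lt hwy', ?_, fun z hz => ?_⟩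
    · rwa [Real.sq_sqrt ((sq_nonneg _).trans hwy.le)]
    · exact mem_ball_zero_iff.2 ((hmax hz).trans_lt hwy')

end Deterministic

lemma eventually_lt_sq_of_tendsto (hκ : κ ≤ 0) {r : ℕ → ℝ}
    (hlim : Tendsto (fun m => ‖r m‖ₑ) atTop (𝓝 (rho κ))) {x : ℝ} (hx : 0 ≤ x)
    (hx' : 0 < 1 + κ * x) : ∀ᶠ m in atTop, x < r m ^ 2 := by
  have h1 : ‖Real.sqrt x‖ₑ < rho κ := by
    rw [enorm_lt_rho_iff hκ, Real.norm_eq_abs, sq_abs, Real.sq_sqrt hx]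
    exact hx'
  filter_upwards [hlim.eventually (lt_mem_nhds h1)] with m hm
  rw [← ofReal_norm, ← ofReal_norm, ENNReal.ofReal_lt_ofReal_iff_of_nonneg (norm_nonneg _),
    Real.norm_of_nonneg (Real.sqrt_nonneg x), Real.norm_eq_abs] at hm
  rw [← sq_abs]
  exact (Real.sqrt_lt' ((Real.sqrt_nonneg x).trans_lt hm)).1 hm

end RandomAnalytic

theorem theorem2
    {Ω Ω' : Type*} [MeasurableSpace Ω] [MeasurableSpace Ω']
    (P : Measure Ω) [IsProbabilityMeasure P] (P' : Measure Ω') [IsProbabilityMeasure P']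
    -- `X 0, X 1, …` are i.i.d. real random variables with mean zero and variance one
    (X : ℕ → Ω → ℝ) (hX_indep : iIndepFun X P)
    (hX_ident : ∀ n, IdentDistrib (X n) (X 0) P P)
    (hX_sq : MemLp (X 0) 2 P) (hX_mean : ∫ ω, X 0 ω ∂P = 0) (hX_var : Var[X 0; P] = 1)
    -- `Z 0, Z 1, …` are i.i.d. real standard normal random variables
    (Z : ℕ → Ω' → ℝ) (hZ_indep : iIndepFun Z P')
    (hZ_law : ∀ n, HasLaw (Z n) (gaussianReal 0 1) P')
    (κ : ℝ) (hκ : κ ≤ 0) :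
    -- the random power series and their zero sets are almost surely well behaved
    (∀ᵐ ω ∂P, RandomAnalytic.ConvergesOnDisk κ (fun k => (X k ω : ℂ)) ∧
      RandomAnalytic.LocallyFiniteZeros κ (fun k => (X k ω : ℂ))) ∧
    (∀ᵐ ω ∂P', RandomAnalytic.ConvergesOnDisk κ (fun k => (Z k ω : ℂ)) ∧
      RandomAnalytic.LocallyFiniteZeros κ (fun k => (Z k ω : ℂ))) ∧
    -- convergence in distribution of the linear statistics of the zeros
    ∀ φ : ℂ → ℂ, Continuous φ → HasCompactSupport φ → tsupport φ ⊆ RandomAnalytic.disk κ →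
      ∀ r : ℕ → ℝ, (∀ m, ‖r m‖ₑ < RandomAnalytic.rho κ) →
        Tendsto (fun m => ‖r m‖ₑ) atTop (𝓝 (RandomAnalytic.rho κ)) →
        TendstoInDistribution
          (fun (m : ℕ) (ω : Ω) => RandomAnalytic.zeroSum κ (fun k => (X k ω : ℂ))
            (fun ξ => φ (RandomAnalytic.mobius κ (r m : ℂ) ξ)))
          atTop
          (fun ω : Ω' => RandomAnalytic.zeroSum κ (fun k => (Z k ω : ℂ)) φ)
          (fun _ => P) P' := by

  have hX : RandomAnalytic.IsStandardIID X P := ⟨hX_indep, hX_ident, hX_sq, hX_mean, hX_var⟩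
  have hZ : RandomAnalytic.IsStandardIID Z P' := .of_gaussian hZ_indep hZ_law
  refine ⟨?_, ?_, fun φ hφ hφc hφU r hr hlim => ?_⟩
  · filter_upwards [hX.ae_absSummable hκ, hX.ae_exists_ne_zero] with ω h1 h2
    exact ⟨h1.convergesOnDisk hκ, h1.locallyFiniteZeros hκ h2⟩
  · filter_upwards [hZ.ae_absSummable hκ, hZ.ae_exists_ne_zero] with ω h1 h2
    exact ⟨h1.convergesOnDisk hκ, h1.locallyFiniteZeros hκ h2⟩
  · have hr' : ∀ m, 0 < 1 + κ * r m ^ 2 := fun m => by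
      have := (RandomAnalytic.enorm_lt_rho_iff hκ (r m)).1 (hr m)
      rwa [Real.norm_eq_abs, sq_abs] at this
    obtain ⟨R, hR, hR', hφR⟩ := RandomAnalytic.exists_radius hκ hφc hφU
    refine (RandomAnalytic.tendstoInDistribution_zeroStat_shifted hX hZ (hZ_law 0) hκ hr'
      (fun x hx hx' => RandomAnalytic.eventually_lt_sq_of_tendsto hκ hlim hx hx') hR hR' hφ hφc
      hφR).congr (fun m => ?_) (ae_of_all _ fun ω => ?_)
    -- Transporting multiplicities uses analyticity of the series, so this identity is only claimed
    -- almost surely.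
    · filter_upwards [hX.ae_absSummable hκ] with ω hω
      exact (hω.zeroSum_comp_mobius hκ (hr' m) hφU).symm
    · exact (RandomAnalytic.zeroSum_eq_zeroStat _ hφU).symm
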